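/- **Setup.** Let $n,\kappa\ge 1$ be integers and $F$ a field. The *graded unipotent group* $U=U_n^\kappa(F[X])$ is the group generated by symbols $e_{i,j}(f)$, where $0\le i<j\le n$ and $f\in F[X]$ has degree at most $\kappa(j-i)$, subject to the Steinberg relations (with $[g,h]=g^{-1}h^{-1}gh$): - $e_{i,j}(f)\,e_{i,j}(g)=e_{i,j}(f+g)$ for $i<j$; - $[e_{i,j}(f),e_{j,k}(g)]=e_{i,k}(fg)$ for $i<j<k$; - $[e_{i,j}(f),e_{k,l}(g)]=1$ for $i<j$, $k<l$ with $j\ne k$ and $i\ne l$. For $1\le \ell\le n$, the *staircase subgroup* $U_\ell\le U$ is generated by those $e_{i,j}(f)$ with $\ell\notin\{i+1,\dots,j\}$. Let $\mathcal H=(H_i)_{i\in I}$ be a family of subgroups of a group $G$. A *word over $\mathcal H$* is a finite string whose letters are elements of $\bigcup_i H_i$ (with no cancellation built in); its *evaluation* is the product of its letters in $G$, and it is a *relator* if its evaluation is $1$. Inverses of words are formal: reverse the string and invert each letter. Let $\sim$ be the equivalence relation on words generated by $xy\sim yx$ and $x\sim x^{-1}$. A word $x$ is *derived from* $y$ *via*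 a relator $r$ if there are words $p,q,u,v$ over $\mathcal H$ with $x\sim puq$, $y\sim pvq$ and $uv^{-1}\sim r$. An *in-subgroup relator of length $3$* is a relator of length $3$ whose three letters all lie in a single $H_i$. The *area* of a relator $w$ is the least number of successive derivation steps, each via an in-subgroup relator of length $3$, that reduce $w$ to the empty word ($\infty$ if this is impossible). Let $\operatorname{diam}(G;\mathcal H)$ be the supremum over $g\in G$ of the least length of a word over $\mathcal H$ with evaluation $g$ ($\infty$ if some $g$ has no such word), and let $\operatorname{area}_T(G;\mathcal H)$ be the supremum of the areas of all relators over $\mathcal H$ of length at most $T$. **Theorem 1.4 (Unipotent group presentation bounds).** For every real $\xi>0$ there exist $C_0,C\in\mathbb N$ such that for all sufficiently large $n$ (depending only on $\xi$) the following holds. For every field $F$, every integer $\kappa\ge1$, and all integers $1\le\ell_1<\ell_2<\ell_3\le n$ with $\ell_2-\ell_1\ge\xi n$ and $\ell_3-\ell_2\ge\xi n$, $$\operatorname{diam}\bigl(U;(U_{\ell_1},U_{\ell_2})\bigr)\le C_0 \qquad\text{and}\qquad \operatorname{area}_{2C_0+1}\bigl(U;(U_{\ell_1},U_{\ell_2},U_{\ell_3})\bigr)\le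 C,$$ where $U=U_n^\kappa(F[X])$. -/

import Mathlib

namespace UnipPres

open scoped Polynomial

section SubgroupWords

variable {G : Type*} [Group G] {ι : Type*} (H : ι → Subgroup G)

/-- Words over the subgroup family `H`: strings of formal letters, each letter being an
element of the union of the subgroups `H i`. No cancellation is built in. -/
abbrev SubWord : Type _ := List {g : G // ∃ i, g ∈ H i}

variable {H}

/-- The evaluation of a word: the ordered product of its letters in `G`. -/
def SubWord.eval (w : SubWord H) : G := (w.map Subtype.val).prod

/-- The formal inverse of a word: reverse it and invert each letter. -/
def SubWord.inv (w : SubWord H) : SubWord H :=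
  (w.map fun g => ⟨g.1⁻¹, g.2.imp fun _ h => inv_mem h⟩).reverse

/-- A relator is a word that evaluates to the identity. -/
def SubWord.IsRelator (w : SubWord H) : Prop := w.eval = 1

/-- The elementary moves `x y ↦ y x` and `x ↦ x⁻¹` on words. -/
inductive SubWord.Move : SubWord H → SubWord H → Prop
  | rotate (x y : SubWord H) : SubWord.Move (x ++ y) (y ++ x)
  | inv (x : SubWord H) : SubWord.Move x x.inv

/-- The equivalence relation `∼` on words generated by `x y ∼ y x` and `x ∼ x⁻¹`. -/
def SubWord.Sim (x y : SubWord H) : Prop := Relation.EqvGen SubWord.Move x y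

/-- `x` is derived from `y` via `r`: for some words `p, q, u, v`,
`x ∼ p u q`, `y ∼ p v q` and `u v⁻¹ ∼ r`. -/
def SubWord.DerivedVia (r x y : SubWord H) : Prop :=
  ∃ p q u v : SubWord H,
    SubWord.Sim x (p ++ u ++ q) ∧ SubWord.Sim y (p ++ v ++ q) ∧ SubWord.Sim (u ++ v.inv) r

/-- In-subgroup relators of length `k`: relators of length exactly `k` all of whose letters
lie in one and the same subgroup of the family. -/
def SubWord.IsInSubgroupRelator (k : ℕ) (r : SubWord H) : Prop :=
  r.length = k ∧ r.IsRelator ∧ ∃ i, ∀ g ∈ r, g.1 ∈ H i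

/-- `w.ReducesIn k`: the word `w` is reduced to the empty word by exactly `k` derivation
steps, each of them via an in-subgroup relator of length `3`. -/
inductive SubWord.ReducesIn : ℕ → SubWord H → Prop
  | nil : SubWord.ReducesIn 0 []
  | step {k : ℕ} {w w' r : SubWord H} (hr : r.IsInSubgroupRelator 3)
      (hd : SubWord.DerivedVia r w' w) (h : SubWord.ReducesIn k w') :
      SubWord.ReducesIn (k + 1) w

/-- The least number of derivation steps (via in-subgroup relators of length `3`) that
reduce `w` to the empty word; it is `⊤` if this is impossible. -/
noncomputable def SubWord.area (w : SubWord H) : ℕ∞ :=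
  ⨅ (k : ℕ) (_ : w.ReducesIn k), (k : ℕ∞)

variable (H)

/-- The group diameter: the largest, over `g ∈ G`, least length of a word over `H` that
evaluates to `g` (`⊤` if some `g` has no such word or if the lengths are unbounded). -/
noncomputable def gdiam : ℕ∞ :=
  ⨆ g : G, ⨅ (w : SubWord H) (_ : w.eval = g), (w.length : ℕ∞)

/-- The largest area of a relator over `H` of length at most `T`. -/
noncomputable def garea (T : ℕ) : ℕ∞ :=
  ⨆ (w : SubWord H) (_ : w.IsRelator ∧ w.length ≤ T), w.area

end SubgroupWords

section GradedUnipotent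

variable (F : Type*) [Field F] (n κ : ℕ)

/-- The generator symbols `e_{i,j}(f)`: indices `i < j` in `{0, …, n}` and a polynomial
`f ∈ F[X]` of degree at most `κ (j - i)`. -/
structure Gate where
  src : Fin (n + 1)
  tgt : Fin (n + 1)
  src_lt_tgt : src < tgt
  poly : F[X]
  natDegree_le : poly.natDegree ≤ κ * ((tgt : ℕ) - (src : ℕ))

variable {F n κ}

theorem natDegree_add_le_of {d : ℕ} {f g : F[X]} (hf : f.natDegree ≤ d)
    (hg : g.natDegree ≤ d) : (f + g).natDegree ≤ d :=
  (Polynomial.natDegree_add_le f g).trans (max_le hf hg)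

theorem natDegree_mul_le_of {i j k : Fin (n + 1)} (hij : i < j) (hjk : j < k) {f g : F[X]}
    (hf : f.natDegree ≤ κ * ((j : ℕ) - (i : ℕ))) (hg : g.natDegree ≤ κ * ((k : ℕ) - (j : ℕ))) :
    (f * g).natDegree ≤ κ * ((k : ℕ) - (i : ℕ)) := by
  have h1 : (i : ℕ) < j := hij
  have h2 : (j : ℕ) < k := hjk
  have h3 : (k : ℕ) - i = (j - i) + (k - j) := by omega
  rw [h3, mul_add]
  exact Polynomial.natDegree_mul_le.trans (add_le_add hf hg)

/-- The commutator `[g, h] = g⁻¹ h⁻¹ g h`. -/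
def comm {G : Type*} [Group G] (g h : G) : G := g⁻¹ * h⁻¹ * g * h

/-- The Steinberg relators (a relation `x = y` is encoded as the relator `x y⁻¹`). -/
inductive SteinbergRel : FreeGroup (Gate F n κ) → Prop
  /-- `e_{i,j}(f) e_{i,j}(g) = e_{i,j}(f + g)` -/
  | linearity {i j : Fin (n + 1)} (hij : i < j) (f g : F[X])
      (hf : f.natDegree ≤ κ * ((j : ℕ) - (i : ℕ))) (hg : g.natDegree ≤ κ * ((j : ℕ) - (i : ℕ))) :
      SteinbergRel
        (FreeGroup.of ⟨i, j, hij, f, hf⟩ * FreeGroup.of ⟨i, j, hij, g, hg⟩ *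
          (FreeGroup.of ⟨i, j, hij, f + g, natDegree_add_le_of hf hg⟩)⁻¹)
  /-- `[e_{i,j}(f), e_{j,k}(g)] = e_{i,k}(f g)` -/
  | nontrivialComm {i j k : Fin (n + 1)} (hij : i < j) (hjk : j < k) (f g : F[X])
      (hf : f.natDegree ≤ κ * ((j : ℕ) - (i : ℕ))) (hg : g.natDegree ≤ κ * ((k : ℕ) - (j : ℕ))) :
      SteinbergRel
        (comm (FreeGroup.of ⟨i, j, hij, f, hf⟩) (FreeGroup.of ⟨j, k, hjk, g, hg⟩) *
          (FreeGroup.of ⟨i, k, hij.trans hjk, f * g, natDegree_mul_le_of hij hjk hf hg⟩)⁻¹)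
  /-- `[e_{i,j}(f), e_{k,l}(g)] = 1` whenever `j ≠ k` and `i ≠ l` -/
  | trivialComm (x y : Gate F n κ) (h₁ : x.tgt ≠ y.src) (h₂ : x.src ≠ y.tgt) :
      SteinbergRel (comm (FreeGroup.of x) (FreeGroup.of y))

variable (F n κ)

/-- The graded unipotent group, defined by generators and the Steinberg relations. -/
abbrev GrUnip : Type _ := PresentedGroup {r : FreeGroup (Gate F n κ) | SteinbergRel r}

/-- The staircase subgroup of `ℓ`: generated by the `e_{i,j}(f)` with `ℓ ∉ (i, j]`. -/
def stair (ℓ : ℕ) : Subgroup (GrUnip F n κ) :=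
  Subgroup.closure
    {g | ∃ x : Gate F n κ, ℓ ∉ Set.Ioc (x.src : ℕ) (x.tgt : ℕ) ∧ PresentedGroup.of x = g}

end GradedUnipotent

end UnipPres

/-!
The graded unipotent group `U` is the group of matrices `1 + y` with `y` strictly upper triangular
over `F[X]` and `deg y i j ≤ κ (j - i)` (`toMat_injective`, `exists_toMat_eq`), and the staircase
subgroup of `ℓ` consists of those that vanish at the positions `i < ℓ ≤ j` (`mem_stair_iff`).

*From bounds to a group identity.* If the areas of relators of bounded length were unbounded over
some class of groups, then a sequence of counterexamples, read as one relator in the product of the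
groups, would have no derivation at all. So it is enough to show that in every countable product of
the groups in question, a relator over the three subgroups is trivial in the colimit of the
subgroups, that is, that the colimit embeds (`exists_garea_le`, `ColimitInjective`). The proof
may use only identities that pass to products: the number of their terms has to be bounded
independently of `n`, `κ` and `F`. This is where the gaps `ξ n` enter.

*Bounded factorizations.* The cuts `ℓ₁ < ℓ₂ < ℓ₃` divide the indices into blocks `A`, `B`, `C`, `D`;
the block `B` is divided further into `B₁` and `B₂`. With a step `h` proportional to `n`, there are
boundedly many *anchors* `E t` in the block `A B₁`, whose entries are powers of `X`, such that each
matrix in the blocks `A C` and `A D` has the form `∑ t, E t * r t` with `r t` in `B₁ C` and `B₁ D`: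
expand each entry along powers of `X` whose exponents have gaps at most `κ h`
(`exists_eq_sum_anchor_mul`). The same works for `A C` through `B₂`, and for `B D` through `C`. The
syzygies of the anchors are generated by those between consecutive powers of `X`, so those in `B₁ D`
factor through syzygies in `B₁ C` (`exists_block_syz`). The structure `BlockSystem` collects these
facts, and passes to products.

*Injectivity of the colimit.* No subgroup contains the block `A D`, so its image in the colimit has
to be constructed. Elements of `A B` and `B D` have commutators in the colimit; those of `A Bᵢ` and
`Bⱼ D` with `i ≠ j` are trivial because `Bⱼ D` factors through `C`. Writing a product in `A D` both
through `B` and through `C` (`bracket_assoc`) shows that these commutators are central, and the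
syzygies show that they depend on the product of the two factors alone. This gives a homomorphism
from `A D` to the colimit (`exists_cornerMap`). With it, the whole last block column maps to the
colimit, and the image of the subgroup of the third cut normalizes it. Hence each word is a last
block column times one letter from that subgroup (`exists_word_normalForm`), and such a product is
trivial as soon as its matrix is (`prod_map_eq_one`).

*The diameter.* Up to a factor in the subgroup of `ℓ₂` and one in that of `ℓ₁`, a matrix is
concentrated in `A C` and `A D`. There it is a bounded product of commutators of anchors, which lie
in the subgroup of `ℓ₂`, with elements of the subgroup of `ℓ₁` (`exists_word_prod_eq`).
-/

namespace UnipPres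

/-! ### Derivations and the colimit of a family of subgroups -/

section Derivations

variable {G : Type*} [Group G] {ι : Type*} {H : ι → Subgroup G}

namespace SubWord

theorem inv_append (x y : SubWord H) : (x ++ y).inv = y.inv ++ x.inv := by
  simp [SubWord.inv]

theorem inv_inv (x : SubWord H) : x.inv.inv = x := by
  induction x with
  | nil => rfl
  | cons a x ih =>
    have h : (a :: x : SubWord H) = [a] ++ x := rfl
    rw [h, inv_append, inv_append, ih]
    simp [SubWord.inv]

/-- One rewriting step `p u q ↦ p v q` with `u v⁻¹` an in-subgroup relator of length `3`, without
passing to equivalent words first. -/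
inductive Step : SubWord H → SubWord H → Prop
  | mk (p q u v r : SubWord H) (hr : r.IsInSubgroupRelator 3) (h : Sim (u ++ v.inv) r) :
      Step (p ++ u ++ q) (p ++ v ++ q)

theorem Step.symm {x y : SubWord H} (h : Step x y) : Step y x := by
  obtain ⟨p, q, u, v, r, hr, h⟩ := h
  refine ⟨p, q, v, u, r, hr, ?_⟩
  have h1 : Sim (u ++ v.inv) (v ++ u.inv) := by
    have := Relation.EqvGen.rel _ _ (Move.inv (u ++ v.inv))
    rwa [inv_append, inv_inv] at this
  exact (h1.symm _ _).trans _ _ _ h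

theorem Step.append {x y : SubWord H} (h : Step x y) (a b : SubWord H) :
    Step (a ++ x ++ b) (a ++ y ++ b) := by
  obtain ⟨p, q, u, v, r, hr, h⟩ := h
  simpa using Step.mk (a ++ p) (q ++ b) u v r hr h

theorem eqvGen_step_append {x y : SubWord H} (h : Relation.EqvGen Step x y) (a b : SubWord H) :
    Relation.EqvGen Step (a ++ x ++ b) (a ++ y ++ b) := by
  induction h with
  | rel x y h => exact .rel _ _ (h.append a b)
  | refl x => exact .refl _
  | symm x y _ ih => exact .symm _ _ ih
  | trans x y z _ _ ih ih' => exact .trans _ _ _ ih ih'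

theorem Step.exists_derivedVia {x y : SubWord H} (h : Step x y) :
    ∃ r : SubWord H, r.IsInSubgroupRelator 3 ∧ DerivedVia r x y := by
  obtain ⟨p, q, u, v, r, hr, h⟩ := h
  exact ⟨r, hr, p, q, u, v, .refl _, .refl _, h⟩

theorem exists_reducesIn_iff_of_eqvGen {x y : SubWord H} (h : Relation.EqvGen Step x y) :
    (∃ k, x.ReducesIn k) ↔ ∃ k, y.ReducesIn k := by
  induction h with
  | rel x y h =>
    constructor
    · rintro ⟨k, hk⟩
      obtain ⟨r, hr, hd⟩ := h.exists_derivedVia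
      exact ⟨k + 1, .step hr hd hk⟩
    · rintro ⟨k, hk⟩
      obtain ⟨r, hr, hd⟩ := h.symm.exists_derivedVia
      exact ⟨k + 1, .step hr hd hk⟩
  | refl x => rfl
  | symm x y _ ih => exact ih.symm
  | trans x y z _ _ ih ih' => exact ih.trans ih'

theorem area_le_of_reducesIn {w : SubWord H} {k : ℕ} (h : w.ReducesIn k) : w.area ≤ k :=
  iInf₂_le k h

end SubWord

open SubWord

variable (H) in
/-- The congruence on words generated by the replacements `u ↦ v` for which `u v⁻¹` is an
in-subgroup relator of length `3`. -/
def wordCon : Con (FreeMonoid {g : G // ∃ i, g ∈ H i}) :=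
  conGen fun u v => ∃ r : SubWord H, r.IsInSubgroupRelator 3 ∧
    Sim ((FreeMonoid.toList u : SubWord H) ++ SubWord.inv (FreeMonoid.toList v)) r

theorem eqvGen_step_of_wordCon {u v : FreeMonoid {g : G // ∃ i, g ∈ H i}} (h : wordCon H u v) :
    Relation.EqvGen Step (FreeMonoid.toList u : SubWord H) (FreeMonoid.toList v) := by
  change ConGen.Rel _ u v at h
  induction h with
  | of x y h =>
    obtain ⟨r, hr, h⟩ := h
    simpa using Relation.EqvGen.rel _ _ (Step.mk [] [] _ _ r hr h)
  | refl x => exact .refl _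
  | symm _ ih => exact .symm _ _ ih
  | trans _ _ ih ih' => exact .trans _ _ _ ih ih'
  | @mul w x y z _ _ ih ih' =>
    have h1 := eqvGen_step_append ih [] (FreeMonoid.toList y)
    have h2 := eqvGen_step_append ih' (FreeMonoid.toList x) []
    simp only [List.nil_append, List.append_nil] at h1 h2
    rw [FreeMonoid.toList_mul, FreeMonoid.toList_mul]
    exact .trans _ _ _ h1 h2

variable (H) in
/-- The colimit of the family `H`: words modulo in-subgroup relators of length `3`. -/
abbrev Amalgam : Type _ := (wordCon H).Quotient

/-- The class of a one-letter word. -/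
def letterClass (g : {g : G // ∃ i, g ∈ H i}) : Amalgam H :=
  ((FreeMonoid.of g : FreeMonoid _) : (wordCon H).Quotient)

theorem letterClass_mul {i : ι} {g h : G} (hg : g ∈ H i) (hh : h ∈ H i) :
    letterClass ⟨g, i, hg⟩ * letterClass ⟨h, i, hh⟩ =
      (letterClass ⟨g * h, i, mul_mem hg hh⟩ : Amalgam H) := by
  refine (Con.eq (wordCon H)).2 (ConGen.Rel.of _ _ ?_)
  refine ⟨[⟨g, i, hg⟩, ⟨h, i, hh⟩, ⟨(g * h)⁻¹, i, inv_mem (mul_mem hg hh)⟩], ⟨rfl, ?_, i, ?_⟩, ?_⟩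
  · simp [SubWord.IsRelator, SubWord.eval]
  · intro x hx
    simp only [List.mem_cons, List.not_mem_nil, or_false] at hx
    rcases hx with rfl | rfl | rfl
    exacts [hg, hh, inv_mem (mul_mem hg hh)]
  · exact .refl _

theorem letterClass_one (i : ι) : (letterClass ⟨1, i, one_mem _⟩ : Amalgam H) = 1 := by
  have h2 := letterClass_mul (one_mem (H i)) (one_mem (H i))
  simp only [mul_one] at h2
  have h3 : (letterClass ⟨1, i, one_mem _⟩ * letterClass ⟨1, i, one_mem _⟩ *
      letterClass ⟨1, i, one_mem _⟩ : Amalgam H) = 1 := by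
    refine (Con.eq (wordCon H)).2 (ConGen.Rel.of _ _ ?_)
    refine ⟨[⟨1, i, one_mem _⟩, ⟨1, i, one_mem _⟩, ⟨1, i, one_mem _⟩], ⟨rfl, ?_, i, ?_⟩, ?_⟩
    · simp [SubWord.IsRelator, SubWord.eval]
    · intro x hx
      simp only [List.mem_cons, List.not_mem_nil, or_false, or_self] at hx
      subst hx
      exact one_mem _
    · exact .refl _
  rw [h2, h2] at h3
  exact h3

/-- The class of a letter as a unit of the colimit. -/
def letterUnit (g : {g : G // ∃ i, g ∈ H i}) : (Amalgam H)ˣ where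
  val := letterClass g
  inv := letterClass ⟨g.1⁻¹, g.2.imp fun _ h => inv_mem h⟩
  val_inv := by
    obtain ⟨g, i, hg⟩ := g
    rw [letterClass_mul hg (inv_mem hg)]
    simpa using letterClass_one i
  inv_val := by
    obtain ⟨g, i, hg⟩ := g
    rw [letterClass_mul (inv_mem hg) hg]
    simpa using letterClass_one i

open Classical in
variable (H) in
/-- The map to the units of the colimit, extended by `1` to elements that are not letters. -/
noncomputable def toAmalgam (g : G) : (Amalgam H)ˣ :=
  if h : ∃ i, g ∈ H i then letterUnit ⟨g, h⟩ else 1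

theorem toAmalgam_mul {i : ι} {g h : G} (hg : g ∈ H i) (hh : h ∈ H i) :
    toAmalgam H (g * h) = toAmalgam H g * toAmalgam H h := by
  have h1 : ∃ i, g ∈ H i := ⟨i, hg⟩
  have h2 : ∃ i, h ∈ H i := ⟨i, hh⟩
  have h3 : ∃ i, g * h ∈ H i := ⟨i, mul_mem hg hh⟩
  rw [toAmalgam, toAmalgam, toAmalgam, dif_pos h1, dif_pos h2, dif_pos h3]
  ext
  exact (letterClass_mul hg hh).symm

/-- A word that dies in the colimit can be reduced to the empty word. -/
theorem exists_reducesIn_of_toAmalgam (w : SubWord H)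
    (hw : (w.map fun g => toAmalgam H g.1).prod = 1) : ∃ k, w.ReducesIn k := by
  have h1 : ∀ w : SubWord H, (((w.map fun g => toAmalgam H g.1).prod : (Amalgam H)ˣ) : Amalgam H) =
      ((FreeMonoid.ofList w : FreeMonoid _) : (wordCon H).Quotient) := by
    intro w
    induction w with
    | nil => rfl
    | cons a w ih =>
      rw [List.map_cons, List.prod_cons, Units.val_mul, ih, FreeMonoid.ofList_cons, Con.coe_mul]
      congr 1
      rw [toAmalgam, dif_pos a.2]
      rfl
  have h2 := h1 w
  rw [hw] at h2
  have h3 := eqvGen_step_of_wordCon ((Con.eq (wordCon H)).1 h2.symm)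
  exact (exists_reducesIn_iff_of_eqvGen h3).2 ⟨0, .nil⟩

end Derivations

/-! ### Functoriality of derivations -/

section Functoriality

variable {G G' : Type*} [Group G] [Group G'] {ι : Type*} {H : ι → Subgroup G}
  {H' : ι → Subgroup G'} (f : G →* G') (hf : ∀ i, ∀ g ∈ H i, f g ∈ H' i)

namespace SubWord

/-- The image of a word under a homomorphism that respects the subgroup families. -/
def mapHom (w : SubWord H) : SubWord H' :=
  w.map fun g => ⟨f g.1, g.2.imp fun i h => hf i _ h⟩

theorem mapHom_append (x y : SubWord H) : (x ++ y).mapHom f hf = x.mapHom f hf ++ y.mapHom f hf :=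
  List.map_append

theorem mapHom_inv (x : SubWord H) : x.inv.mapHom f hf = (x.mapHom f hf).inv := by
  simp [mapHom, SubWord.inv, Function.comp_def]

theorem Sim.mapHom {x y : SubWord H} (h : Sim x y) : Sim (x.mapHom f hf) (y.mapHom f hf) := by
  induction h with
  | rel x y h =>
    refine .rel _ _ ?_
    cases h with
    | rotate x y =>
      rw [mapHom_append, mapHom_append]
      exact .rotate _ _
    | inv x =>
      rw [mapHom_inv]
      exact .inv _
  | refl x => exact .refl _
  | symm x y _ ih => exact .symm _ _ ih
  | trans x y z _ _ ih ih' => exact .trans _ _ _ ih ih'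

theorem eval_mapHom (w : SubWord H) : (w.mapHom f hf).eval = f w.eval := by
  simp [mapHom, SubWord.eval, map_list_prod, Function.comp_def]

theorem IsInSubgroupRelator.mapHom {k : ℕ} {r : SubWord H} (h : r.IsInSubgroupRelator k) :
    (r.mapHom f hf).IsInSubgroupRelator k := by
  obtain ⟨h1, h2, i, h3⟩ := h
  refine ⟨by simpa [SubWord.mapHom] using h1, ?_, i, ?_⟩
  · rw [IsRelator, eval_mapHom, show r.eval = 1 from h2, map_one]
  · intro g hg
    obtain ⟨g', hg', rfl⟩ := List.mem_map.1 hg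
    exact hf i _ (h3 _ hg')

theorem ReducesIn.mapHom {k : ℕ} {w : SubWord H} (h : w.ReducesIn k) :
    (w.mapHom f hf).ReducesIn k := by
  induction h with
  | nil => exact .nil
  | step hr hd _ ih =>
    refine .step (hr.mapHom f hf) ?_ ih
    obtain ⟨p, q, u, v, h1, h2, h3⟩ := hd
    refine ⟨p.mapHom f hf, q.mapHom f hf, u.mapHom f hf, v.mapHom f hf, ?_, ?_, ?_⟩
    · simpa only [mapHom_append] using h1.mapHom f hf
    · simpa only [mapHom_append] using h2.mapHom f hf
    · simpa only [mapHom_append, mapHom_inv] using h3.mapHom f hf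

end SubWord

end Functoriality

/-! ### Compactness: uniform area bounds from products -/

section Compactness

universe u

/-- Every map `θ` from `G` to a group which is multiplicative on each `H i` kills the lists of
elements of the `H i` with product `1`. For `θ` the map to the colimit of the `H i` this says that
the colimit embeds into `G`. -/
def ColimitInjective {G : Type u} [Group G] {ι : Type*} (H : ι → Subgroup G) : Prop :=
  ∀ (Γ : Type u) [Group Γ] (θ : G → Γ),
    (∀ i, ∀ g ∈ H i, ∀ h ∈ H i, θ (g * h) = θ g * θ h) →
      ∀ L : List G, (∀ g ∈ L, ∃ i, g ∈ H i) → L.prod = 1 → (L.map θ).prod = 1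

theorem ColimitInjective.exists_reducesIn {G : Type u} [Group G] {ι : Type*} {H : ι → Subgroup G}
    (hH : ColimitInjective H) (w : SubWord H) (hw : w.IsRelator) : ∃ k, w.ReducesIn k := by
  refine exists_reducesIn_of_toAmalgam w ?_
  have := hH (Amalgam H)ˣ (toAmalgam H) (fun i g hg h hh => toAmalgam_mul hg hh)
    (w.map Subtype.val) (by
      intro g hg
      obtain ⟨x, -, rfl⟩ := List.mem_map.1 hg
      exact x.2) hw
  rwa [List.map_map] at this

variable {P : Type*} (G : P → Type u) [∀ p, Group (G p)] {ι : Type*} (H : ∀ p, ι → Subgroup (G p))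

/-- Compactness for relators with a prescribed distribution of the letters over the subgroups: if
the areas were unbounded, the product of a sequence of counterexamples would be a relator in the
product group that has no derivation. -/
theorem exists_area_le_of_pattern
    (hH : ∀ s : ℕ → P, ColimitInjective fun i => Subgroup.pi Set.univ fun k => H (s k) i)
    (L : List ι) : ∃ C : ℕ, ∀ p, ∀ w : SubWord (H p), w.IsRelator →
      List.Forall₂ (fun (g : {g : G p // ∃ i, g ∈ H p i}) i => g.1 ∈ H p i) w L → w.area ≤ C := by
  by_contra! hcon
  choose s w hw hL hC using hcon
  have hlen : ∀ k, (w k).length = L.length := fun k => (hL k).length_eq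
  have hmem : ∀ (t : Fin L.length) (k : ℕ),
      ((w k).get (t.cast (hlen k).symm)).1 ∈ H (s k) (L.get t) := fun t k =>
    (List.forall₂_iff_get.1 (hL k)).2 t.1 ((hlen k).symm ▸ t.2) t.2
  let W : SubWord (fun i => Subgroup.pi Set.univ fun k => H (s k) i) :=
    List.ofFn fun t : Fin L.length =>
      ⟨fun k => ((w k).get (t.cast (hlen k).symm)).1, L.get t, fun k _ => hmem t k⟩
  have hproj : ∀ k, W.mapHom (Pi.evalMonoidHom (fun k => G (s k)) k)
      (H := fun i => Subgroup.pi Set.univ fun k => H (s k) i) (H' := H (s k))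
        (fun i g hg => hg k trivial) = w k := by
    intro k
    refine List.ext_get ?_ ?_
    · simp [SubWord.mapHom, W, hlen k]
    · intro t h1 h2
      ext
      simp [SubWord.mapHom, W]
  have hrel : W.IsRelator := by
    rw [SubWord.IsRelator]
    funext k
    have := SubWord.eval_mapHom (Pi.evalMonoidHom (fun k => G (s k)) k)
      (H := fun i => Subgroup.pi Set.univ fun k => H (s k) i) (H' := H (s k))
        (fun i g hg => hg k trivial) W
    rw [hproj k, show (w k).eval = 1 from hw k] at this
    exact this.symm
  obtain ⟨k, hk⟩ := (hH s).exists_reducesIn W hrel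
  have := hk.mapHom (Pi.evalMonoidHom (fun k => G (s k)) k)
      (H := fun i => Subgroup.pi Set.univ fun k => H (s k) i) (H' := H (s k))
        (fun i g hg => hg k trivial)
  rw [hproj k] at this
  exact (hC k).not_ge (SubWord.area_le_of_reducesIn this)

/-- A family of groups whose sequential products all embed the colimit of their subgroups has
uniformly bounded areas. -/
theorem exists_garea_le [Finite ι]
    (hH : ∀ s : ℕ → P, ColimitInjective fun i => Subgroup.pi Set.univ fun k => H (s k) i)
    (T : ℕ) : ∃ C : ℕ, ∀ p, garea (H p) T ≤ C := by
  choose C hC using exists_area_le_of_pattern G H hH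
  have hfin : {L : List ι | L.length ≤ T}.Finite := List.finite_length_le ι T
  obtain ⟨M, hM⟩ := (hfin.image C).bddAbove
  refine ⟨M, fun p => iSup₂_le fun w hw => ?_⟩
  obtain ⟨hw, hlen⟩ := hw
  have hf : List.Forall₂ (fun (g : {g : G p // ∃ i, g ∈ H p i}) i => g.1 ∈ H p i) w
      (w.map fun g => g.2.choose) := by
    rw [List.forall₂_map_right_iff, List.forall₂_same]
    exact fun g _ => g.2.choose_spec
  refine (hC _ p w hw hf).trans ?_
  exact_mod_cast hM ⟨_, by simpa using hlen, rfl⟩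

end Compactness

end UnipPres

namespace UnipPres

open scoped Polynomial

/-! ### The matrix model of the graded unipotent group -/

section MatrixModel

variable {F : Type*} [Field F] {n κ : ℕ}

theorem one_add_mul_one_add {R : Type*} [Ring R] (a b : R) :
    (1 + a) * (1 + b) = 1 + (a + b + a * b) := by
  noncomm_ring

/-- The unitriangular matrix `1 + f E_{ij}` attached to a generator symbol. -/
noncomputable def gateUnit (x : Gate F n κ) : (Matrix (Fin (n + 1)) (Fin (n + 1)) F[X])ˣ where
  val := 1 + Matrix.single x.src x.tgt x.poly
  inv := 1 - Matrix.single x.src x.tgt x.poly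
  val_inv := by
    have h : Matrix.single x.src x.tgt x.poly * Matrix.single x.src x.tgt x.poly = 0 :=
      Matrix.single_mul_single_of_ne _ _ _ _ x.src_lt_tgt.ne' _
    rw [sub_eq_add_neg, one_add_mul_one_add, mul_neg, h, neg_zero, add_zero, add_neg_cancel,
      add_zero]
  inv_val := by
    have h : Matrix.single x.src x.tgt x.poly * Matrix.single x.src x.tgt x.poly = 0 :=
      Matrix.single_mul_single_of_ne _ _ _ _ x.src_lt_tgt.ne' _
    rw [sub_eq_add_neg, one_add_mul_one_add, neg_mul, h, neg_zero, add_zero, neg_add_cancel,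
      add_zero]

theorem comm_mul_inv_eq_one_iff {G : Type*} [Group G] {g h k : G} :
    comm g h * k⁻¹ = 1 ↔ g * h = h * g * k := by
  rw [mul_inv_eq_one, comm]
  constructor
  · rintro rfl
    group
  · intro h1
    rw [mul_assoc, h1]
    group

theorem gateUnit_relators (r : FreeGroup (Gate F n κ)) (hr : SteinbergRel r) :
    FreeGroup.lift gateUnit r = 1 := by
  cases hr with
  | @linearity i j hij f g hf hg =>
    simp only [map_mul, map_inv, FreeGroup.lift_apply_of]
    rw [mul_inv_eq_one]
    ext1
    have h : Matrix.single i j f * Matrix.single i j g = 0 :=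
      Matrix.single_mul_single_of_ne _ _ _ _ hij.ne' _
    simp only [gateUnit, Units.val_mul]
    rw [one_add_mul_one_add, h, Matrix.single_add, add_zero]
  | @nontrivialComm i j k hij hjk f g hf hg =>
    simp only [map_mul, map_inv, FreeGroup.lift_apply_of, comm]
    refine comm_mul_inv_eq_one_iff.2 ?_
    ext1
    have h1 : Matrix.single i j f * Matrix.single j k g = Matrix.single i k (f * g) :=
      Matrix.single_mul_single_same _ _ _ _ _
    have h2 : Matrix.single j k g * Matrix.single i j f = 0 :=
      Matrix.single_mul_single_of_ne _ _ _ _ (hij.trans hjk).ne' _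
    have h3 : Matrix.single i j f * Matrix.single i k (f * g) = 0 :=
      Matrix.single_mul_single_of_ne _ _ _ _ hij.ne' _
    have h4 : Matrix.single j k g * Matrix.single i k (f * g) = 0 :=
      Matrix.single_mul_single_of_ne _ _ _ _ (hij.trans hjk).ne' _
    simp only [gateUnit, Units.val_mul]
    simp only [mul_add, add_mul, one_mul, mul_one, h1, h2, h3, h4, zero_mul]
    abel
  | trivialComm x y h1 h2 =>
    simp only [map_mul, map_inv, FreeGroup.lift_apply_of, comm]
    rw [← mul_one (_ * _), ← inv_one]
    refine comm_mul_inv_eq_one_iff.2 ?_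
    ext1
    have h3 : Matrix.single x.src x.tgt x.poly * Matrix.single y.src y.tgt y.poly = 0 :=
      Matrix.single_mul_single_of_ne _ _ _ _ h1 _
    have h4 : Matrix.single y.src y.tgt y.poly * Matrix.single x.src x.tgt x.poly = 0 :=
      Matrix.single_mul_single_of_ne _ _ _ _ h2.symm _
    simp only [gateUnit, Units.val_mul, Units.val_one]
    simp only [mul_add, add_mul, one_mul, mul_one, h3, h4]
    abel

/-- The representation of the graded unipotent group by unitriangular matrices. -/
noncomputable def toMat : GrUnip F n κ →* Matrix (Fin (n + 1)) (Fin (n + 1)) F[X] :=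
  (Units.coeHom _).comp (PresentedGroup.toGroup (f := gateUnit) gateUnit_relators)

theorem toMat_of (x : Gate F n κ) :
    toMat (PresentedGroup.of x : GrUnip F n κ) = 1 + Matrix.single x.src x.tgt x.poly := by
  simp only [toMat, MonoidHom.comp_apply, PresentedGroup.toGroup.of]
  rfl

variable (F n κ) in
/-- The strictly upper triangular matrices whose `(i, j)` entry has degree at most `κ (j - i)`. -/
def gradedStrict : AddSubgroup (Matrix (Fin (n + 1)) (Fin (n + 1)) F[X]) where
  carrier := {y | ∀ i j, (y i j).natDegree ≤ κ * ((j : ℕ) - (i : ℕ)) ∧ (j ≤ i → y i j = 0)}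
  add_mem' {y z} hy hz i j := by
    refine ⟨natDegree_add_le_of (hy i j).1 (hz i j).1, fun h => ?_⟩
    rw [Matrix.add_apply, (hy i j).2 h, (hz i j).2 h, add_zero]
  zero_mem' i j := by simp
  neg_mem' {y} hy i j := by
    refine ⟨?_, fun h => ?_⟩
    · rw [Matrix.neg_apply, Polynomial.natDegree_neg]
      exact (hy i j).1
    · rw [Matrix.neg_apply, (hy i j).2 h, neg_zero]

theorem mul_mem_gradedStrict {y z : Matrix (Fin (n + 1)) (Fin (n + 1)) F[X]}
    (hy : y ∈ gradedStrict F n κ) (hz : z ∈ gradedStrict F n κ) : y * z ∈ gradedStrict F n κ := by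
  intro i j
  rw [Matrix.mul_apply]
  constructor
  · refine Polynomial.natDegree_sum_le_of_forall_le _ _ fun k _ => ?_
    by_cases h1 : k ≤ i
    · rw [(hy i k).2 h1]; simp
    by_cases h2 : j ≤ k
    · rw [(hz k j).2 h2]; simp
    exact natDegree_mul_le_of (not_le.1 h1) (not_le.1 h2) (hy i k).1 (hz k j).1
  · intro h
    refine Finset.sum_eq_zero fun k _ => ?_
    by_cases h1 : k ≤ i
    · rw [(hy i k).2 h1, zero_mul]
    · rw [(hz k j).2 (h.trans (not_le.1 h1).le), mul_zero]

theorem single_mem_gradedStrict {i j : Fin (n + 1)} (hij : i < j) {f : F[X]}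
    (hf : f.natDegree ≤ κ * ((j : ℕ) - (i : ℕ))) :
    Matrix.single i j f ∈ gradedStrict F n κ := by
  intro k l
  by_cases h : i = k ∧ j = l
  · obtain ⟨rfl, rfl⟩ := h
    rw [Matrix.single_apply_same]
    exact ⟨hf, fun h => absurd hij h.not_gt⟩
  · rw [Matrix.single_apply_of_ne _ _ _ _ _ h]
    simp

open Classical in
/-- The generator `e_{ij}(f)`, extended by `1` to inadmissible `i, j, f`. -/
noncomputable def elem (κ : ℕ) (i j : Fin (n + 1)) (f : F[X]) : GrUnip F n κ :=
  if h : i < j ∧ f.natDegree ≤ κ * ((j : ℕ) - (i : ℕ)) then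
    PresentedGroup.of ⟨i, j, h.1, f, h.2⟩ else 1

theorem elem_eq {i j : Fin (n + 1)} (hij : i < j) {f : F[X]}
    (hf : f.natDegree ≤ κ * ((j : ℕ) - (i : ℕ))) :
    elem κ i j f = PresentedGroup.of ⟨i, j, hij, f, hf⟩ := dif_pos ⟨hij, hf⟩

theorem of_eq_elem (x : Gate F n κ) : PresentedGroup.of x = elem κ x.src x.tgt x.poly :=
  (elem_eq x.src_lt_tgt x.natDegree_le).symm

theorem elem_of_le {i j : Fin (n + 1)} (hij : j ≤ i) (f : F[X]) : elem κ i j f = 1 :=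
  dif_neg fun h => hij.not_gt h.1

theorem mk_steinbergRel {r : FreeGroup (Gate F n κ)} (hr : SteinbergRel r) :
    PresentedGroup.mk {r : FreeGroup (Gate F n κ) | SteinbergRel r} r = 1 :=
  PresentedGroup.mk_eq_one_iff.2 (Subgroup.subset_normalClosure hr)

theorem elem_add {i j : Fin (n + 1)} (hij : i < j) {f g : F[X]}
    (hf : f.natDegree ≤ κ * ((j : ℕ) - (i : ℕ))) (hg : g.natDegree ≤ κ * ((j : ℕ) - (i : ℕ))) :
    elem κ i j (f + g) = elem κ i j f * elem κ i j g := by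
  rw [elem_eq hij hf, elem_eq hij hg, elem_eq hij (natDegree_add_le_of hf hg)]
  have := mk_steinbergRel (SteinbergRel.linearity hij f g hf hg)
  rw [map_mul, map_inv, mul_inv_eq_one, map_mul] at this
  exact this.symm

theorem elem_zero (i j : Fin (n + 1)) : elem κ i j (0 : F[X]) = 1 := by
  by_cases hij : i < j
  · have := elem_add (κ := κ) hij (f := (0 : F[X])) (g := 0) (by simp) (by simp)
    rw [add_zero] at this
    exact right_eq_mul.1 this
  · exact elem_of_le (not_lt.1 hij) _

theorem commute_elem {i j k l : Fin (n + 1)} (h1 : j ≠ k) (h2 : i ≠ l) (f g : F[X]) :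
    Commute (elem κ i j f) (elem κ k l g) := by
  by_cases hf : i < j ∧ f.natDegree ≤ κ * ((j : ℕ) - (i : ℕ))
  · by_cases hg : k < l ∧ g.natDegree ≤ κ * ((l : ℕ) - (k : ℕ))
    · rw [elem_eq hf.1 hf.2, elem_eq hg.1 hg.2]
      have := mk_steinbergRel
        (SteinbergRel.trivialComm ⟨i, j, hf.1, f, hf.2⟩ ⟨k, l, hg.1, g, hg.2⟩ h1 h2)
      simp only [comm, map_mul, map_inv] at this
      have h3 := comm_mul_inv_eq_one_iff (k := (1 : GrUnip F n κ)).1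
        (by rw [inv_one, mul_one]; exact this)
      rwa [mul_one] at h3
    · rw [show elem κ k l g = 1 from dif_neg hg]
      exact Commute.one_right _
  · rw [show elem κ i j f = 1 from dif_neg hf]
    exact Commute.one_left _

theorem elem_mul_elem {i j k : Fin (n + 1)} (hij : i < j) (hjk : j < k) {f g : F[X]}
    (hf : f.natDegree ≤ κ * ((j : ℕ) - (i : ℕ))) (hg : g.natDegree ≤ κ * ((k : ℕ) - (j : ℕ))) :
    elem κ i j f * elem κ j k g = elem κ j k g * elem κ i k (f * g) * elem κ i j f := by
  have hc : Commute (elem κ i k (f * g)) (elem κ i j f) :=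
    commute_elem (hij.trans hjk).ne' hij.ne _ _
  rw [mul_assoc, hc.eq, ← mul_assoc, elem_eq hij hf, elem_eq hjk hg,
    elem_eq (hij.trans hjk) (natDegree_mul_le_of hij hjk hf hg)]
  have := mk_steinbergRel (SteinbergRel.nontrivialComm hij hjk f g hf hg)
  simp only [comm, map_mul, map_inv] at this
  exact comm_mul_inv_eq_one_iff.1 this

/-- The product of the generators `e_{ij}(v i)` over the list `l` of row indices. -/
noncomputable def colProd (κ : ℕ) (j : Fin (n + 1)) (v : Fin (n + 1) → F[X])
    (l : List (Fin (n + 1))) : GrUnip F n κ :=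
  (l.map fun i => elem κ i j (v i)).prod

theorem commute_colProd {i j k : Fin (n + 1)} (hkj : k < j) (f : F[X])
    (v : Fin (n + 1) → F[X]) (l : List (Fin (n + 1))) (hl : i ∉ l) :
    Commute (elem κ k i f) (colProd κ j v l) := by
  refine Commute.list_prod_right _ _ fun x hx => ?_
  obtain ⟨m, hm, rfl⟩ := List.mem_map.1 hx
  exact commute_elem (by rintro rfl; exact hl hm) hkj.ne _ _

theorem colProd_congr {j : Fin (n + 1)} {v w : Fin (n + 1) → F[X]} {l : List (Fin (n + 1))}
    (h : ∀ i ∈ l, i < j → v i = w i) : colProd κ j v l = colProd κ j w l := by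
  rw [colProd, colProd]
  congr 1
  refine List.map_congr_left fun i hi => ?_
  by_cases hij : i < j
  · rw [h i hi hij]
  · rw [elem_of_le (not_lt.1 hij), elem_of_le (not_lt.1 hij)]

theorem elem_mul_colProd_same {j k : Fin (n + 1)} (hkj : k < j) {f : F[X]}
    (hf : f.natDegree ≤ κ * ((j : ℕ) - (k : ℕ)))
    {v : Fin (n + 1) → F[X]} (hv : (v k).natDegree ≤ κ * ((j : ℕ) - (k : ℕ)))
    (l : List (Fin (n + 1))) (hl : l.Nodup) (hk : k ∈ l) :
    elem κ k j f * colProd κ j v l = colProd κ j (Function.update v k (v k + f)) l := by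
  induction l with
  | nil => simp at hk
  | cons a l ih =>
    rw [List.nodup_cons] at hl
    simp only [colProd, List.map_cons, List.prod_cons] at ih ⊢
    by_cases hak : a = k
    · subst hak
      rw [← mul_assoc, ← elem_add hkj hf hv, Function.update_self, add_comm]
      congr 1
      exact colProd_congr fun i hi _ => by
        rw [Function.update_of_ne]
        rintro rfl
        exact hl.1 hi
    · have hk' : k ∈ l := (List.mem_cons.1 hk).resolve_left fun h => hak h.symm
      rw [Function.update_of_ne hak, ← ih hl.2 hk', ← mul_assoc, ← mul_assoc]
      congr 1
      by_cases haj : a < j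
      · exact (commute_elem haj.ne' hkj.ne _ _).eq
      · rw [elem_of_le (not_lt.1 haj), mul_one, one_mul]

/-- A generator moves through a column to its right, and acts on it by a row operation. -/
theorem elem_mul_colProd {i j k : Fin (n + 1)} (hki : k < i) (hij : i < j) {f : F[X]}
    (hf : f.natDegree ≤ κ * ((i : ℕ) - (k : ℕ)))
    {v : Fin (n + 1) → F[X]} (hv : (v i).natDegree ≤ κ * ((j : ℕ) - (i : ℕ)))
    (l : List (Fin (n + 1))) (hl : l.Nodup) (hi : i ∈ l) :
    elem κ k i f * colProd κ j v l = elem κ k j (f * v i) * colProd κ j v l * elem κ k i f := by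
  induction l with
  | nil => simp at hi
  | cons a l ih =>
    rw [List.nodup_cons] at hl
    have hcons : ∀ b : Fin (n + 1), colProd κ j v (b :: l) = elem κ b j (v b) * colProd κ j v l :=
      fun b => by simp [colProd]
    rw [hcons]
    by_cases hai : a = i
    · subst hai
      have h1 := (commute_colProd (κ := κ) (hki.trans hij) f v l hl.1).eq
      have h2 : Commute (elem κ a j (v a)) (elem κ k j (f * v a)) :=
        commute_elem (hki.trans hij).ne' hij.ne _ _
      rw [← mul_assoc, elem_mul_elem hki hij hf hv, h2.eq, mul_assoc, h1]
      simp only [mul_assoc]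
    · have hi' : i ∈ l := (List.mem_cons.1 hi).resolve_left fun h => hai h.symm
      have h1 : Commute (elem κ k i f) (elem κ a j (v a)) :=
        commute_elem (fun h => hai h.symm) (hki.trans hij).ne _ _
      have h2 : Commute (elem κ a j (v a)) (elem κ k j (f * v i)) := by
        by_cases haj : a < j
        · exact commute_elem (hki.trans hij).ne' haj.ne _ _
        · rw [elem_of_le (not_lt.1 haj)]
          exact Commute.one_left _
      rw [← mul_assoc, h1.eq, mul_assoc, ih hl.2 hi', ← mul_assoc, ← mul_assoc, ← mul_assoc, h2.eq]

/-- The normal form of a unitriangular matrix restricted to the columns in the list `L`. -/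
noncomputable def normalForm (κ : ℕ) (M : Matrix (Fin (n + 1)) (Fin (n + 1)) F[X])
    (L : List (Fin (n + 1))) : GrUnip F n κ :=
  (L.map fun j => colProd κ j (fun i => M i j) (List.finRange (n + 1))).prod

theorem normalForm_congr {M M' : Matrix (Fin (n + 1)) (Fin (n + 1)) F[X]}
    {L : List (Fin (n + 1))} (h : ∀ j ∈ L, ∀ i, i < j → M i j = M' i j) :
    normalForm κ M L = normalForm κ M' L := by
  rw [normalForm, normalForm]
  congr 1
  exact List.map_congr_left fun j hj => colProd_congr fun i _ hij => h j hj i hij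

/-- Multiplying a normal form from the left by a generator is the corresponding row operation:
the generator moves to the right through the columns until it is absorbed in its own. -/
theorem elem_mul_normalForm {k l : Fin (n + 1)} (hkl : k < l) {f : F[X]}
    (hf : f.natDegree ≤ κ * ((l : ℕ) - (k : ℕ)))
    {y : Matrix (Fin (n + 1)) (Fin (n + 1)) F[X]} (hy : y ∈ gradedStrict F n κ)
    (L : List (Fin (n + 1))) (hL : L.Pairwise (· > ·)) (hl : l ∈ L) :
    elem κ k l f * normalForm κ (1 + y) L =
      normalForm κ ((1 + Matrix.single k l f) * (1 + y)) L := by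
  have hrow : ∀ i j, ((1 + Matrix.single k l f) * (1 + y)) i j =
      (1 + y) i j + if i = k then f * (1 + y) l j else 0 := by
    intro i j
    rw [add_mul, one_mul, Matrix.add_apply]
    split_ifs with h
    · subst h
      rw [Matrix.single_mul_apply_same]
    · rw [Matrix.single_mul_apply_of_ne _ _ _ _ _ h]
  have hdeg : ∀ i j, i < j → ((1 + y) i j).natDegree ≤ κ * ((j : ℕ) - (i : ℕ)) := by
    intro i j hij
    rw [Matrix.add_apply, Matrix.one_apply_ne hij.ne, zero_add]
    exact (hy i j).1
  induction L with
  | nil => simp at hl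
  | cons j L ih =>
    rw [List.pairwise_cons] at hL
    have hcons : ∀ M : Matrix (Fin (n + 1)) (Fin (n + 1)) F[X], normalForm κ M (j :: L) =
        colProd κ j (fun i => M i j) (List.finRange (n + 1)) * normalForm κ M L :=
      fun b => by simp [normalForm]
    rw [hcons, hcons]
    by_cases hlj : l = j
    · subst hlj
      rw [← mul_assoc, elem_mul_colProd_same (v := fun i => (1 + y) i l) hkl hf (hdeg k l hkl)
        _ (List.nodup_finRange _)
        (List.mem_finRange k)]
      congr 1
      · refine colProd_congr fun i _ hil => ?_
        rw [hrow]
        by_cases hik : i = k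
        · subst hik
          have h1 : (1 + y) l l = 1 := by
            rw [Matrix.add_apply, (hy l l).2 le_rfl, Matrix.one_apply_eq, add_zero]
          rw [Function.update_self, if_pos rfl, h1, mul_one]
        · rw [Function.update_of_ne hik, if_neg hik, add_zero]
      · refine normalForm_congr fun j hj i hij => ?_
        have hjl : j < l := hL.1 j hj
        have h0 : (1 + y) l j = 0 := by
          rw [Matrix.add_apply, (hy l j).2 hjl.le, Matrix.one_apply_ne hjl.ne', add_zero]
        rw [hrow, h0, mul_zero, ite_self, add_zero]
    · have hl' : l ∈ L := (List.mem_cons.1 hl).resolve_left hlj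
      have hlj' : l < j := hL.1 l hl'
      rw [← mul_assoc, elem_mul_colProd (v := fun i => (1 + y) i j) hkl hlj' hf (hdeg l j hlj') _
        (List.nodup_finRange _) (List.mem_finRange l), mul_assoc, ih hL.2 hl',
        elem_mul_colProd_same (v := fun i => (1 + y) i j) (hkl.trans hlj')
        (natDegree_mul_le_of hkl hlj' hf (hdeg l j hlj')) (hdeg k j (hkl.trans hlj')) _
        (List.nodup_finRange _) (List.mem_finRange k)]
      congr 1
      refine colProd_congr fun i _ _ => ?_
      rw [hrow]
      by_cases hik : i = k
      · subst hik
        rw [Function.update_self, if_pos rfl]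
      · rw [Function.update_of_ne hik, if_neg hik, add_zero]

theorem normalForm_one (L : List (Fin (n + 1))) :
    normalForm κ (1 : Matrix (Fin (n + 1)) (Fin (n + 1)) F[X]) L = 1 := by
  refine List.prod_eq_one fun x hx => ?_
  obtain ⟨j, -, rfl⟩ := List.mem_map.1 hx
  refine List.prod_eq_one fun x hx => ?_
  obtain ⟨i, -, rfl⟩ := List.mem_map.1 hx
  by_cases hij : i < j
  · simp only [Matrix.one_apply_ne hij.ne, elem_zero]
  · exact elem_of_le (not_lt.1 hij) _

theorem elem_neg {i j : Fin (n + 1)} (f : F[X]) : elem κ i j (-f) = (elem κ i j f)⁻¹ := by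
  by_cases h : i < j ∧ f.natDegree ≤ κ * ((j : ℕ) - (i : ℕ))
  · rw [eq_inv_iff_mul_eq_one, ← elem_add h.1 (by simpa using h.2) h.2, neg_add_cancel, elem_zero]
  · rw [elem, elem, dif_neg h, dif_neg, inv_one]
    rwa [Polynomial.natDegree_neg]

theorem toMat_elem {i j : Fin (n + 1)} (hij : i < j) {f : F[X]}
    (hf : f.natDegree ≤ κ * ((j : ℕ) - (i : ℕ))) :
    toMat (elem κ i j f) = 1 + Matrix.single i j f := by
  rw [elem_eq hij hf, toMat_of]

/-- The column indices in decreasing order. -/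
def descCols (n : ℕ) : List (Fin (n + 1)) := (List.finRange (n + 1)).reverse

theorem mem_descCols (j : Fin (n + 1)) : j ∈ descCols n :=
  List.mem_reverse.2 (List.mem_finRange j)

theorem pairwise_descCols : (descCols n).Pairwise (· > ·) := by
  rw [descCols, List.pairwise_reverse]
  exact List.pairwise_lt_finRange _

theorem elem_mul_spec {k l : Fin (n + 1)} (hkl : k < l) {f : F[X]}
    (hf : f.natDegree ≤ κ * ((l : ℕ) - (k : ℕ))) {g : GrUnip F n κ}
    (hg : toMat g - 1 ∈ gradedStrict F n κ ∧ normalForm κ (toMat g) (descCols n) = g) :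
    toMat (elem κ k l f * g) - 1 ∈ gradedStrict F n κ ∧
      normalForm κ (toMat (elem κ k l f * g)) (descCols n) = elem κ k l f * g := by
  obtain ⟨h1, h2⟩ := hg
  obtain ⟨y, hy⟩ : ∃ y, toMat g = 1 + y := ⟨toMat g - 1, by abel⟩
  rw [hy, add_sub_cancel_left] at h1
  rw [hy] at h2
  rw [map_mul, toMat_elem hkl hf, hy]
  refine ⟨?_, ?_⟩
  · have h3 := single_mem_gradedStrict hkl hf
    have h4 : (1 + Matrix.single k l f) * (1 + y) - 1 =
        Matrix.single k l f + y + Matrix.single k l f * y := by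
      rw [one_add_mul_one_add, add_sub_cancel_left]
    rw [h4]
    exact add_mem (add_mem h3 h1) (mul_mem_gradedStrict h3 h1)
  · rw [← elem_mul_normalForm hkl hf h1 _ pairwise_descCols (mem_descCols l), h2]

/-- Each element is the normal form of its matrix, so it is determined by the matrix. -/
theorem toMat_spec (g : GrUnip F n κ) :
    toMat g - 1 ∈ gradedStrict F n κ ∧ normalForm κ (toMat g) (descCols n) = g := by
  have hg : g ∈ Subgroup.closure (Set.range (PresentedGroup.of : Gate F n κ → GrUnip F n κ)) := by
    rw [PresentedGroup.closure_range_of]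
    trivial
  induction hg using Subgroup.closure_induction_left with
  | one => exact ⟨by simp, by rw [map_one, normalForm_one]⟩
  | mul_left x hx y _ ih =>
    obtain ⟨x, rfl⟩ := hx
    rw [of_eq_elem]
    exact elem_mul_spec x.src_lt_tgt x.natDegree_le ih
  | inv_mul_cancel x hx y _ ih =>
    obtain ⟨x, rfl⟩ := hx
    rw [of_eq_elem, ← elem_neg]
    exact elem_mul_spec x.src_lt_tgt (by rw [Polynomial.natDegree_neg]; exact x.natDegree_le) ih

theorem toMat_injective : Function.Injective (toMat : GrUnip F n κ → _) := fun g h hgh => by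
  rw [← (toMat_spec g).2, hgh, (toMat_spec h).2]

theorem toMat_colProd {y : Matrix (Fin (n + 1)) (Fin (n + 1)) F[X]} (hy : y ∈ gradedStrict F n κ)
    (j : Fin (n + 1)) (l : List (Fin (n + 1))) :
    toMat (colProd κ j (fun i => (1 + y) i j) l) =
      1 + (l.map fun i => Matrix.single i j (y i j)).sum := by
  induction l with
  | nil => simp [colProd]
  | cons a l ih =>
    simp only [colProd, List.map_cons, List.prod_cons, List.sum_cons, map_mul] at ih ⊢
    rw [ih]
    by_cases haj : a < j
    · rw [Matrix.add_apply, Matrix.one_apply_ne haj.ne, zero_add, toMat_elem haj (hy a j).1]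
      have h : Matrix.single a j (y a j) * (l.map fun i => Matrix.single i j (y i j)).sum = 0 := by
        rw [← List.sum_map_mul_left]
        refine List.sum_eq_zero fun x hx => ?_
        obtain ⟨i, -, rfl⟩ := List.mem_map.1 hx
        by_cases hij : i < j
        · exact Matrix.single_mul_single_of_ne _ _ _ _ hij.ne' _
        · rw [(hy i j).2 (not_lt.1 hij), Matrix.single_zero, mul_zero]
      rw [one_add_mul_one_add, h, add_zero]
    · rw [elem_of_le (not_lt.1 haj), (hy a j).2 (not_lt.1 haj), Matrix.single_zero, map_one,
        one_mul, zero_add]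

theorem toMat_normalForm {y : Matrix (Fin (n + 1)) (Fin (n + 1)) F[X]}
    (hy : y ∈ gradedStrict F n κ) (L : List (Fin (n + 1))) (hL : L.Pairwise (· > ·)) :
    toMat (normalForm κ (1 + y) L) =
      1 + (L.map fun j => ((List.finRange (n + 1)).map fun i =>
        Matrix.single i j (y i j)).sum).sum := by
  induction L with
  | nil => simp [normalForm]
  | cons j L ih =>
    rw [List.pairwise_cons] at hL
    have ih := ih hL.2
    simp only [normalForm, List.map_cons, List.prod_cons, List.sum_cons, map_mul] at ih ⊢
    rw [ih, toMat_colProd hy, one_add_mul_one_add]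
    have h : ((List.finRange (n + 1)).map fun i => Matrix.single i j (y i j)).sum *
        (L.map fun j => ((List.finRange (n + 1)).map fun i =>
          Matrix.single i j (y i j)).sum).sum = 0 := by
      rw [← List.sum_map_mul_left]
      refine List.sum_eq_zero fun x hx => ?_
      obtain ⟨j', hj', rfl⟩ := List.mem_map.1 hx
      have hjj : j' < j := hL.1 j' hj'
      rw [← List.sum_map_mul_left]
      refine List.sum_eq_zero fun x hx => ?_
      obtain ⟨i', -, rfl⟩ := List.mem_map.1 hx
      rw [← List.sum_map_mul_right]
      refine List.sum_eq_zero fun x hx => ?_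
      obtain ⟨i, -, rfl⟩ := List.mem_map.1 hx
      by_cases hij : i' < j'
      · exact Matrix.single_mul_single_of_ne _ _ _ _ (hij.trans hjj).ne' _
      · rw [(hy i' j').2 (not_lt.1 hij), Matrix.single_zero, mul_zero]
    rw [h, add_zero]

/-- The matrices of the form `1 + y` with `y` in `gradedStrict` are all attained. -/
theorem exists_toMat_eq {y : Matrix (Fin (n + 1)) (Fin (n + 1)) F[X]}
    (hy : y ∈ gradedStrict F n κ) : ∃ g : GrUnip F n κ, toMat g = 1 + y := by
  refine ⟨normalForm κ (1 + y) (descCols n), ?_⟩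
  rw [toMat_normalForm hy _ pairwise_descCols, descCols, List.map_reverse, List.sum_reverse]
  congr 1
  simp only [← List.ofFn_eq_map, List.sum_ofFn]
  rw [Finset.sum_comm]
  exact (Matrix.matrix_eq_sum_single y).symm

/-- The staircase subgroup of `ℓ` is the group of matrices that are block diagonal for the
partition of the indices into those below `ℓ` and the rest. -/
theorem mem_stair_iff {ℓ : ℕ} {g : GrUnip F n κ} :
    g ∈ stair F n κ ℓ ↔ ∀ i j : Fin (n + 1), (i : ℕ) < ℓ → ℓ ≤ j → toMat g i j = 0 := by
  constructor
  · intro hg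
    have key : ∀ {k l : Fin (n + 1)}, k < l → ℓ ∉ Set.Ioc (k : ℕ) l → ∀ {f : F[X]},
        f.natDegree ≤ κ * ((l : ℕ) - (k : ℕ)) → ∀ {g : GrUnip F n κ},
        (∀ i j : Fin (n + 1), (i : ℕ) < ℓ → ℓ ≤ j → toMat g i j = 0) →
        ∀ i j : Fin (n + 1), (i : ℕ) < ℓ → ℓ ≤ j → toMat (elem κ k l f * g) i j = 0 := by
      intro k l hkl hℓ f hf g ih i j hi hj
      rw [map_mul, toMat_elem hkl hf, add_mul, one_mul, Matrix.add_apply, ih i j hi hj, zero_add]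
      by_cases hik : i = k
      · subst hik
        have : (l : ℕ) < ℓ := by
          by_contra h
          exact hℓ ⟨hi, not_lt.1 h⟩
        rw [Matrix.single_mul_apply_same, ih l j this hj, mul_zero]
      · rw [Matrix.single_mul_apply_of_ne _ _ _ _ _ hik]
    induction hg using Subgroup.closure_induction_left with
    | one =>
      intro i j hi hj
      rw [map_one, Matrix.one_apply_ne]
      rintro rfl
      omega
    | mul_left x hx y _ ih =>
      obtain ⟨x, hx, rfl⟩ := hx
      rw [of_eq_elem]
      exact key x.src_lt_tgt hx x.natDegree_le ih
    | inv_mul_cancel x hx y _ ih =>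
      obtain ⟨x, hx, rfl⟩ := hx
      rw [of_eq_elem, ← elem_neg]
      exact key x.src_lt_tgt hx (by rw [Polynomial.natDegree_neg]; exact x.natDegree_le) ih
  · intro h
    rw [← (toMat_spec g).2]
    refine list_prod_mem fun x hx => ?_
    obtain ⟨j, -, rfl⟩ := List.mem_map.1 hx
    refine list_prod_mem fun x hx => ?_
    obtain ⟨i, -, rfl⟩ := List.mem_map.1 hx
    by_cases hz : toMat g i j = 0
    · simp only [hz, elem_zero, one_mem]
    by_cases hd : i < j ∧ (toMat g i j).natDegree ≤ κ * ((j : ℕ) - (i : ℕ))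
    · rw [elem_eq hd.1 hd.2]
      refine Subgroup.subset_closure ⟨_, ?_, rfl⟩
      exact fun hℓ => hz (h i j hℓ.1 hℓ.2)
    · rw [show elem κ i j (toMat g i j) = 1 from dif_neg hd]
      exact one_mem _

end MatrixModel

end UnipPres

namespace UnipPres

open scoped commutatorElement

/-! ### Rings with five triangular blocks -/

section BlockRing

variable {R : Type*} [Ring R]

/-- The elements of `N` whose `(i, j)` block `e i * x * e j` vanishes for `(i, j) ∉ Z`. -/
def supp (N : AddSubgroup R) (e : Fin 5 → R) (Z : Finset (Fin 5 × Fin 5)) : AddSubgroup R where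
  carrier := {x | x ∈ N ∧ ∀ i j, (i, j) ∉ Z → e i * x * e j = 0}
  add_mem' {x y} hx hy := ⟨add_mem hx.1 hy.1, fun i j h => by
    rw [mul_add, add_mul, hx.2 i j h, hy.2 i j h, add_zero]⟩
  zero_mem' := ⟨zero_mem _, fun i j _ => by rw [mul_zero, zero_mul]⟩
  neg_mem' {x} hx := ⟨neg_mem hx.1, fun i j h => by
    rw [mul_neg, neg_mul, hx.2 i j h, neg_zero]⟩

/-- The upper triangular block positions that do not straddle the cut before block `k`. -/
def cutSet (k : Fin 5) : Finset (Fin 5 × Fin 5) :=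
  Finset.univ.filter fun p => p.1 ≤ p.2 ∧ ¬ (p.1 < k ∧ k ≤ p.2)

/-- The cuts that correspond to the three staircase subgroups. -/
def cuts : Finset (Fin 5) := {1, 3, 4}

/-- A ring with a triangular decomposition into the five blocks `A`, `B₁`, `B₂`, `C`, `D`
(numbered `0` to `4`), given by idempotents `e`; `N` plays the role of the strictly upper
triangular graded matrices. The elements `E t` are finitely many anchors in the block `A B₁`
through which everything in `A C` and `A D` factors, and whose syzygies in `B₁ D` come from
syzygies in `B₁ C`. The field `fac` says that `A C` also factors through `B₂`, and `B D` through
`C`. All sums are indexed by `T` or `U`, so that products of block systems are block systems. The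
field `inv` provides the inverse `1 + y'` of `1 + y`. -/
structure BlockSystem {T : Type} [Fintype T] (U : Type) [Fintype U] (N : AddSubgroup R)
    (e : Fin 5 → R) (E : T → R) : Prop where
  mul_mem : ∀ x ∈ N, ∀ y ∈ N, x * y ∈ N
  left_mem : ∀ x ∈ N, ∀ i, e i * x ∈ N
  right_mem : ∀ x ∈ N, ∀ i, x * e i ∈ N
  idem : CompleteOrthogonalIdempotents e
  upper : ∀ x ∈ N, ∀ i j, j < i → e i * x * e j = 0
  inv : ∀ y ∈ N, ∃ y' ∈ N, y + y' + y * y' = 0 ∧ y' + y + y' * y = 0 ∧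
    ∀ k ∈ cuts, y ∈ supp N e (cutSet k) → y' ∈ supp N e (cutSet k)
  anchor_mem : ∀ t, E t ∈ supp N e {(0, 1)}
  gen : ∀ x ∈ supp N e {(0, 3), (0, 4)}, ∃ r : T → R,
    (∀ t, r t ∈ supp N e {(1, 3), (1, 4)}) ∧ x = ∑ t, E t * r t
  fac : ∀ i j k : Fin 5, (i, j, k) ∈ ({(0, 2, 3), (1, 3, 4), (2, 3, 4)} : Finset _) →
    ∀ x ∈ supp N e {(i, k)}, ∃ p r : T → R,
      (∀ t, p t ∈ supp N e {(i, j)}) ∧ (∀ t, r t ∈ supp N e {(j, k)}) ∧ x = ∑ t, p t * r t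
  syz : ∀ k : T → R, (∀ t, k t ∈ supp N e {(1, 4)}) → ∑ t, E t * k t = 0 →
    ∃ (r : U → T → R) (q : U → R), (∀ u t, r u t ∈ supp N e {(1, 3)}) ∧
      (∀ u, q u ∈ supp N e {(3, 4)}) ∧ (∀ t, k t = ∑ u, r u t * q u) ∧
      ∀ u, ∑ t, E t * r u t = 0

variable {T : Type} [Fintype T] {U : Type} [Fintype U] {N : AddSubgroup R} {e : Fin 5 → R}
  {E : T → R}

theorem supp_mono {Z W : Finset (Fin 5 × Fin 5)} {x : R} (hx : x ∈ supp N e Z)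
    (h : Z ⊆ W := by decide) : x ∈ supp N e W :=
  ⟨hx.1, fun i j hij => hx.2 i j fun h' => hij (h h')⟩

theorem supp_inter {Z W V : Finset (Fin 5 × Fin 5)} {x : R} (hx : x ∈ supp N e Z)
    (hx' : x ∈ supp N e W) (h : Z ∩ W ⊆ V := by decide) : x ∈ supp N e V := by
  refine ⟨hx.1, fun i j hij => ?_⟩
  by_cases h1 : (i, j) ∈ Z
  · exact hx'.2 i j fun h2 => hij (h (Finset.mem_inter.2 ⟨h1, h2⟩))
  · exact hx.2 i j h1

namespace BlockSystem

theorem eq_sum_rows (hB : BlockSystem U N e E) (x : R) : x = ∑ i, e i * x := by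
  rw [← Finset.sum_mul, hB.idem.complete, one_mul]

theorem eq_sum_cols (hB : BlockSystem U N e E) (x : R) : x = ∑ i, x * e i := by
  rw [← Finset.mul_sum, hB.idem.complete, mul_one]

theorem e_mul_self (hB : BlockSystem U N e E) (i : Fin 5) : e i * e i = e i :=
  hB.idem.idem i

theorem e_mul_ne (hB : BlockSystem U N e E) {i j : Fin 5} (h : i ≠ j) : e i * e j = 0 :=
  hB.idem.ortho h

theorem mul_mem_supp (hB : BlockSystem U N e E) {Z W V : Finset (Fin 5 × Fin 5)} {x y : R}
    (hx : x ∈ supp N e Z) (hy : y ∈ supp N e W)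
    (h : ∀ i j k, (i, j) ∈ Z → (j, k) ∈ W → (i, k) ∈ V := by decide) : x * y ∈ supp N e V := by
  refine ⟨hB.mul_mem _ hx.1 _ hy.1, fun i k hik => ?_⟩
  have h1 : e i * (x * y) * e k = ∑ j, (e i * x * e j) * (e j * y * e k) := by
    have h2 : ∀ j, (e i * x * e j) * (e j * y * e k) = e i * x * e j * (y * e k) := by
      intro j
      calc _ = e i * x * (e j * e j) * (y * e k) := by noncomm_ring
        _ = _ := by rw [hB.e_mul_self]
    rw [Finset.sum_congr rfl fun j _ => h2 j, ← Finset.sum_mul, ← hB.eq_sum_cols]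
    noncomm_ring
  rw [h1]
  refine Finset.sum_eq_zero fun j _ => ?_
  by_cases hij : (i, j) ∈ Z
  · rw [hy.2 j k fun hjk => hik (h i j k hij hjk), mul_zero]
  · rw [hx.2 i j hij, zero_mul]

theorem eq_zero_of_mem_supp (hB : BlockSystem U N e E) {x : R} (hx : x ∈ supp N e ∅) : x = 0 := by
  rw [hB.eq_sum_rows x]
  refine Finset.sum_eq_zero fun i _ => ?_
  rw [hB.eq_sum_cols (e i * x)]
  exact Finset.sum_eq_zero fun j _ => hx.2 i j (by simp)

theorem mul_eq_zero_of_supp (hB : BlockSystem U N e E) {Z W : Finset (Fin 5 × Fin 5)} {x y : R}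
    (hx : x ∈ supp N e Z) (hy : y ∈ supp N e W)
    (h : ∀ i j k, (i, j) ∈ Z → (j, k) ∉ W := by decide) : x * y = 0 :=
  hB.eq_zero_of_mem_supp (hB.mul_mem_supp hx hy fun i j k h1 h2 => absurd h2 (h i j k h1))

theorem row_mem (hB : BlockSystem U N e E) {Z W : Finset (Fin 5 × Fin 5)} {x : R} (i : Fin 5)
    (hx : x ∈ supp N e Z) (h : ∀ j, (i, j) ∈ Z → (i, j) ∈ W := by decide) :
    e i * x ∈ supp N e W := by
  refine ⟨hB.left_mem _ hx.1 i, fun i' j hij => ?_⟩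
  by_cases hi : i' = i
  · subst hi
    rw [← mul_assoc, hB.e_mul_self]
    exact hx.2 _ _ fun h' => hij (h j h')
  · rw [← mul_assoc, hB.e_mul_ne hi, zero_mul, zero_mul]

theorem col_mem (hB : BlockSystem U N e E) {Z W : Finset (Fin 5 × Fin 5)} {x : R} (j : Fin 5)
    (hx : x ∈ supp N e Z) (h : ∀ i, (i, j) ∈ Z → (i, j) ∈ W := by decide) :
    x * e j ∈ supp N e W := by
  refine ⟨hB.right_mem _ hx.1 j, fun i j' hij => ?_⟩
  by_cases hj : j = j'
  · subst hj
    rw [mul_assoc, mul_assoc, hB.e_mul_self, ← mul_assoc]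
    exact hx.2 _ _ fun h' => hij (h i h')
  · rw [mul_assoc, mul_assoc, hB.e_mul_ne hj, mul_zero, mul_zero]

theorem row_eq_zero (hB : BlockSystem U N e E) {Z : Finset (Fin 5 × Fin 5)} {x : R} (i : Fin 5)
    (hx : x ∈ supp N e Z) (h : ∀ j, (i, j) ∉ Z := by decide) : e i * x = 0 :=
  hB.eq_zero_of_mem_supp (hB.row_mem i hx fun j hj => absurd hj (h j))

theorem col_eq_zero (hB : BlockSystem U N e E) {Z : Finset (Fin 5 × Fin 5)} {x : R} (j : Fin 5)
    (hx : x ∈ supp N e Z) (h : ∀ i, (i, j) ∉ Z := by decide) : x * e j = 0 :=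
  hB.eq_zero_of_mem_supp (hB.col_mem j hx fun i hi => absurd hi (h i))

theorem row_eq_self (hB : BlockSystem U N e E) {Z : Finset (Fin 5 × Fin 5)} {x : R} (i : Fin 5)
    (hx : x ∈ supp N e Z) (h : ∀ i' j, (i', j) ∈ Z → i' = i := by decide) : e i * x = x := by
  have h1 := hB.eq_sum_rows x
  rw [Finset.sum_eq_single i (fun i' _ hi => ?_) fun h => absurd (Finset.mem_univ _) h] at h1
  · exact h1.symm
  exact hB.eq_zero_of_mem_supp (hB.row_mem i' hx fun j hj => absurd (h _ _ hj) hi)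

theorem col_eq_self (hB : BlockSystem U N e E) {Z : Finset (Fin 5 × Fin 5)} {x : R} (j : Fin 5)
    (hx : x ∈ supp N e Z) (h : ∀ i j', (i, j') ∈ Z → j' = j := by decide) : x * e j = x := by
  have h1 := hB.eq_sum_cols x
  rw [Finset.sum_eq_single j (fun j' _ hj => ?_) fun h => absurd (Finset.mem_univ _) h] at h1
  · exact h1.symm
  exact hB.eq_zero_of_mem_supp (hB.col_mem j' hx fun i hi => absurd (h _ _ hi) hj)

theorem mem_supp_upper (hB : BlockSystem U N e E) {x : R} (hx : x ∈ N) :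
    x ∈ supp N e (Finset.univ.filter fun p : Fin 5 × Fin 5 => p.1 ≤ p.2) :=
  ⟨hx, fun i j hij => hB.upper x hx i j (by simpa using hij)⟩

/-- Every element of the block `A C` is a combination of the anchors. -/
theorem gen_AC (hB : BlockSystem U N e E) {x : R} (hx : x ∈ supp N e {(0, 3)}) :
    ∃ r : T → R, (∀ t, r t ∈ supp N e {(1, 3)}) ∧ x = ∑ t, E t * r t := by
  obtain ⟨r, hr, hxr⟩ := hB.gen x (supp_mono hx)
  refine ⟨fun t => r t * e 3, fun t => hB.col_mem 3 (hr t), ?_⟩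
  rw [← hB.col_eq_self 3 hx]
  conv_lhs => rw [hxr]
  rw [Finset.sum_mul]
  exact Finset.sum_congr rfl fun t _ => mul_assoc _ _ _

/-- Every element of the block `A D` is a combination of the anchors. -/
theorem gen_AD (hB : BlockSystem U N e E) {x : R} (hx : x ∈ supp N e {(0, 4)}) :
    ∃ r : T → R, (∀ t, r t ∈ supp N e {(1, 4)}) ∧ x = ∑ t, E t * r t := by
  obtain ⟨r, hr, hxr⟩ := hB.gen x (supp_mono hx)
  refine ⟨fun t => r t * e 4, fun t => hB.col_mem 4 (hr t), ?_⟩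
  rw [← hB.col_eq_self 4 hx]
  conv_lhs => rw [hxr]
  rw [Finset.sum_mul]
  exact Finset.sum_congr rfl fun t _ => mul_assoc _ _ _

end BlockSystem

/-- A map from `R` to a group such that `1 + p ↦ X p` is multiplicative on the unipotent elements
that do not straddle one of the three cuts. -/
structure IsLocalHom {Γ : Type*} [Group Γ] (N : AddSubgroup R) (e : Fin 5 → R) (X : R → Γ) :
    Prop where
  map_circ : ∀ k ∈ cuts, ∀ p ∈ supp N e (cutSet k), ∀ q ∈ supp N e (cutSet k),
    X (p + q + p * q) = X p * X q

namespace IsLocalHom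

variable {Γ : Type*} [Group Γ] {X : R → Γ}

theorem map_zero (hX : IsLocalHom N e X) : X 0 = 1 := by
  have := hX.map_circ 1 (by decide) 0 (zero_mem _) 0 (zero_mem _)
  rw [mul_zero, add_zero, add_zero] at this
  exact right_eq_mul.1 this

variable {Z W : Finset (Fin 5 × Fin 5)} {p q : R}

theorem map_circ_supp (hX : IsLocalHom N e X) (k : Fin 5)
    (hp : p ∈ supp N e Z) (hq : q ∈ supp N e W) (hk : k ∈ cuts := by decide)
    (hZ : Z ⊆ cutSet k := by decide) (hW : W ⊆ cutSet k := by decide) :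
    X (p + q + p * q) = X p * X q :=
  hX.map_circ k hk p (supp_mono hp hZ) q (supp_mono hq hW)

theorem map_add (hB : BlockSystem U N e E) (hX : IsLocalHom N e X) (k : Fin 5)
    (hp : p ∈ supp N e Z) (hq : q ∈ supp N e W) (hk : k ∈ cuts := by decide)
    (hZ : Z ⊆ cutSet k := by decide) (hW : W ⊆ cutSet k := by decide)
    (h : ∀ i j k, (i, j) ∈ Z → (j, k) ∉ W := by decide) :
    X (p + q) = X p * X q := by
  rw [← hX.map_circ_supp k hp hq hk hZ hW, hB.mul_eq_zero_of_supp hp hq h, add_zero]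

theorem commute (hB : BlockSystem U N e E) (hX : IsLocalHom N e X) (k : Fin 5)
    (hp : p ∈ supp N e Z) (hq : q ∈ supp N e W) (hk : k ∈ cuts := by decide)
    (hZ : Z ⊆ cutSet k := by decide) (hW : W ⊆ cutSet k := by decide)
    (h : ∀ i j k, (i, j) ∈ Z → (j, k) ∉ W := by decide)
    (h' : ∀ i j k, (i, j) ∈ W → (j, k) ∉ Z := by decide) :
    Commute (X p) (X q) := by
  rw [Commute, SemiconjBy, ← hX.map_add hB k hp hq hk hZ hW h,
    ← hX.map_add hB k hq hp hk hW hZ h', add_comm]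

theorem bracket (hB : BlockSystem U N e E) (hX : IsLocalHom N e X) (k : Fin 5)
    (hp : p ∈ supp N e Z) (hq : q ∈ supp N e W) (hk : k ∈ cuts := by decide)
    (hZ : Z ⊆ cutSet k := by decide) (hW : W ⊆ cutSet k := by decide)
    (hqp : ∀ i j k, (i, j) ∈ W → (j, k) ∉ Z := by decide)
    (hqq : ∀ i j k, (i, j) ∈ W → (j, k) ∉ W := by decide) :
    X (p * q) = ⁅X p, X q⁆ := by
  have hcut : ∀ {x y : R}, x ∈ supp N e (cutSet k) → y ∈ supp N e (cutSet k) →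
      x * y ∈ supp N e (cutSet k) := by
    intro x y hx hy
    have h : ∀ k ∈ cuts, ∀ i j l, (i, j) ∈ cutSet k → (j, l) ∈ cutSet k → (i, l) ∈ cutSet k := by
      decide
    exact hB.mul_mem_supp hx hy (h k hk)
  have hp' := supp_mono hp hZ
  have hq' := supp_mono hq hW
  have h1 : q * p = 0 := hB.mul_eq_zero_of_supp hq hp hqp
  have h2 : q * q = 0 := hB.mul_eq_zero_of_supp hq hq hqq
  have h3 : X (p * q) * X q * X p = X p * X q := by
    rw [← hX.map_circ k hk _ (hcut hp' hq') _ hq', mul_assoc, h2, mul_zero, add_zero,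
      ← hX.map_circ k hk _ (add_mem (hcut hp' hq') hq') _ hp', ← hX.map_circ k hk _ hp' _ hq',
      add_mul, mul_assoc, h1, mul_zero, add_zero, add_zero]
    congr 1
    abel
  rw [commutatorElement_def, ← h3]
  group

end IsLocalHom

/-! ### Commutators of the blocks in the colimit -/

section Commutators

variable {Γ : Type*} [Group Γ] {X : R → Γ}

/-- Orthogonal blocks `A Bᵢ` and `Bⱼ D` commute: write the second factor through `C`. -/
theorem commute_AB_BD (hB : BlockSystem U N e E) (hX : IsLocalHom N e X) {i j : Fin 5}
    (hij : (i = 1 ∧ j = 2) ∨ (i = 2 ∧ j = 1)) {p k : R} (hp : p ∈ supp N e {(0, i)})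
    (hk : k ∈ supp N e {(j, 4)}) : Commute (X p) (X k) := by
  obtain ⟨r, q, hr, hq, rfl⟩ := hB.fac j 3 4 (by
    rcases hij with ⟨-, rfl⟩ | ⟨-, rfl⟩ <;> decide) k hk
  refine (Finset.sum_induction (fun t => r t * q t)
    (fun k => k ∈ supp N e {(j, 4)} ∧ Commute (X p) (X k)) ?_ ?_ ?_).2
  · rintro k k' ⟨hk, h⟩ ⟨hk', h'⟩
    refine ⟨add_mem hk hk', ?_⟩
    have : X (k + k') = X k * X k' := by
      rcases hij with ⟨-, rfl⟩ | ⟨-, rfl⟩ <;> exact hX.map_add hB 1 hk hk'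
    rw [this]
    exact h.mul_right h'
  · exact ⟨zero_mem _, by rw [hX.map_zero]; exact Commute.one_right _⟩
  · intro t _
    have h1 : Commute (X p) (X (r t)) := by
      rcases hij with ⟨rfl, rfl⟩ | ⟨rfl, rfl⟩ <;> exact hX.commute hB 4 hp (hr t)
    have h2 : Commute (X p) (X (q t)) := by
      rcases hij with ⟨rfl, rfl⟩ | ⟨rfl, rfl⟩ <;> exact hX.commute hB 3 hp (hq t)
    have h3 : X (r t * q t) = ⁅X (r t), X (q t)⁆ := by
      rcases hij with ⟨rfl, rfl⟩ | ⟨rfl, rfl⟩ <;> exact hX.bracket hB 1 (hr t) (hq t)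
    refine ⟨?_, ?_⟩
    · rcases hij with ⟨rfl, rfl⟩ | ⟨rfl, rfl⟩ <;> exact hB.mul_mem_supp (hr t) (hq t)
    · rw [h3, commutatorElement_def]
      exact ((h1.mul_right h2).mul_right h1.inv_right).mul_right h2.inv_right

/-- The blocks `A C` and `Bⱼ D` commute: write the first factor through the other half of `B`. -/
theorem commute_AC_BjD (hB : BlockSystem U N e E) (hX : IsLocalHom N e X) {i j : Fin 5}
    (hij : (i = 1 ∧ j = 2) ∨ (i = 2 ∧ j = 1)) {m k : R} (hm : m ∈ supp N e {(0, 3)})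
    (hk : k ∈ supp N e {(j, 4)}) : Commute (X m) (X k) := by
  have hfac : ∃ p r : T → R, (∀ t, p t ∈ supp N e {(0, i)}) ∧ (∀ t, r t ∈ supp N e {(i, 3)}) ∧
      m = ∑ t, p t * r t := by
    rcases hij with ⟨rfl, rfl⟩ | ⟨rfl, rfl⟩
    · obtain ⟨r, hr, h⟩ := hB.gen_AC hm
      exact ⟨E, r, hB.anchor_mem, hr, h⟩
    · exact hB.fac 0 2 3 (by decide) m hm
  obtain ⟨p, r, hp, hr, rfl⟩ := hfac
  refine (Finset.sum_induction (fun t => p t * r t)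
    (fun m => m ∈ supp N e {(0, 3)} ∧ Commute (X m) (X k)) ?_ ?_ ?_).2
  · rintro m m' ⟨hm, h⟩ ⟨hm', h'⟩
    refine ⟨add_mem hm hm', ?_⟩
    rw [hX.map_add hB 4 hm hm']
    exact h.mul_left h'
  · exact ⟨zero_mem _, by rw [hX.map_zero]; exact Commute.one_left _⟩
  · intro t _
    have h1 : Commute (X (p t)) (X k) := commute_AB_BD hB hX hij (hp t) hk
    have h2 : Commute (X (r t)) (X k) := by
      rcases hij with ⟨rfl, rfl⟩ | ⟨rfl, rfl⟩ <;> exact hX.commute hB 1 (hr t) hk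
    have h3 : X (p t * r t) = ⁅X (p t), X (r t)⁆ := by
      rcases hij with ⟨rfl, rfl⟩ | ⟨rfl, rfl⟩ <;> exact hX.bracket hB 4 (hp t) (hr t)
    refine ⟨?_, ?_⟩
    · rcases hij with ⟨rfl, rfl⟩ | ⟨rfl, rfl⟩ <;> exact hB.mul_mem_supp (hp t) (hr t)
    · rw [h3, commutatorElement_def]
      exact ((h1.mul_left h2).mul_left h1.inv_left).mul_left h2.inv_left

theorem commute_AC_BD (hB : BlockSystem U N e E) (hX : IsLocalHom N e X) {m k : R}
    (hm : m ∈ supp N e {(0, 3)}) (hk : k ∈ supp N e {(1, 4), (2, 4)}) :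
    Commute (X m) (X k) := by
  have hk' : k = e 1 * k + e 2 * k := by
    conv_lhs => rw [hB.eq_sum_rows k, Fin.sum_univ_five, hB.row_eq_zero 0 hk,
      hB.row_eq_zero 3 hk, hB.row_eq_zero 4 hk]
    abel
  have h1 : e 1 * k ∈ supp N e {(1, 4)} := hB.row_mem 1 hk
  have h2 : e 2 * k ∈ supp N e {(2, 4)} := hB.row_mem 2 hk
  rw [hk', hX.map_add hB 1 h1 h2]
  exact (commute_AC_BjD hB hX (.inr ⟨rfl, rfl⟩) hm h1).mul_right
    (commute_AC_BjD hB hX (.inl ⟨rfl, rfl⟩) hm h2)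

/-- The commutators into the block `A D` through `B` and through `C` agree. This is a form of the
Hall–Witt identity. -/
theorem bracket_assoc (hB : BlockSystem U N e E) (hX : IsLocalHom N e X) {p r q : R}
    (hp : p ∈ supp N e {(0, 1), (0, 2)}) (hr : r ∈ supp N e {(1, 3), (2, 3)})
    (hq : q ∈ supp N e {(3, 4)}) : ⁅X p, X (r * q)⁆ = ⁅X (p * r), X q⁆ := by
  have hpr : p * r ∈ supp N e {(0, 3)} := hB.mul_mem_supp hp hr
  have hrq : r * q ∈ supp N e {(1, 4), (2, 4)} := hB.mul_mem_supp hr hq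
  have hM : X (p * r) = ⁅X p, X r⁆ := hX.bracket hB 4 hp hr
  have hK : X (r * q) = ⁅X r, X q⁆ := hX.bracket hB 1 hr hq
  have hMK : Commute (X (p * r)) (X (r * q)) := commute_AC_BD hB hX hpr hrq
  have hKQ : Commute (X (r * q)) (X q) := hX.commute hB 1 hrq hq
  have hPQ : Commute (X p) (X q) := hX.commute hB 3 hp hq
  have h1 : X p * X r * (X p)⁻¹ = X (p * r) * X r := by
    rw [hM, commutatorElement_def]
    group
  have h2 : X p * X q * (X p)⁻¹ = X q := by
    rw [hPQ.eq]
    group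
  have h3 : X p * X (r * q) * (X p)⁻¹ = X (p * r) * X r * X q * (X (p * r) * X r)⁻¹ * (X q)⁻¹ := by
    calc X p * X (r * q) * (X p)⁻¹
        = (X p * X r * (X p)⁻¹) * (X p * X q * (X p)⁻¹) * (X p * X r * (X p)⁻¹)⁻¹ *
          (X p * X q * (X p)⁻¹)⁻¹ := by
          rw [hK, commutatorElement_def]
          group
      _ = _ := by rw [h1, h2]
  have h4 : X r * X q * (X r)⁻¹ = X (r * q) * X q := by
    rw [hK, commutatorElement_def]
    group
  calc ⁅X p, X (r * q)⁆ = X p * X (r * q) * (X p)⁻¹ * (X (r * q))⁻¹ := rfl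
    _ = X (p * r) * (X r * X q * (X r)⁻¹) * (X (p * r))⁻¹ * (X q)⁻¹ * (X (r * q))⁻¹ := by
      rw [h3]
      group
    _ = (X (p * r) * X (r * q)) * X q * (X (p * r))⁻¹ * (X q)⁻¹ * (X (r * q))⁻¹ := by
      rw [h4]
      group
    _ = X (r * q) * ⁅X (p * r), X q⁆ * (X (r * q))⁻¹ := by
      rw [hMK.eq, commutatorElement_def]
      group
    _ = ⁅X (p * r), X q⁆ := by
      have h5 : Commute (X (r * q)) ⁅X (p * r), X q⁆ := by
        rw [commutatorElement_def]
        exact ((hMK.symm.mul_right hKQ).mul_right hMK.symm.inv_right).mul_right hKQ.inv_right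
      rw [h5.eq]
      group

end Commutators

end BlockRing

end UnipPres

namespace UnipPres

open scoped commutatorElement

/-! ### The image of the corner block in the colimit -/

section CornerMap

variable {R : Type*} [Ring R] {T : Type} [Fintype T] {U : Type} [Fintype U] {N : AddSubgroup R}
  {e : Fin 5 → R} {E : T → R} {Γ : Type*} [Group Γ] {X : R → Γ}

/-- The block positions `A × (B ∪ C)`. -/
def rowA : Finset (Fin 5 × Fin 5) := {(0, 1), (0, 2), (0, 3)}

/-- The block positions `(B ∪ C) × D`. -/
def colD : Finset (Fin 5 × Fin 5) := {(1, 4), (2, 4), (3, 4)}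

/-- The block positions `(A ∪ B ∪ C) × D`. -/
def fullColD : Finset (Fin 5 × Fin 5) := {(0, 4), (1, 4), (2, 4), (3, 4)}

theorem bracket_mul_right_of_commute {a b b' : Γ} (h : Commute b ⁅a, b'⁆) :
    ⁅a, b * b'⁆ = ⁅a, b⁆ * ⁅a, b'⁆ := by
  have h1 : ⁅a, b * b'⁆ = ⁅a, b⁆ * (b * ⁅a, b'⁆ * b⁻¹) := by
    simp only [commutatorElement_def]
    group
  rw [h1, h.eq]
  group

theorem bracket_mul_left_of_commute {a a' b : Γ} (h : Commute a ⁅a', b⁆) :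
    ⁅a * a', b⁆ = ⁅a', b⁆ * ⁅a, b⁆ := by
  have h1 : ⁅a * a', b⁆ = a * ⁅a', b⁆ * a⁻¹ * ⁅a, b⁆ := by
    simp only [commutatorElement_def]
    group
  rw [h1, h.eq]
  group

theorem bracket_eq_one_of_commute {a b : Γ} (h : Commute a b) : ⁅a, b⁆ = 1 :=
  commutatorElement_eq_one_iff_commute.2 h

namespace BlockSystem

theorem exists_rowA (hB : BlockSystem U N e E) {p : R} (hp : p ∈ supp N e rowA) :
    ∃ b ∈ supp N e {(0, 1), (0, 2)}, ∃ c ∈ supp N e {(0, 3)}, p = b + c := by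
  refine ⟨p * e 1 + p * e 2, add_mem (hB.col_mem 1 hp) (hB.col_mem 2 hp), p * e 3,
    hB.col_mem 3 hp, ?_⟩
  conv_lhs => rw [hB.eq_sum_cols p, Fin.sum_univ_five, hB.col_eq_zero 0 hp, hB.col_eq_zero 4 hp]
  abel

theorem exists_colD (hB : BlockSystem U N e E) {k : R} (hk : k ∈ supp N e colD) :
    ∃ b ∈ supp N e {(1, 4), (2, 4)}, ∃ c ∈ supp N e {(3, 4)}, k = b + c := by
  refine ⟨e 1 * k + e 2 * k, add_mem (hB.row_mem 1 hk) (hB.row_mem 2 hk), e 3 * k,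
    hB.row_mem 3 hk, ?_⟩
  conv_lhs => rw [hB.eq_sum_rows k, Fin.sum_univ_five, hB.row_eq_zero 0 hk, hB.row_eq_zero 4 hk]
  abel

/-- A property of elements of `A C` that is additive holds if it holds for all `E t * r`. -/
theorem induction_AC (hB : BlockSystem U N e E) {P : R → Prop} (h0 : P 0)
    (hadd : ∀ x ∈ supp N e {(0, 3)}, ∀ y ∈ supp N e {(0, 3)}, P x → P y → P (x + y))
    (hmul : ∀ t, ∀ r ∈ supp N e {(1, 3)}, P (E t * r))
    {m : R} (hm : m ∈ supp N e {(0, 3)}) : P m := by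
  obtain ⟨r, hr, rfl⟩ := hB.gen_AC hm
  refine (Finset.sum_induction (fun t => E t * r t) (fun m => m ∈ supp N e {(0, 3)} ∧ P m)
    (fun x y hx hy => ⟨add_mem hx.1 hy.1, hadd x hx.1 y hy.1 hx.2 hy.2⟩) ⟨zero_mem _, h0⟩
    fun t _ => ⟨hB.mul_mem_supp (hB.anchor_mem t) (hr t), hmul t _ (hr t)⟩).2

/-- A property of elements of `B D` that is additive holds if it holds for all `r * q` with `r` in
`B C` and `q` in `C D`. -/
theorem induction_BD (hB : BlockSystem U N e E) {P : R → Prop} (h0 : P 0)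
    (hadd : ∀ x ∈ supp N e {(1, 4), (2, 4)}, ∀ y ∈ supp N e {(1, 4), (2, 4)},
      P x → P y → P (x + y))
    (hmul : ∀ r ∈ supp N e {(1, 3), (2, 3)}, ∀ q ∈ supp N e {(3, 4)}, P (r * q))
    {k : R} (hk : k ∈ supp N e {(1, 4), (2, 4)}) : P k := by
  have key : ∀ i, i = 1 ∨ i = 2 → e i * k ∈ supp N e {(1, 4), (2, 4)} ∧ P (e i * k) := by
    intro i hi
    have h1 : e i * k ∈ supp N e {(i, 4)} := by
      rcases hi with rfl | rfl <;> exact hB.row_mem _ hk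
    obtain ⟨r, q, hr, hq, h2⟩ := hB.fac i 3 4 (by rcases hi with rfl | rfl <;> decide) _ h1
    rw [h2]
    have hr' : ∀ t, r t ∈ supp N e {(1, 3), (2, 3)} := by
      rcases hi with rfl | rfl <;> exact fun t => supp_mono (hr t)
    exact Finset.sum_induction (fun t => r t * q t)
      (fun k => k ∈ supp N e {(1, 4), (2, 4)} ∧ P k)
      (fun x y hx hy => ⟨add_mem hx.1 hy.1, hadd x hx.1 y hy.1 hx.2 hy.2⟩) ⟨zero_mem _, h0⟩
      fun t _ => ⟨hB.mul_mem_supp (hr' t) (hq t), hmul _ (hr' t) _ (hq t)⟩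
  have hk' : k = e 1 * k + e 2 * k := by
    conv_lhs => rw [hB.eq_sum_rows k, Fin.sum_univ_five, hB.row_eq_zero 0 hk,
      hB.row_eq_zero 3 hk, hB.row_eq_zero 4 hk]
    abel
  rw [hk']
  exact hadd _ (key 1 (.inl rfl)).1 _ (key 2 (.inr rfl)).1 (key 1 (.inl rfl)).2
    (key 2 (.inr rfl)).2

end BlockSystem

variable (N e X) in
/-- The images of the blocks `A × (B ∪ C)` and `(B ∪ C) × D`. -/
def blockImages : Set Γ := X '' {p | p ∈ supp N e rowA ∨ p ∈ supp N e colD}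

variable (N e X) in
/-- The center of the group generated by the images of `A × (B ∪ C)` and `(B ∪ C) × D`; it
contains their commutators. -/
def cornerGroup : Subgroup Γ :=
  Subgroup.closure (blockImages N e X) ⊓ Subgroup.centralizer (blockImages N e X)

instance : CommGroup (cornerGroup N e X) where
  mul_comm a b := by
    have h1 := Subgroup.closure_le_centralizer_centralizer _ a.2.1
    exact Subtype.ext (Subgroup.mem_centralizer_iff.1 h1 b.1 b.2.2).symm

theorem commute_of_mem_cornerGroup {c : Γ} (hc : c ∈ cornerGroup N e X) {p : R}
    (hp : p ∈ supp N e rowA ∨ p ∈ supp N e colD) : Commute (X p) c :=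
  Subgroup.mem_centralizer_iff.1 hc.2 _ ⟨p, hp, rfl⟩

theorem bracket_mem_closure {p k : R} (hp : p ∈ supp N e rowA) (hk : k ∈ supp N e colD) :
    ⁅X p, X k⁆ ∈ Subgroup.closure (blockImages N e X) := by
  have h1 : X p ∈ Subgroup.closure (blockImages N e X) :=
    Subgroup.subset_closure ⟨p, .inl hp, rfl⟩
  have h2 : X k ∈ Subgroup.closure (blockImages N e X) :=
    Subgroup.subset_closure ⟨k, .inr hk, rfl⟩
  rw [commutatorElement_def]
  exact mul_mem (mul_mem (mul_mem h1 h2) (inv_mem h1)) (inv_mem h2)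

theorem mem_centralizer_blockImages (hB : BlockSystem U N e E) (hX : IsLocalHom N e X) {c : Γ}
    (h1 : ∀ p ∈ supp N e {(0, 1), (0, 2)}, Commute (X p) c)
    (h2 : ∀ m ∈ supp N e {(0, 3)}, Commute (X m) c)
    (h3 : ∀ k ∈ supp N e {(1, 4), (2, 4)}, Commute (X k) c)
    (h4 : ∀ q ∈ supp N e {(3, 4)}, Commute (X q) c) :
    c ∈ Subgroup.centralizer (blockImages N e X) := by
  rw [Subgroup.mem_centralizer_iff]
  rintro _ ⟨p, hp | hp, rfl⟩
  · obtain ⟨b, hb, c', hc', rfl⟩ := hB.exists_rowA hp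
    rw [hX.map_add hB 4 hb hc']
    exact ((h1 b hb).mul_left (h2 c' hc')).eq
  · obtain ⟨b, hb, c', hc', rfl⟩ := hB.exists_colD hp
    rw [hX.map_add hB 1 hb hc']
    exact ((h3 b hb).mul_left (h4 c' hc')).eq

theorem commute_bracket {x a b : Γ} (ha : Commute x a) (hb : Commute x b) :
    Commute x ⁅a, b⁆ := by
  rw [commutatorElement_def]
  exact ((ha.mul_right hb).mul_right ha.inv_right).mul_right hb.inv_right

/-- A commutator that has both a form through `B` and a form through `C` is central: each of the
four blocks visibly commutes with one of the two forms. -/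
theorem bracket_mul_mem (hB : BlockSystem U N e E) (hX : IsLocalHom N e X) {p r q : R}
    (hp : p ∈ supp N e {(0, 1), (0, 2)}) (hr : r ∈ supp N e {(1, 3), (2, 3)})
    (hq : q ∈ supp N e {(3, 4)}) : ⁅X p, X (r * q)⁆ ∈ cornerGroup N e X := by
  have hpr : p * r ∈ supp N e {(0, 3)} := hB.mul_mem_supp hp hr
  have hrq : r * q ∈ supp N e {(1, 4), (2, 4)} := hB.mul_mem_supp hr hq
  refine ⟨bracket_mem_closure (supp_mono hp) (supp_mono hrq),
    mem_centralizer_blockImages hB hX ?_ ?_ ?_ ?_⟩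
  · intro p' hp'
    rw [bracket_assoc hB hX hp hr hq]
    exact commute_bracket (hX.commute hB 4 hp' hpr) (hX.commute hB 3 hp' hq)
  · intro m hm
    exact commute_bracket (hX.commute hB 4 hm hp) (commute_AC_BD hB hX hm hrq)
  · intro k hk
    rw [bracket_assoc hB hX hp hr hq]
    exact commute_bracket (commute_AC_BD hB hX hpr hk).symm (hX.commute hB 1 hk hq)
  · intro q' hq'
    exact commute_bracket (hX.commute hB 3 hq' hp) (hX.commute hB 1 hq' hrq)

theorem map_add_rowA (hB : BlockSystem U N e E) (hX : IsLocalHom N e X) {p p' : R}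
    (hp : p ∈ supp N e rowA) (hp' : p' ∈ supp N e rowA) : X (p + p') = X p * X p' :=
  hX.map_add hB 4 hp hp'

theorem map_add_colD (hB : BlockSystem U N e E) (hX : IsLocalHom N e X) {k k' : R}
    (hk : k ∈ supp N e colD) (hk' : k' ∈ supp N e colD) : X (k + k') = X k * X k' :=
  hX.map_add hB 1 hk hk'

theorem bracket_add_right_mem (hB : BlockSystem U N e E) (hX : IsLocalHom N e X) {p k k' : R}
    (hk : k ∈ supp N e colD) (hk' : k' ∈ supp N e colD)
    (h : ⁅X p, X k⁆ ∈ cornerGroup N e X) (h' : ⁅X p, X k'⁆ ∈ cornerGroup N e X) :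
    ⁅X p, X (k + k')⁆ ∈ cornerGroup N e X := by
  rw [map_add_colD hB hX hk hk',
    bracket_mul_right_of_commute (commute_of_mem_cornerGroup h' (.inr hk))]
  exact mul_mem h h'

theorem bracket_add_left_mem (hB : BlockSystem U N e E) (hX : IsLocalHom N e X) {p p' k : R}
    (hp : p ∈ supp N e rowA) (hp' : p' ∈ supp N e rowA)
    (h : ⁅X p, X k⁆ ∈ cornerGroup N e X) (h' : ⁅X p', X k⁆ ∈ cornerGroup N e X) :
    ⁅X (p + p'), X k⁆ ∈ cornerGroup N e X := by
  rw [map_add_rowA hB hX hp hp',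
    bracket_mul_left_of_commute (commute_of_mem_cornerGroup h' (.inl hp))]
  exact mul_mem h' h

/-- All commutators of `A × (B ∪ C)` with `(B ∪ C) × D` are central: split both arguments; the mixed
terms are trivial, and the others are sums of terms that factor through both `B` and `C`. -/
theorem bracket_mem (hB : BlockSystem U N e E) (hX : IsLocalHom N e X) {p k : R}
    (hp : p ∈ supp N e rowA) (hk : k ∈ supp N e colD) : ⁅X p, X k⁆ ∈ cornerGroup N e X := by
  obtain ⟨b, hb, m, hm, rfl⟩ := hB.exists_rowA hp
  obtain ⟨b', hb', q, hq, rfl⟩ := hB.exists_colD hk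
  have hbq : ⁅X b, X q⁆ = 1 := bracket_eq_one_of_commute (hX.commute hB 3 hb hq)
  have hmb : ⁅X m, X b'⁆ = 1 := bracket_eq_one_of_commute (commute_AC_BD hB hX hm hb')
  have hbb : ⁅X b, X b'⁆ ∈ cornerGroup N e X := by
    refine hB.induction_BD (P := fun k => ⁅X b, X k⁆ ∈ cornerGroup N e X) ?_ ?_ ?_ hb'
    · simp [hX.map_zero]
    · exact fun x hx y hy => bracket_add_right_mem hB hX (supp_mono hx) (supp_mono hy)
    · exact fun r hr q hq => bracket_mul_mem hB hX hb hr hq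
  have hmq : ⁅X m, X q⁆ ∈ cornerGroup N e X := by
    refine hB.induction_AC (P := fun m => ⁅X m, X q⁆ ∈ cornerGroup N e X) ?_ ?_ ?_ hm
    · simp [hX.map_zero]
    · exact fun x hx y hy => bracket_add_left_mem hB hX (supp_mono hx) (supp_mono hy)
    · intro t r hr
      rw [← bracket_assoc hB hX (supp_mono (hB.anchor_mem t)) (supp_mono hr) hq]
      exact bracket_mul_mem hB hX (supp_mono (hB.anchor_mem t)) (supp_mono hr) hq
  refine bracket_add_left_mem hB hX (supp_mono hb) (supp_mono hm) ?_ ?_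
  · exact bracket_add_right_mem hB hX (supp_mono hb') (supp_mono hq) hbb (hbq ▸ one_mem _)
  · exact bracket_add_right_mem hB hX (supp_mono hb') (supp_mono hq) (hmb ▸ one_mem _) hmq

open Classical in
variable (N e X) in
/-- The commutator `⁅X p, X k⁆` as an element of the commutative group `cornerGroup`, with the
value `1` if it does not lie there. -/
noncomputable def brk (p k : R) : cornerGroup N e X :=
  if h : ⁅X p, X k⁆ ∈ cornerGroup N e X then ⟨⁅X p, X k⁆, h⟩ else 1

theorem coe_brk (hB : BlockSystem U N e E) (hX : IsLocalHom N e X) {p k : R}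
    (hp : p ∈ supp N e rowA) (hk : k ∈ supp N e colD) :
    (brk N e X p k : Γ) = ⁅X p, X k⁆ := by
  rw [brk, dif_pos (bracket_mem hB hX hp hk)]

theorem brk_add_right (hB : BlockSystem U N e E) (hX : IsLocalHom N e X) {p k k' : R}
    (hp : p ∈ supp N e rowA) (hk : k ∈ supp N e colD) (hk' : k' ∈ supp N e colD) :
    brk N e X p (k + k') = brk N e X p k * brk N e X p k' := by
  ext
  rw [Subgroup.coe_mul, coe_brk hB hX hp hk, coe_brk hB hX hp hk',
    coe_brk hB hX hp (add_mem hk hk'), map_add_colD hB hX hk hk',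
    bracket_mul_right_of_commute
      (commute_of_mem_cornerGroup (bracket_mem hB hX hp hk') (.inr hk))]

theorem brk_add_left (hB : BlockSystem U N e E) (hX : IsLocalHom N e X) {p p' k : R}
    (hp : p ∈ supp N e rowA) (hp' : p' ∈ supp N e rowA) (hk : k ∈ supp N e colD) :
    brk N e X (p + p') k = brk N e X p k * brk N e X p' k := by
  rw [mul_comm]
  ext
  rw [Subgroup.coe_mul, coe_brk hB hX hp hk, coe_brk hB hX hp' hk,
    coe_brk hB hX (add_mem hp hp') hk, map_add_rowA hB hX hp hp',
    bracket_mul_left_of_commute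
      (commute_of_mem_cornerGroup (bracket_mem hB hX hp' hk) (.inl hp))]

theorem brk_zero_right (hB : BlockSystem U N e E) (hX : IsLocalHom N e X) {p : R}
    (hp : p ∈ supp N e rowA) : brk N e X p 0 = 1 := by
  ext
  rw [coe_brk hB hX hp (zero_mem _), hX.map_zero]
  simp

theorem brk_zero_left (hB : BlockSystem U N e E) (hX : IsLocalHom N e X) {k : R}
    (hk : k ∈ supp N e colD) : brk N e X 0 k = 1 := by
  ext
  rw [coe_brk hB hX (zero_mem _) hk, hX.map_zero]
  simp

theorem brk_sum_right (hB : BlockSystem U N e E) (hX : IsLocalHom N e X) {p : R}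
    (hp : p ∈ supp N e rowA) {ι : Type*} (s : Finset ι) (k : ι → R)
    (hk : ∀ i, k i ∈ supp N e colD) :
    brk N e X p (∑ i ∈ s, k i) = ∏ i ∈ s, brk N e X p (k i) := by
  classical
  induction s using Finset.induction_on with
  | empty => exact brk_zero_right hB hX hp
  | insert a s ha ih =>
    rw [Finset.sum_insert ha, Finset.prod_insert ha,
      brk_add_right hB hX hp (hk a) (sum_mem fun i _ => hk i), ih]

theorem brk_sum_left (hB : BlockSystem U N e E) (hX : IsLocalHom N e X) {k : R}
    (hk : k ∈ supp N e colD) {ι : Type*} (s : Finset ι) (p : ι → R)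
    (hp : ∀ i, p i ∈ supp N e rowA) :
    brk N e X (∑ i ∈ s, p i) k = ∏ i ∈ s, brk N e X (p i) k := by
  classical
  induction s using Finset.induction_on with
  | empty => exact brk_zero_left hB hX hk
  | insert a s ha ih =>
    rw [Finset.sum_insert ha, Finset.prod_insert ha,
      brk_add_left hB hX (hp a) (sum_mem fun i _ => hp i) hk, ih]

theorem brk_assoc (hB : BlockSystem U N e E) (hX : IsLocalHom N e X) {p r q : R}
    (hp : p ∈ supp N e {(0, 1), (0, 2)}) (hr : r ∈ supp N e {(1, 3), (2, 3)})
    (hq : q ∈ supp N e {(3, 4)}) : brk N e X p (r * q) = brk N e X (p * r) q := by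
  have hpr : p * r ∈ supp N e {(0, 3)} := hB.mul_mem_supp hp hr
  have hrq : r * q ∈ supp N e {(1, 4), (2, 4)} := hB.mul_mem_supp hr hq
  ext
  rw [coe_brk hB hX (supp_mono hp) (supp_mono hrq), coe_brk hB hX (supp_mono hpr) (supp_mono hq),
    bracket_assoc hB hX hp hr hq]

/-- A relation between the anchors gives a relation between commutators: by assumption it comes
from relations in `B₁ C`, which can be moved into the first argument. -/
theorem prod_brk_anchor_eq_one (hB : BlockSystem U N e E) (hX : IsLocalHom N e X) (k : T → R)
    (hk : ∀ t, k t ∈ supp N e {(1, 4)}) (h : ∑ t, E t * k t = 0) :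
    ∏ t, brk N e X (E t) (k t) = 1 := by
  obtain ⟨r, q, hr, hq, hkrq, hE⟩ := hB.syz k hk h
  have hrq : ∀ u t, r u t * q u ∈ supp N e {(1, 4)} := fun u t => hB.mul_mem_supp (hr u t) (hq u)
  have h1 : ∀ t, brk N e X (E t) (k t) = ∏ u, brk N e X (E t * r u t) (q u) := by
    intro t
    rw [hkrq t, brk_sum_right hB hX (supp_mono (hB.anchor_mem t)) _ _
      fun u => supp_mono (hrq u t)]
    exact Finset.prod_congr rfl fun u _ =>
      brk_assoc hB hX (supp_mono (hB.anchor_mem t)) (supp_mono (hr u t)) (hq u)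
  rw [Finset.prod_congr rfl fun t _ => h1 t, Finset.prod_comm]
  refine Finset.prod_eq_one fun u _ => ?_
  have h2 : ∀ t, E t * r u t ∈ supp N e {(0, 3)} := fun t =>
    hB.mul_mem_supp (hB.anchor_mem t) (hr u t)
  rw [← brk_sum_left hB hX (supp_mono (hq u)) _ _ fun t => supp_mono (h2 t), hE u,
    brk_zero_left hB hX (supp_mono (hq u))]

/-- The block `A D`, which lies in none of the three subgroups, still has a well-defined image:
there is a homomorphism `φ` on it with `⁅X p, X k⁆ = φ (p * k)`. -/
theorem exists_cornerMap (hB : BlockSystem U N e E) (hX : IsLocalHom N e X) :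
    ∃ φ : R → cornerGroup N e X,
      (∀ m ∈ supp N e {(0, 4)}, ∀ m' ∈ supp N e {(0, 4)}, φ (m + m') = φ m * φ m') ∧
      ∀ p ∈ supp N e rowA, ∀ k ∈ supp N e colD, ⁅X p, X k⁆ = φ (p * k) := by
  classical
  choose! K hK hK' using fun m (hm : m ∈ supp N e {(0, 4)}) => hB.gen_AD hm
  have hE : ∀ t, E t ∈ supp N e rowA := fun t => supp_mono (hB.anchor_mem t)
  have hEk : ∀ t, ∀ k ∈ supp N e {(1, 4)}, E t * k ∈ supp N e {(0, 4)} := fun t k hk =>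
    hB.mul_mem_supp (hB.anchor_mem t) hk
  let φ : R → cornerGroup N e X := fun m => ∏ t, brk N e X (E t) (K m t)
  have hφ : ∀ k : T → R, (∀ t, k t ∈ supp N e {(1, 4)}) →
      φ (∑ t, E t * k t) = ∏ t, brk N e X (E t) (k t) := by
    intro k hk
    have hm : ∑ t, E t * k t ∈ supp N e {(0, 4)} := sum_mem fun t _ => hEk t _ (hk t)
    have h1 := prod_brk_anchor_eq_one hB hX (fun t => k t - K (∑ t, E t * k t) t)
      (fun t => sub_mem (hk t) (hK _ hm t))
      (by simp only [mul_sub, Finset.sum_sub_distrib]; rw [← hK' _ hm, sub_self])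
    have h2 : ∀ t, brk N e X (E t) (k t) =
        brk N e X (E t) (k t - K (∑ t, E t * k t) t) * brk N e X (E t) (K (∑ t, E t * k t) t) := by
      intro t
      rw [← brk_add_right hB hX (hE t) (supp_mono (sub_mem (hk t) (hK _ hm t)))
        (supp_mono (hK _ hm t)), sub_add_cancel]
    rw [Finset.prod_congr rfl fun t _ => h2 t, Finset.prod_mul_distrib, h1, one_mul]
  have hadd : ∀ m ∈ supp N e {(0, 4)}, ∀ m' ∈ supp N e {(0, 4)}, φ (m + m') = φ m * φ m' := by
    intro m hm m' hm'
    have h1 : m + m' = ∑ t, E t * (K m t + K m' t) := by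
      simp only [mul_add, Finset.sum_add_distrib]
      rw [← hK' m hm, ← hK' m' hm']
    rw [h1, hφ _ fun t => add_mem (hK m hm t) (hK m' hm' t), ← Finset.prod_mul_distrib]
    exact Finset.prod_congr rfl fun t _ =>
      brk_add_right hB hX (hE t) (supp_mono (hK m hm t)) (supp_mono (hK m' hm' t))
  have hφ0 : φ 0 = 1 := by
    have := hadd 0 (zero_mem _) 0 (zero_mem _)
    rw [add_zero] at this
    exact left_eq_mul.1 this
  have hsingle : ∀ t, ∀ k ∈ supp N e {(1, 4)}, φ (E t * k) = brk N e X (E t) k := by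
    intro t k hk
    have h1 : ∀ t', (Pi.single t k : T → R) t' ∈ supp N e {(1, 4)} := by
      intro t'
      by_cases h : t' = t
      · subst h
        rwa [Pi.single_eq_same]
      · rw [Pi.single_eq_of_ne h]
        exact zero_mem _
    have h2 := hφ (Pi.single t k) h1
    rw [Finset.sum_eq_single t (fun t' _ h => by rw [Pi.single_eq_of_ne h, mul_zero])
      fun h => absurd (Finset.mem_univ _) h, Pi.single_eq_same,
      Finset.prod_eq_single t (fun t' _ h => by
        rw [Pi.single_eq_of_ne h, brk_zero_right hB hX (hE t')])
      fun h => absurd (Finset.mem_univ _) h, Pi.single_eq_same] at h2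
    exact h2
  have hC : ∀ m ∈ supp N e {(0, 3)}, ∀ q ∈ supp N e {(3, 4)}, brk N e X m q = φ (m * q) := by
    intro m hm q hq
    refine hB.induction_AC (P := fun m => brk N e X m q = φ (m * q)) ?_ ?_ ?_ hm
    · rw [brk_zero_left hB hX (supp_mono hq), zero_mul, hφ0]
    · intro x hx y hy h1 h2
      rw [brk_add_left hB hX (supp_mono hx) (supp_mono hy) (supp_mono hq), h1, h2, add_mul,
        hadd _ (hB.mul_mem_supp hx hq) _ (hB.mul_mem_supp hy hq)]
    · intro t r hr
      rw [← brk_assoc hB hX (supp_mono (hB.anchor_mem t)) (supp_mono hr) hq, mul_assoc,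
        hsingle t _ (hB.mul_mem_supp hr hq)]
  have hBD : ∀ p ∈ supp N e {(0, 1), (0, 2)}, ∀ k ∈ supp N e {(1, 4), (2, 4)},
      brk N e X p k = φ (p * k) := by
    intro p hp k hk
    refine hB.induction_BD (P := fun k => brk N e X p k = φ (p * k)) ?_ ?_ ?_ hk
    · rw [brk_zero_right hB hX (supp_mono hp), mul_zero, hφ0]
    · intro x hx y hy h1 h2
      rw [brk_add_right hB hX (supp_mono hp) (supp_mono hx) (supp_mono hy), h1, h2, mul_add,
        hadd _ (hB.mul_mem_supp hp hx) _ (hB.mul_mem_supp hp hy)]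
    · intro r hr q hq
      rw [brk_assoc hB hX hp hr hq, hC _ (hB.mul_mem_supp hp hr) _ hq, mul_assoc]
  refine ⟨φ, hadd, fun p hp k hk => ?_⟩
  rw [← coe_brk hB hX hp hk]
  congr 1
  obtain ⟨b, hb, m, hm, rfl⟩ := hB.exists_rowA hp
  obtain ⟨b', hb', q, hq, rfl⟩ := hB.exists_colD hk
  have hbA : b ∈ supp N e rowA := supp_mono hb
  have hmA : m ∈ supp N e rowA := supp_mono hm
  have hbD : b' ∈ supp N e colD := supp_mono hb'
  have hqD : q ∈ supp N e colD := supp_mono hq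
  have hbq : brk N e X b q = 1 := by
    ext
    rw [coe_brk hB hX hbA hqD]
    exact bracket_eq_one_of_commute (hX.commute hB 3 hb hq)
  have hmb : brk N e X m b' = 1 := by
    ext
    rw [coe_brk hB hX hmA hbD]
    exact bracket_eq_one_of_commute (commute_AC_BD hB hX hm hb')
  have h1 : (b + m) * (b' + q) = b * b' + m * q := by
    rw [add_mul, mul_add, mul_add, hB.mul_eq_zero_of_supp hb hq, hB.mul_eq_zero_of_supp hm hb',
      add_zero, zero_add]
  rw [brk_add_left hB hX hbA hmA hk, brk_add_right hB hX hbA hbD hqD,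
    brk_add_right hB hX hmA hbD hqD, hbq, hmb, mul_one, one_mul, h1,
    hadd _ (hB.mul_mem_supp hb hb') _ (hB.mul_mem_supp hm hq), hBD _ hb _ hb', hC _ hm _ hq]

end CornerMap

end UnipPres

namespace UnipPres

open scoped commutatorElement

/-! ### Words over the three cuts -/

section WordNormalForm

variable {R : Type*} [Ring R] {T : Type} [Fintype T] {U : Type} [Fintype U] {N : AddSubgroup R}
  {e : Fin 5 → R} {E : T → R} {Γ : Type*} [Group Γ] {X : R → Γ}

variable (N e X) in
/-- `φ` maps the block `A D` to the corner group compatibly with commutators. -/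
structure IsCornerMap (φ : R → cornerGroup N e X) : Prop where
  map_add : ∀ m ∈ supp N e {(0, 4)}, ∀ m' ∈ supp N e {(0, 4)}, φ (m + m') = φ m * φ m'
  bracket : ∀ p ∈ supp N e rowA, ∀ k ∈ supp N e colD, ⁅X p, X k⁆ = φ (p * k)

/-- The positions inside the diagonal blocks `A`, `B ∪ C`, `D`. -/
def diagSet : Finset (Fin 5 × Fin 5) := cutSet 1 ∩ cutSet 4

/-- The map on the last block column obtained from the corner map and from `X`. -/
def colMap (e : Fin 5 → R) (X : R → Γ) {H : Subgroup Γ} (φ : R → H) (v : R) : Γ :=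
  φ (e 0 * v) * X (v - e 0 * v)

variable {φ : R → cornerGroup N e X}

theorem IsCornerMap.map_zero (hφ : IsCornerMap N e X φ) : φ 0 = 1 := by
  have := hφ.map_add 0 (zero_mem _) 0 (zero_mem _)
  rw [add_zero] at this
  exact left_eq_mul.1 this

theorem BlockSystem.row_zero_mem (hB : BlockSystem U N e E) {v : R}
    (hv : v ∈ supp N e fullColD) : e 0 * v ∈ supp N e {(0, 4)} := hB.row_mem 0 hv

theorem BlockSystem.sub_row_zero_mem (hB : BlockSystem U N e E) {v : R}
    (hv : v ∈ supp N e fullColD) : v - e 0 * v ∈ supp N e colD := by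
  have h : v - e 0 * v = e 1 * v + e 2 * v + e 3 * v := by
    conv_lhs => lhs; rw [hB.eq_sum_rows v, Fin.sum_univ_five, hB.row_eq_zero 4 hv]
    abel
  rw [h]
  exact add_mem (add_mem (hB.row_mem 1 hv) (hB.row_mem 2 hv)) (hB.row_mem 3 hv)

theorem colMap_add_eq (hB : BlockSystem U N e E) {m k : R} (hm : m ∈ supp N e {(0, 4)})
    (hk : k ∈ supp N e colD) : colMap e X φ (m + k) = φ m * X k := by
  have h : e 0 * (m + k) = m := by
    rw [mul_add, hB.row_eq_self 0 hm, hB.row_eq_zero 0 hk, add_zero]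
  rw [colMap, h, add_sub_cancel_left]

theorem colMap_zero (hX : IsLocalHom N e X) (hφ : IsCornerMap N e X φ) :
    colMap e X φ 0 = 1 := by
  rw [colMap, mul_zero, sub_zero, hφ.map_zero, hX.map_zero, Subgroup.coe_one, mul_one]

theorem colMap_add (hB : BlockSystem U N e E) (hX : IsLocalHom N e X)
    (hφ : IsCornerMap N e X φ) {v w : R} (hv : v ∈ supp N e fullColD)
    (hw : w ∈ supp N e fullColD) : colMap e X φ (v + w) = colMap e X φ v * colMap e X φ w := by
  have h1 := hB.row_zero_mem hv
  have h2 := hB.row_zero_mem hw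
  have h3 := hB.sub_row_zero_mem hv
  have h4 := hB.sub_row_zero_mem hw
  have h5 : v + w - e 0 * (v + w) = (v - e 0 * v) + (w - e 0 * w) := by
    rw [mul_add]
    abel
  rw [colMap, colMap, colMap, h5, mul_add, hφ.map_add _ h1 _ h2, map_add_colD hB hX h3 h4,
    Subgroup.coe_mul]
  have h6 := commute_of_mem_cornerGroup (φ (e 0 * w)).2 (.inr h3)
  simp only [mul_assoc]
  congr 1
  rw [← mul_assoc, ← mul_assoc, h6.eq]

/-- Conjugation of the last block column by `A × (B ∪ C)`. -/
theorem mul_colMap_of_rowA (hB : BlockSystem U N e E)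
    (hφ : IsCornerMap N e X φ) {p v : R} (hp : p ∈ supp N e rowA) (hv : v ∈ supp N e fullColD) :
    X p * colMap e X φ v = colMap e X φ (v + p * v) * X p := by
  have h1 := hB.row_zero_mem hv
  have h3 := hB.sub_row_zero_mem hv
  obtain ⟨m, hm, k, hk, rfl⟩ : ∃ m ∈ supp N e {(0, 4)}, ∃ k ∈ supp N e colD, v = m + k :=
    ⟨_, h1, _, h3, by abel⟩
  have hpk : p * k ∈ supp N e {(0, 4)} := hB.mul_mem_supp hp hk
  have h4 : m + k + p * (m + k) = (m + p * k) + k := by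
    rw [mul_add, hB.mul_eq_zero_of_supp hp hm]
    abel
  rw [h4, colMap_add_eq hB hm hk, colMap_add_eq hB (add_mem hm hpk) hk, hφ.map_add _ hm _ hpk,
    Subgroup.coe_mul, ← hφ.bracket p hp k hk, ← mul_assoc,
    (commute_of_mem_cornerGroup (φ m).2 (.inl hp)).eq, commutatorElement_def]
  group

theorem mul_mul_mul_of_mul_eq_one {a b : R} (h : b * a = 1) (x y : R) :
    a * (x * y) * b = a * x * b * (a * y * b) := by
  calc a * (x * y) * b = a * x * 1 * y * b := by simp only [mul_assoc, mul_one]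
    _ = _ := by simp only [← h, mul_assoc]

/-- Conjugation of the last block column by the diagonal blocks. -/
theorem mul_colMap_of_diagSet (hB : BlockSystem U N e E) (hX : IsLocalHom N e X)
    (hφ : IsCornerMap N e X φ) {h h' v : R} (hh : h ∈ supp N e diagSet)
    (hh' : h' ∈ supp N e diagSet) (hinv : h' + h + h' * h = 0)
    (hv : v ∈ supp N e fullColD) :
    X h * colMap e X φ v = colMap e X φ ((1 + h) * v * (1 + h')) * X h := by
  have hexp : ∀ x, (1 + h) * x * (1 + h') = x + h * x + x * h' + h * x * h' := by
    intro x
    noncomm_ring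
  have hconj : ∀ x, (1 + h) * x * (1 + h') * (1 + h) = (1 + h) * x := by
    intro x
    rw [mul_assoc _ (1 + h'), one_add_mul_one_add, hinv, add_zero, mul_one]
  have hcirc : ∀ x, h + x + h * x =
      (1 + h) * x * (1 + h') + h + (1 + h) * x * (1 + h') * h := by
    intro x
    have h1 := hconj x
    rw [mul_add, mul_one, add_mul 1 h x, one_mul] at h1
    rw [add_mul 1 h x, one_mul, add_right_comm _ h, h1]
    abel
  have hadd : ∀ x y, (1 + h) * (x + y) * (1 + h') =
      (1 + h) * x * (1 + h') + (1 + h) * y * (1 + h') := fun x y => by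
    rw [mul_add (1 + h), add_mul _ _ (1 + h')]
  have hmem : ∀ Z : Finset (Fin 5 × Fin 5),
      (∀ i j k, (i, j) ∈ diagSet → (j, k) ∈ Z → (i, k) ∈ Z) →
      (∀ i j k, (i, j) ∈ Z → (j, k) ∈ diagSet → (i, k) ∈ Z) → ∀ x ∈ supp N e Z,
      (1 + h) * x * (1 + h') ∈ supp N e Z := by
    intro Z h1 h2 x hx
    rw [hexp]
    have h3 := hB.mul_mem_supp hh hx h1
    exact add_mem (add_mem (add_mem hx h3) (hB.mul_mem_supp hx hh' h2))
      (hB.mul_mem_supp h3 hh' h2)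
  have hXp : ∀ p ∈ supp N e rowA, X h * X p * (X h)⁻¹ = X ((1 + h) * p * (1 + h')) := by
    intro p hp
    have hp' := hmem rowA (by decide) (by decide) p hp
    rw [mul_inv_eq_iff_eq_mul, ← hX.map_circ_supp 4 hh hp, ← hX.map_circ_supp 4 hp' hh]
    congr 1
    exact hcirc p
  have hXk : ∀ k ∈ supp N e colD, X h * X k * (X h)⁻¹ = X ((1 + h) * k * (1 + h')) := by
    intro k hk
    have hk' := hmem colD (by decide) (by decide) k hk
    rw [mul_inv_eq_iff_eq_mul, ← hX.map_circ_supp 1 hh hk, ← hX.map_circ_supp 1 hk' hh]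
    congr 1
    exact hcirc k
  have hm4 := hmem {(0, 4)} (by decide) (by decide)
  have hXm : ∀ m ∈ supp N e {(0, 4)},
      X h * φ m * (X h)⁻¹ = φ ((1 + h) * m * (1 + h')) := by
    intro m hm
    obtain ⟨k, hk, rfl⟩ := hB.gen_AD hm
    refine (Finset.sum_induction (fun t => E t * k t) (fun m => m ∈ supp N e {(0, 4)} ∧
      X h * φ m * (X h)⁻¹ = φ ((1 + h) * m * (1 + h'))) ?_ ?_ ?_).2
    · rintro x y ⟨hx, hx'⟩ ⟨hy, hy'⟩
      refine ⟨add_mem hx hy, ?_⟩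
      rw [hφ.map_add _ hx _ hy, hadd, hφ.map_add _ (hm4 x hx) _ (hm4 y hy),
        Subgroup.coe_mul, Subgroup.coe_mul, ← hx', ← hy']
      group
    · refine ⟨zero_mem _, ?_⟩
      rw [mul_zero, zero_mul, hφ.map_zero, Subgroup.coe_one]
      group
    · intro t _
      have hE : E t ∈ supp N e rowA := supp_mono (hB.anchor_mem t)
      have hk' : k t ∈ supp N e colD := supp_mono (hk t)
      refine ⟨hB.mul_mem_supp (hB.anchor_mem t) (hk t), ?_⟩
      have h1 : (1 + h) * (E t * k t) * (1 + h') =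
          ((1 + h) * E t * (1 + h')) * ((1 + h) * k t * (1 + h')) := by
        have h2 : (1 + h') * (1 + h) = 1 := by rw [one_add_mul_one_add, hinv, add_zero]
        exact mul_mul_mul_of_mul_eq_one h2 _ _
      rw [h1, ← hφ.bracket _ hE _ hk', ← hφ.bracket _ (hmem rowA (by decide) (by decide) _ hE) _
        (hmem colD (by decide) (by decide) _ hk'), ← hXp _ hE, ← hXk _ hk', commutatorElement_def,
        commutatorElement_def]
      group
  have h1 := hB.row_zero_mem hv
  have h3 := hB.sub_row_zero_mem hv
  obtain ⟨m, hm, k, hk, rfl⟩ : ∃ m ∈ supp N e {(0, 4)}, ∃ k ∈ supp N e colD, v = m + k :=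
    ⟨_, h1, _, h3, by abel⟩
  rw [hadd, colMap_add_eq hB hm hk, colMap_add_eq hB (hm4 m hm)
    (hmem colD (by decide) (by decide) k hk), ← hXm m hm, ← hXk k hk]
  group

/-- The subgroup of the last cut normalizes the image of the last block column. -/
theorem exists_mul_colMap (hB : BlockSystem U N e E) (hX : IsLocalHom N e X)
    (hφ : IsCornerMap N e X φ) {y v : R} (hy : y ∈ supp N e (cutSet 4))
    (hv : v ∈ supp N e fullColD) : ∃ v' ∈ supp N e fullColD,
      X y * colMap e X φ v = colMap e X φ v' * X y ∧ (1 + y) * v = v' * (1 + y) := by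
  -- factor `1 + y = (1 + h) * (1 + p)` with `h` block diagonal and `p` in the first block row
  have hp₀ : e 0 * y * e 1 + e 0 * y * e 2 + e 0 * y * e 3 ∈ supp N e rowA := by
    have h0 : e 0 * y ∈ supp N e {(0, 0), (0, 1), (0, 2), (0, 3)} := hB.row_mem 0 hy
    exact add_mem (add_mem (hB.col_mem 1 h0) (hB.col_mem 2 h0)) (hB.col_mem 3 h0)
  set p₀ := e 0 * y * e 1 + e 0 * y * e 2 + e 0 * y * e 3 with hp₀_def
  have hh : y - p₀ ∈ supp N e diagSet := by
    refine supp_inter (Z := cutSet 4) (W := cutSet 1) (sub_mem hy (supp_mono hp₀)) ?_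
    have h0 : e 0 * y ∈ supp N e {(0, 0), (0, 1), (0, 2), (0, 3)} := hB.row_mem 0 hy
    have h1 : y - p₀ = e 0 * y * e 0 + (e 1 * y + e 2 * y + e 3 * y + e 4 * y) := by
      have h2 : y = e 0 * y + e 1 * y + e 2 * y + e 3 * y + e 4 * y := by
        conv_lhs => rw [hB.eq_sum_rows y, Fin.sum_univ_five]
      have h3 : e 0 * y = e 0 * y * e 0 + p₀ := by
        conv_lhs => rw [hB.eq_sum_cols (e 0 * y), Fin.sum_univ_five, hB.col_eq_zero 4 h0]
        rw [hp₀_def]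
        abel
      conv_lhs => lhs; rw [h2, h3]
      abel
    rw [h1]
    exact add_mem (hB.col_mem 0 h0) (add_mem (add_mem (add_mem (hB.row_mem 1 hy)
      (hB.row_mem 2 hy)) (hB.row_mem 3 hy)) (hB.row_mem 4 hy))
  set h := y - p₀ with hh_def
  obtain ⟨h', -, hinv, hinv', hcut⟩ := hB.inv h hh.1
  have hh' : h' ∈ supp N e diagSet :=
    supp_inter (hcut 1 (by decide) (supp_mono hh)) (hcut 4 (by decide) (supp_mono hh))
  have hp : p₀ + h' * p₀ ∈ supp N e rowA := add_mem hp₀ (hB.mul_mem_supp hh' hp₀)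
  set p := p₀ + h' * p₀ with hp_def
  have hhp : h + p + h * p = y := by
    have : p + h * p = p₀ + (h + h' + h * h') * p₀ := by
      rw [hp_def]
      noncomm_ring
    rw [add_assoc, this, hinv, zero_mul, add_zero, hh_def, sub_add_cancel]
  have hXy : X y = X h * X p := by
    rw [← hhp]
    exact hX.map_circ_supp 4 hh hp
  have hpv : v + p * v ∈ supp N e fullColD := add_mem hv (hB.mul_mem_supp hp hv)
  refine ⟨(1 + h) * (v + p * v) * (1 + h'), ?_, ?_, ?_⟩
  · have : (1 + h) * (v + p * v) * (1 + h') = (v + p * v) + h * (v + p * v) + (v + p * v) * h' +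
        h * (v + p * v) * h' := by noncomm_ring
    rw [this]
    have h3 : h * (v + p * v) ∈ supp N e fullColD := hB.mul_mem_supp hh hpv
    exact add_mem (add_mem (add_mem hpv h3) (hB.mul_mem_supp hpv hh')) (hB.mul_mem_supp h3 hh')
  · rw [hXy, mul_assoc, mul_colMap_of_rowA hB hφ hp hv, ← mul_assoc,
      mul_colMap_of_diagSet hB hX hφ hh hh' hinv' hpv, mul_assoc]
  · have h1 : (1 + y) = (1 + h) * (1 + p) := by rw [one_add_mul_one_add, hhp]
    have h2 : (1 + h') * (1 + h) = 1 := by rw [one_add_mul_one_add, hinv', add_zero]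
    have h3 : (v + p * v) * p = 0 := hB.mul_eq_zero_of_supp hpv hp
    rw [h1]
    calc (1 + h) * (1 + p) * v = (1 + h) * (v + p * v + (v + p * v) * p) := by
          rw [h3]
          noncomm_ring
      _ = (1 + h) * (v + p * v) * ((1 + h') * (1 + h)) * (1 + p) := by
          rw [h2]
          noncomm_ring
      _ = _ := by simp only [mul_assoc]

/-- A letter in the subgroup of the first or second cut splits off its last block column. -/
theorem exists_letter_factor (hB : BlockSystem U N e E) (hX : IsLocalHom N e X)
    (hφ : IsCornerMap N e X φ) {k : Fin 5} (hk : k = 1 ∨ k = 3) {y : R}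
    (hy : y ∈ supp N e (cutSet k)) : ∃ w ∈ supp N e fullColD, ∃ g ∈ supp N e (cutSet 4),
      X y = colMap e X φ w * X g ∧ 1 + y = (1 + w) * (1 + g) := by
  have hcut : k ∈ cuts := by rcases hk with rfl | rfl <;> decide
  -- the positions of the last block column that do not straddle the cut `k`
  have hwk : y * e 4 - e 4 * (y * e 4) ∈ supp N e (colD ∩ cutSet k) := by
    have h1 : y * e 4 - e 4 * (y * e 4) =
        e 0 * (y * e 4) + e 1 * (y * e 4) + e 2 * (y * e 4) + e 3 * (y * e 4) := by
      conv_lhs => lhs; rw [hB.eq_sum_rows (y * e 4), Fin.sum_univ_five]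
      abel
    rw [h1]
    have h2 : y * e 4 ∈ supp N e ((colD ∩ cutSet k) ∪ {(4, 4)}) := by
      rcases hk with rfl | rfl <;> exact hB.col_mem 4 hy
    rcases hk with rfl | rfl <;> exact add_mem (add_mem (add_mem (hB.row_mem 0 h2)
      (hB.row_mem 1 h2)) (hB.row_mem 2 h2)) (hB.row_mem 3 h2)
  set w₀ := y * e 4 - e 4 * (y * e 4) with hw₀_def
  have hg : y - w₀ ∈ supp N e (cutSet k ∩ cutSet 4) := by
    refine supp_inter (Z := cutSet k) (W := cutSet 4)
      (sub_mem hy (supp_mono hwk Finset.inter_subset_right)) ?_ subset_rfl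
    have h1 : y - w₀ = (y * e 0 + y * e 1 + y * e 2 + y * e 3) + e 4 * (y * e 4) := by
      have h2 : y = y * e 0 + y * e 1 + y * e 2 + y * e 3 + y * e 4 := by
        conv_lhs => rw [hB.eq_sum_cols y, Fin.sum_univ_five]
      rw [hw₀_def]
      conv_lhs => lhs; rw [h2]
      abel
    rw [h1]
    have h3 : y * e 4 ∈ supp N e ((colD ∩ cutSet k) ∪ {(4, 4)}) := by
      rcases hk with rfl | rfl <;> exact hB.col_mem 4 hy
    rcases hk with rfl | rfl <;> exact add_mem (add_mem (add_mem (add_mem (hB.col_mem 0 hy)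
      (hB.col_mem 1 hy)) (hB.col_mem 2 hy)) (hB.col_mem 3 hy)) (hB.row_mem 4 h3)
  set g := y - w₀ with hg_def
  have hgk : g ∈ supp N e (cutSet k) := supp_mono hg Finset.inter_subset_left
  obtain ⟨g', -, -, hinv', hcutg⟩ := hB.inv g hg.1
  have hg' : g' ∈ supp N e (cutSet k ∩ cutSet 4) :=
    supp_inter (hcutg k hcut hgk)
      (hcutg 4 (by decide) (supp_mono hg Finset.inter_subset_right)) subset_rfl
  have hw : w₀ + w₀ * g' ∈ supp N e (colD ∩ cutSet k) := by
    refine add_mem hwk ?_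
    rcases hk with rfl | rfl <;> exact hB.mul_mem_supp hwk hg'
  set w := w₀ + w₀ * g' with hw_def
  have hwg : w + g + w * g = y := by
    have h1 : w + w * g = w₀ + w₀ * (g' + g + g' * g) := by
      rw [hw_def]
      noncomm_ring
    rw [add_right_comm, h1, hinv', mul_zero, add_zero, hg_def, add_sub_cancel]
  have hwD : w ∈ supp N e colD := supp_mono hw Finset.inter_subset_left
  refine ⟨w, supp_mono hwD, g, supp_mono hg Finset.inter_subset_right, ?_, ?_⟩
  · have h1 := colMap_add_eq (X := X) (φ := φ) hB (zero_mem (supp N e {(0, 4)})) hwD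
    rw [zero_add, hφ.map_zero, Subgroup.coe_one, one_mul] at h1
    rw [h1, ← hX.map_circ k hcut w (supp_mono hw Finset.inter_subset_right) g hgk, hwg]
  · rw [one_add_mul_one_add, hwg]

/-- Normal form of a word over the three cuts: last block column times the last cut. -/
theorem exists_word_normalForm (hB : BlockSystem U N e E) (hX : IsLocalHom N e X)
    (hφ : IsCornerMap N e X φ) (L : List R)
    (hL : ∀ y ∈ L, ∃ k ∈ cuts, y ∈ supp N e (cutSet k)) :
    ∃ v ∈ supp N e fullColD, ∃ h ∈ supp N e (cutSet 4),
      (L.map X).prod = colMap e X φ v * X h ∧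
      (L.map fun y => 1 + y).prod = (1 + v) * (1 + h) := by
  induction L with
  | nil =>
    refine ⟨0, zero_mem _, 0, zero_mem _, ?_, ?_⟩
    · rw [colMap_zero hX hφ, hX.map_zero, List.map_nil, List.prod_nil, mul_one]
    · rw [List.map_nil, List.prod_nil, add_zero, mul_one]
  | cons y L ih =>
    obtain ⟨v, hv, h, hh, hXv, h1v⟩ := ih fun y hy => hL y (List.mem_cons_of_mem _ hy)
    have hy : ∃ w ∈ supp N e fullColD, ∃ g ∈ supp N e (cutSet 4),
        X y = colMap e X φ w * X g ∧ 1 + y = (1 + w) * (1 + g) := by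
      obtain ⟨k, hk, hyk⟩ := hL y List.mem_cons_self
      have hk' : ∀ k ∈ cuts, (k = 1 ∨ k = 3) ∨ k = 4 := by decide
      rcases hk' k hk with hk | rfl
      · exact exists_letter_factor hB hX hφ hk hyk
      · refine ⟨0, zero_mem _, y, hyk, ?_, ?_⟩
        · rw [colMap_zero hX hφ, one_mul]
        · rw [add_zero, one_mul]
    obtain ⟨w, hw, g, hg, hXw, h1w⟩ := hy
    obtain ⟨v', hv', hXv', h1v'⟩ := exists_mul_colMap hB hX hφ hg hv
    have hgh : g * h ∈ supp N e (cutSet 4) := hB.mul_mem_supp hg hh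
    refine ⟨w + v', add_mem hw hv', g + h + g * h, add_mem (add_mem hg hh) hgh, ?_, ?_⟩
    · rw [List.map_cons, List.prod_cons, hXv, hXw, colMap_add hB hX hφ hw hv',
        hX.map_circ_supp 4 hg hh]
      calc colMap e X φ w * X g * (colMap e X φ v * X h)
          = colMap e X φ w * (X g * colMap e X φ v) * X h := by group
        _ = _ := by
          rw [hXv']
          group
    · have hwv : w * v' = 0 := hB.mul_eq_zero_of_supp hw hv'
      rw [List.map_cons, List.prod_cons, h1v, h1w]
      calc (1 + w) * (1 + g) * ((1 + v) * (1 + h))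
          = (1 + w) * ((1 + g) + (1 + g) * v) * (1 + h) := by noncomm_ring
        _ = (1 + w + v' + w * v') * (1 + (g + h + g * h)) := by
          rw [h1v']
          noncomm_ring
        _ = _ := by rw [hwv, add_zero, add_assoc 1 w v']

/-- The colimit of the three cut subgroups embeds into the group of unipotent elements. -/
theorem prod_map_eq_one (hB : BlockSystem U N e E) (hX : IsLocalHom N e X) (L : List R)
    (hL : ∀ y ∈ L, ∃ k ∈ cuts, y ∈ supp N e (cutSet k))
    (h : (L.map fun y => 1 + y).prod = 1) : (L.map X).prod = 1 := by
  obtain ⟨φ, hφ₁, hφ₂⟩ := exists_cornerMap hB hX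
  have hφ : IsCornerMap N e X φ := ⟨hφ₁, hφ₂⟩
  obtain ⟨v, hv, y, hy, hXv, h1v⟩ := exists_word_normalForm hB hX hφ L hL
  rw [h1v, one_add_mul_one_add, add_eq_left] at h
  have hvy : v * y ∈ supp N e fullColD := hB.mul_mem_supp hv hy
  have hy0 : y = 0 := by
    have h1 : y = -(v + v * y) := by
      rw [eq_neg_iff_add_eq_zero, ← h]
      abel
    refine hB.eq_zero_of_mem_supp (supp_inter (W := fullColD) hy ?_)
    rw [h1]
    exact neg_mem (add_mem hv hvy)
  subst hy0
  rw [add_zero, mul_zero, add_zero] at h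
  rw [hXv, h, colMap_zero hX hφ, hX.map_zero, mul_one]

end WordNormalForm

end UnipPres

namespace UnipPres

open scoped Polynomial

/-! ### Factorizations and syzygies of graded matrices -/

section Polynomials

open Polynomial

variable {F : Type*} [Field F]

/-- Expansion of a polynomial along the powers `X ^ d τ`, with coefficients of degree at most
`D`, as long as the gaps of `d` are at most `D`. -/
theorem exists_digits (d : ℕ → ℕ) (D : ℕ) (h0 : d 0 = 0) (hd : ∀ τ, d (τ + 1) ≤ d τ + D) (K : ℕ)
    (f : F[X]) (hf : f.natDegree ≤ d K + D) :
    ∃ g : ℕ → F[X], (∀ τ, (g τ).natDegree ≤ D) ∧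
      f = ∑ τ ∈ Finset.range (K + 1), X ^ d τ * g τ := by
  induction K generalizing f with
  | zero =>
    rw [h0, zero_add] at hf
    refine ⟨fun _ => f, fun _ => hf, ?_⟩
    rw [Finset.sum_range_one, h0, pow_zero, one_mul]
  | succ K ih =>
    have hmonic : (X ^ d (K + 1) : F[X]).Monic := monic_X_pow _
    obtain ⟨g, hg, hfg⟩ := ih (f %ₘ X ^ d (K + 1)) (by
      have := natDegree_modByMonic_le f hmonic
      rw [natDegree_X_pow] at this
      exact this.trans (hd K))
    refine ⟨Function.update g (K + 1) (f /ₘ X ^ d (K + 1)), fun τ => ?_, ?_⟩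
    · by_cases hτ : τ = K + 1
      · subst hτ
        rw [Function.update_self, natDegree_divByMonic _ hmonic, natDegree_X_pow]
        omega
      · rw [Function.update_of_ne hτ]
        exact hg τ
    · rw [Finset.sum_range_succ, Function.update_self]
      conv_lhs => rw [← modByMonic_add_div f (X ^ d (K + 1)), hfg]
      congr 1
      refine Finset.sum_congr rfl fun τ hτ => ?_
      rw [Function.update_of_ne (Finset.mem_range.1 hτ).ne]

/-- A syzygy of the powers `X ^ d τ` is a combination of the syzygies between consecutive powers;
the coefficients `S` obey the degree bound one expects. -/
theorem exists_syzygy_coeffs (d : ℕ → ℕ) (D : ℕ) (h0 : d 0 = 0) (hmono : Monotone d)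
    (hd : ∀ τ, d (τ + 1) - d τ ≤ D) (K : ℕ) (k : ℕ → F[X]) (hk : ∀ τ, (k τ).natDegree ≤ D)
    (hsum : ∑ τ ∈ Finset.range K, X ^ d τ * k τ = 0) :
    ∃ S : ℕ → F[X], S 0 = 0 ∧ S K = 0 ∧
      (∀ τ < K, X ^ (d (τ + 1) - d τ) * S (τ + 1) = k τ + S τ) ∧
      ∀ τ < K, (S (τ + 1)).natDegree + (d (τ + 1) - d τ) ≤ D := by
  let S : ℕ → F[X] := fun τ => -∑ τ' ∈ Finset.Ico τ K, X ^ (d τ' - d τ) * k τ'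
  have hS0 : S 0 = 0 := by
    simp only [S, h0, Nat.sub_zero]
    rw [← Finset.range_eq_Ico, hsum, neg_zero]
  have hrel : ∀ τ < K, X ^ (d (τ + 1) - d τ) * S (τ + 1) = k τ + S τ := by
    intro τ hτ
    simp only [S]
    rw [Finset.sum_eq_sum_Ico_succ_bot hτ, Nat.sub_self, pow_zero, one_mul, neg_add,
      add_neg_cancel_left, mul_neg, Finset.mul_sum]
    congr 1
    refine Finset.sum_congr rfl fun τ' hτ' => ?_
    have h1 : d τ ≤ d (τ + 1) := hmono (Nat.le_succ _)
    have h2 : d (τ + 1) ≤ d τ' := hmono (Finset.mem_Ico.1 hτ').1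
    rw [← mul_assoc, ← pow_add]
    congr 2
    omega
  have hstep : ∀ τ < K, (S τ).natDegree ≤ D →
      (S (τ + 1)).natDegree + (d (τ + 1) - d τ) ≤ D := by
    intro τ hτ hS
    by_cases hz : S (τ + 1) = 0
    · rw [hz, natDegree_zero, zero_add]
      exact hd τ
    · rw [← natDegree_X_pow_mul _ hz, hrel τ hτ]
      exact natDegree_add_le_of (hk τ) hS
  have hdeg : ∀ τ ≤ K, (S τ).natDegree ≤ D := by
    intro τ
    induction τ with
    | zero =>
      intro _
      rw [hS0, natDegree_zero]
      exact Nat.zero_le _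
    | succ τ ih =>
      intro hτ
      exact (Nat.le_add_right _ _).trans (hstep τ hτ (ih (Nat.le_of_succ_le hτ)))
  refine ⟨S, hS0, by simp [S], hrel, fun τ hτ => hstep τ hτ (hdeg τ hτ.le)⟩

end Polynomials

section Anchors

variable {F : Type*} [Field F] {n κ : ℕ}

/-- The column of the anchor in row `i`: rows are numbered modulo `h` inside the interval
`[u, u + h)`. -/
def anchorCol {n : ℕ} (h u : ℕ) (hh : 0 < h) (hu : u + h ≤ n + 1) (i : Fin (n + 1)) :
    Fin (n + 1) :=
  ⟨u + i % h, by have := Nat.mod_lt i.1 hh; omega⟩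

open Classical in
/-- The anchor matrices. For `t = (σ, τ)` the rows `i` with `P i` and `i / h = σ` have a single
nonzero entry, in the column `anchorCol i`, which is a power of `X`. The exponent is
`τ κ h`, cut off at the degree bound lowered by `δ i`. -/
noncomputable def anchor (F : Type*) [Field F] {n : ℕ} (κ h u : ℕ) {L : ℕ}
    (P : Fin (n + 1) → Prop) (δ : Fin (n + 1) → ℕ) (t : Fin L × Fin L) :
    Matrix (Fin (n + 1)) (Fin (n + 1)) F[X] :=
  Matrix.of fun k l => if P k ∧ (k : ℕ) / h = t.1 ∧ (l : ℕ) = u + k % h then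
    Polynomial.X ^ min (t.2 * (κ * h)) (κ * (l - k) - δ k) else 0

variable {h u L : ℕ} {P Q : Fin (n + 1) → Prop} {δ : Fin (n + 1) → ℕ}

theorem anchor_apply_ne_zero {t : Fin L × Fin L} {k l : Fin (n + 1)}
    (hkl : anchor F κ h u P δ t k l ≠ 0) :
    P k ∧ (k : ℕ) / h = t.1 ∧ (l : ℕ) = u + k % h := by
  by_contra hc
  exact hkl (if_neg hc)

open Classical in
theorem anchor_mul_apply (hh : 0 < h) (hu : u + h ≤ n + 1) (t : Fin L × Fin L)
    (M : Matrix (Fin (n + 1)) (Fin (n + 1)) F[X]) (i j : Fin (n + 1)) :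
    (anchor F κ h u P δ t * M) i j = if P i ∧ (i : ℕ) / h = t.1 then
      Polynomial.X ^ min (t.2 * (κ * h)) (κ * ((u + i % h) - i) - δ i) *
        M (anchorCol h u hh hu i) j else 0 := by
  rw [Matrix.mul_apply, Finset.sum_eq_single (anchorCol h u hh hu i)]
  · by_cases hc : P i ∧ (i : ℕ) / h = t.1
    · rw [if_pos hc]
      congr 1
      exact if_pos ⟨hc.1, hc.2, rfl⟩
    · rw [if_neg hc]
      have : anchor F κ h u P δ t i (anchorCol h u hh hu i) = 0 :=
        if_neg fun h' => hc ⟨h'.1, h'.2.1⟩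
      rw [this, zero_mul]
  · intro l _ hl
    have : anchor F κ h u P δ t i l = 0 := if_neg fun h' => hl (Fin.ext h'.2.2)
    rw [this, zero_mul]
  · exact fun h' => absurd (Finset.mem_univ _) h'

theorem natDegree_anchor_le (t : Fin L × Fin L) (k l : Fin (n + 1)) :
    (anchor F κ h u P δ t k l).natDegree ≤ κ * ((l : ℕ) - (k : ℕ)) - δ k := by
  by_cases hc : P k ∧ (k : ℕ) / h = t.1 ∧ (l : ℕ) = u + k % h
  · have : anchor F κ h u P δ t k l =
        Polynomial.X ^ min (t.2 * (κ * h)) (κ * (l - k) - δ k) := if_pos hc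
    rw [this, Polynomial.natDegree_X_pow]
    exact min_le_right _ _
  · have : anchor F κ h u P δ t k l = 0 := if_neg hc
    rw [this, Polynomial.natDegree_zero]
    exact Nat.zero_le _

theorem anchor_mem_gradedStrict (hP : ∀ i, P i → (i : ℕ) < u) (t : Fin L × Fin L) :
    anchor F κ h u P δ t ∈ gradedStrict F n κ := by
  intro k l
  refine ⟨(natDegree_anchor_le t k l).trans (Nat.sub_le _ _), fun hlk => ?_⟩
  by_contra hne
  obtain ⟨h1, -, h3⟩ := anchor_apply_ne_zero hne
  have h4 := hP k h1
  have h5 : (l : ℕ) ≤ k := hlk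
  omega

open Classical in
/-- A matrix with rows in `P`, which lies before `u`, and columns in `Q`, which lies after
`u + 2 h`, is a combination of the anchors: each entry is expanded along the powers of `X` that
occur in the anchors. The slack `δ` in the degrees of the matrix is inherited by the anchors. -/
theorem exists_eq_sum_anchor_mul (hh : 0 < h) (hu : u + h ≤ n + 1) (hL : n + 1 ≤ (L - 1) * h)
    (hP : ∀ i, P i → (i : ℕ) < u) (hQ : ∀ j, Q j → u + 2 * h ≤ (j : ℕ))
    {x : Matrix (Fin (n + 1)) (Fin (n + 1)) F[X]}
    (hx : ∀ i j, x i j ≠ 0 → P i ∧ Q j)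
    (hdeg : ∀ i j, P i → Q j → (x i j).natDegree + δ i ≤ κ * ((j : ℕ) - (i : ℕ))) :
    ∃ r : Fin L × Fin L → Matrix (Fin (n + 1)) (Fin (n + 1)) F[X],
      (∀ t, r t ∈ gradedStrict F n κ) ∧
      (∀ t k l, r t k l ≠ 0 → (u ≤ (k : ℕ) ∧ (k : ℕ) < u + h) ∧ Q l) ∧
      x = ∑ t, anchor F κ h u P δ t * r t := by
  obtain ⟨K, rfl⟩ : ∃ K, L = K + 1 := by
    refine ⟨L - 1, ?_⟩
    have : L - 1 ≠ 0 := by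
      intro h0
      rw [h0] at hL
      omega
    omega
  rw [Nat.add_sub_cancel] at hL
  have hdig : ∀ i j : Fin (n + 1), P i → Q j → ∃ g : ℕ → F[X],
      (∀ τ, (g τ).natDegree ≤ κ * ((j : ℕ) - (u + i % h))) ∧
      x i j = ∑ τ ∈ Finset.range (K + 1),
        Polynomial.X ^ min (τ * (κ * h)) (κ * ((u + i % h) - i) - δ i) * g τ := by
    intro i j hi hj
    have h1 := hP i hi
    have h2 := hQ j hj
    have h3 := Nat.mod_lt i.1 hh
    have h4 : κ * h ≤ κ * ((j : ℕ) - (u + i % h)) := Nat.mul_le_mul_left _ (by omega)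
    refine exists_digits (fun τ => min (τ * (κ * h)) (κ * ((u + i % h) - i) - δ i)) _ (by simp)
      (fun τ => ?_) K (x i j) ?_
    · have h5 : (τ + 1) * (κ * h) = τ * (κ * h) + κ * h := by ring
      simp only [h5]
      omega
    · have h5 : κ * ((u + i % h) - i) ≤ K * (κ * h) := by
        calc κ * ((u + i % h) - i) ≤ κ * (K * h) := Nat.mul_le_mul_left _ (by omega)
          _ = K * (κ * h) := by ring
      have h6 : κ * ((j : ℕ) - (i : ℕ)) =
          κ * ((u + i % h) - i) + κ * ((j : ℕ) - (u + i % h)) := by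
        rw [← mul_add]
        congr 1
        omega
      have h7 := hdeg i j hi hj
      omega
  choose! g hg hxg using hdig
  obtain ⟨r, hr⟩ : ∃ r : Fin (K + 1) × Fin (K + 1) → Matrix (Fin (n + 1)) (Fin (n + 1)) F[X],
      ∀ t k l, r t k l =
        if hc : (u ≤ (k : ℕ) ∧ (k : ℕ) < u + h) ∧ Q l ∧ t.1 * h + (k - u) < n + 1 then
          if P ⟨t.1 * h + (k - u), hc.2.2⟩ then g ⟨t.1 * h + (k - u), hc.2.2⟩ l t.2 else 0
        else 0 :=
    ⟨fun t => Matrix.of fun k l => _, fun t k l => rfl⟩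
  refine ⟨r, fun t k l => ?_, fun t k l hne => ?_, ?_⟩
  · rw [hr]
    split_ifs with hc hp
    · have h1 := hg _ _ hp hc.2.1 t.2
      have h2 : (t.1 * h + (k - u)) % h = k - u := by
        rw [Nat.add_comm, Nat.add_mul_mod_self_right]
        exact Nat.mod_eq_of_lt (by omega)
      simp only [h2] at h1
      rw [Nat.add_sub_cancel' hc.1.1] at h1
      refine ⟨h1, fun hlk => ?_⟩
      have h3 := hQ l hc.2.1
      have h4 : (l : ℕ) ≤ k := hlk
      omega
    · simp
    · simp
  · rw [hr] at hne
    by_cases hc : (u ≤ (k : ℕ) ∧ (k : ℕ) < u + h) ∧ Q l ∧ t.1 * h + (k - u) < n + 1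
    · exact ⟨hc.1, hc.2.1⟩
    · rw [dif_neg hc] at hne
      exact absurd rfl hne
  · ext1 i j
    rw [Matrix.sum_apply]
    simp only [anchor_mul_apply hh hu]
    by_cases hi : P i
    swap
    · have h1 : x i j = 0 := by
        by_contra hne
        exact hi (hx i j hne).1
      rw [h1]
      exact (Finset.sum_eq_zero fun t _ => if_neg fun h' => hi h'.1).symm
    by_cases hj : Q j
    swap
    · have h1 : x i j = 0 := by
        by_contra hne
        exact hj (hx i j hne).2
      rw [h1]
      refine (Finset.sum_eq_zero fun t _ => ?_).symm
      rw [hr, dif_neg fun h' => hj h'.2.1, mul_zero, ite_self]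
    have hdiv : (i : ℕ) / h < K + 1 := by
      rw [Nat.div_lt_iff_lt_mul hh]
      calc (i : ℕ) < n + 1 := i.2
        _ ≤ K * h := hL
        _ ≤ (K + 1) * h := Nat.mul_le_mul_right _ (Nat.le_succ _)
    rw [Fintype.sum_prod_type, Finset.sum_eq_single (⟨i / h, hdiv⟩ : Fin (K + 1))]
    · rw [hxg i j hi hj, ← Fin.sum_univ_eq_sum_range (fun τ => Polynomial.X ^
        min (τ * (κ * h)) (κ * ((u + i % h) - i) - δ i) * g i j τ) (K + 1)]
      refine Finset.sum_congr rfl fun τ _ => ?_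
      rw [if_pos ⟨hi, rfl⟩, hr]
      have h1 := Nat.mod_lt i.1 hh
      have h2 : (i : ℕ) / h * h + (u + i % h - u) = i := by
        rw [Nat.add_sub_cancel_left]
        exact Nat.div_add_mod' _ _
      have hc : (u ≤ (anchorCol h u hh hu i : ℕ) ∧ (anchorCol h u hh hu i : ℕ) < u + h) ∧ Q j ∧
          (i : ℕ) / h * h + ((anchorCol h u hh hu i : ℕ) - u) < n + 1 :=
        ⟨⟨Nat.le_add_right _ _, Nat.add_lt_add_left h1 _⟩, hj, h2.symm ▸ i.2⟩
      rw [dif_pos hc]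
      have h3 : (⟨(i : ℕ) / h * h + ((anchorCol h u hh hu i : ℕ) - u), hc.2.2⟩ : Fin (n + 1)) = i :=
        Fin.ext h2
      simp only [h3, if_pos hi]
    · intro σ _ hσ
      refine Finset.sum_eq_zero fun τ _ => if_neg fun h' => hσ (Fin.ext h'.2.symm)
    · exact fun h' => absurd (Finset.mem_univ _) h'

end Anchors

end UnipPres

namespace UnipPres

open scoped Polynomial

/-! ### The block system of graded matrices -/

section MatrixBlocks

/-- The numerical conditions on the three cuts: the blocks `B` and `C` are long compared with `h`,
and `h` is long compared with `n`. (Since `n + 1` is positive, `le_mul` forces `1 < L`.) -/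
structure IsCut (n h L ℓ₁ ℓ₂ ℓ₃ : ℕ) : Prop where
  pos : 0 < h
  gap₁ : ℓ₁ + 4 * h ≤ ℓ₂
  gap₂ : ℓ₂ + 2 * h ≤ ℓ₃
  le_n : ℓ₃ ≤ n
  le_mul : n + 1 ≤ (L - 1) * h

/-- The number of the block that contains the index `k`; the block `B` is split after `2 h`
indices. -/
def blk (h ℓ₁ ℓ₂ ℓ₃ k : ℕ) : Fin 5 :=
  if k < ℓ₁ then 0 else if k < ℓ₁ + 2 * h then 1 else if k < ℓ₂ then 2 else if k < ℓ₃ then 3 else 4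

/-- The first index behind the cut `k`, for `k` in `cuts`. -/
def cutPos (ℓ₁ ℓ₂ ℓ₃ : ℕ) (k : Fin 5) : ℕ := if k = 1 then ℓ₁ else if k = 3 then ℓ₂ else ℓ₃

variable {n h L ℓ₁ ℓ₂ ℓ₃ : ℕ}

theorem blk_eq_zero_iff {k : ℕ} : blk h ℓ₁ ℓ₂ ℓ₃ k = 0 ↔ k < ℓ₁ := by
  unfold blk
  split_ifs <;> simp_all

theorem blk_eq_one_iff {k : ℕ} :
    blk h ℓ₁ ℓ₂ ℓ₃ k = 1 ↔ ℓ₁ ≤ k ∧ k < ℓ₁ + 2 * h := by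
  unfold blk
  split_ifs <;> simp <;> omega

theorem blk_eq_two_iff {k : ℕ} :
    blk h ℓ₁ ℓ₂ ℓ₃ k = 2 ↔ ℓ₁ + 2 * h ≤ k ∧ k < ℓ₂ := by
  unfold blk
  split_ifs <;> simp <;> omega

theorem blk_eq_three_iff (H : IsCut n h L ℓ₁ ℓ₂ ℓ₃) {k : ℕ} :
    blk h ℓ₁ ℓ₂ ℓ₃ k = 3 ↔ ℓ₂ ≤ k ∧ k < ℓ₃ := by
  have := H.gap₁
  unfold blk
  split_ifs <;> simp <;> omega

theorem blk_eq_four_iff (H : IsCut n h L ℓ₁ ℓ₂ ℓ₃) {k : ℕ} :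
    blk h ℓ₁ ℓ₂ ℓ₃ k = 4 ↔ ℓ₃ ≤ k := by
  have := H.gap₁
  have := H.gap₂
  unfold blk
  split_ifs <;> simp <;> omega

theorem blk_mono (H : IsCut n h L ℓ₁ ℓ₂ ℓ₃) {k l : ℕ} (hkl : k ≤ l) :
    blk h ℓ₁ ℓ₂ ℓ₃ k ≤ blk h ℓ₁ ℓ₂ ℓ₃ l := by
  have := H.gap₁
  have := H.gap₂
  unfold blk
  split_ifs <;> omega

theorem blk_lt_iff (H : IsCut n h L ℓ₁ ℓ₂ ℓ₃) {c : Fin 5} (hc : c ∈ cuts) (k : ℕ) :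
    blk h ℓ₁ ℓ₂ ℓ₃ k < c ↔ k < cutPos ℓ₁ ℓ₂ ℓ₃ c := by
  have := H.gap₁
  have := H.gap₂
  have hc' : c = 1 ∨ c = 3 ∨ c = 4 := by
    revert c
    decide
  unfold blk cutPos
  rcases hc' with rfl | rfl | rfl <;> split_ifs <;> simp_all <;> omega

/-- The idempotent diagonal matrix of a block. -/
noncomputable def blockIdem (F : Type*) [Field F] (n h ℓ₁ ℓ₂ ℓ₃ : ℕ) (i : Fin 5) :
    Matrix (Fin (n + 1)) (Fin (n + 1)) F[X] :=
  Matrix.diagonal fun k => if blk h ℓ₁ ℓ₂ ℓ₃ k = i then 1 else 0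

variable {F : Type*} [Field F] {κ : ℕ}

theorem blockIdem_mul_apply (i : Fin 5) (x : Matrix (Fin (n + 1)) (Fin (n + 1)) F[X])
    (k l : Fin (n + 1)) : (blockIdem F n h ℓ₁ ℓ₂ ℓ₃ i * x) k l =
      if blk h ℓ₁ ℓ₂ ℓ₃ k = i then x k l else 0 := by
  rw [blockIdem, Matrix.diagonal_mul, ite_mul, one_mul, zero_mul]

theorem mul_blockIdem_apply (i : Fin 5) (x : Matrix (Fin (n + 1)) (Fin (n + 1)) F[X])
    (k l : Fin (n + 1)) : (x * blockIdem F n h ℓ₁ ℓ₂ ℓ₃ i) k l =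
      if blk h ℓ₁ ℓ₂ ℓ₃ l = i then x k l else 0 := by
  rw [blockIdem, Matrix.mul_diagonal, mul_ite, mul_one, mul_zero]

theorem mem_supp_iff {Z : Finset (Fin 5 × Fin 5)}
    {x : Matrix (Fin (n + 1)) (Fin (n + 1)) F[X]} :
    x ∈ supp (gradedStrict F n κ) (blockIdem F n h ℓ₁ ℓ₂ ℓ₃) Z ↔ x ∈ gradedStrict F n κ ∧
      ∀ k l, x k l ≠ 0 → (blk h ℓ₁ ℓ₂ ℓ₃ k, blk h ℓ₁ ℓ₂ ℓ₃ l) ∈ Z := by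
  refine and_congr_right fun _ => ⟨fun hx k l hne => ?_, fun hx i j hij => ?_⟩
  · by_contra hc
    have h1 := congrFun (congrFun (hx _ _ hc) k) l
    rw [mul_blockIdem_apply, if_pos rfl, blockIdem_mul_apply, if_pos rfl] at h1
    exact hne h1
  · ext1 k l
    rw [mul_blockIdem_apply, blockIdem_mul_apply]
    split_ifs with h1 h2
    · by_contra hne
      exact hij (h2 ▸ h1 ▸ hx k l hne)
    · rfl
    · rfl

theorem mem_supp_cutSet_iff (H : IsCut n h L ℓ₁ ℓ₂ ℓ₃) {c : Fin 5} (hc : c ∈ cuts)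
    {x : Matrix (Fin (n + 1)) (Fin (n + 1)) F[X]} (hx : x ∈ gradedStrict F n κ) :
    x ∈ supp (gradedStrict F n κ) (blockIdem F n h ℓ₁ ℓ₂ ℓ₃) (cutSet c) ↔
      ∀ k l : Fin (n + 1), (k : ℕ) < cutPos ℓ₁ ℓ₂ ℓ₃ c → cutPos ℓ₁ ℓ₂ ℓ₃ c ≤ l → x k l = 0 := by
  rw [mem_supp_iff, and_iff_right hx]
  constructor
  · intro h1 k l hk hl
    by_contra hne
    have h2 := h1 k l hne
    rw [cutSet, Finset.mem_filter] at h2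
    refine h2.2.2 ⟨(blk_lt_iff H hc k).2 hk, ?_⟩
    rw [← not_lt, blk_lt_iff H hc]
    exact not_lt.2 hl
  · intro h1 k l hne
    rw [cutSet, Finset.mem_filter]
    refine ⟨Finset.mem_univ _, ?_, ?_⟩
    · refine blk_mono H ?_
      by_contra hlk
      exact hne ((hx k l).2 (not_le.1 hlk).le)
    · rintro ⟨hk, hl⟩
      refine hne (h1 k l ((blk_lt_iff H hc k).1 hk) ?_)
      rw [← not_lt, ← blk_lt_iff H hc]
      exact not_lt.2 hl

theorem completeOrthogonalIdempotents_blockIdem :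
    CompleteOrthogonalIdempotents (blockIdem F n h ℓ₁ ℓ₂ ℓ₃) where
  idem i := by
    rw [IsIdempotentElem, blockIdem, Matrix.diagonal_mul_diagonal]
    congr 1
    funext k
    split_ifs <;> simp
  ortho i j hij := by
    change blockIdem F n h ℓ₁ ℓ₂ ℓ₃ i * blockIdem F n h ℓ₁ ℓ₂ ℓ₃ j = 0
    rw [blockIdem, blockIdem, Matrix.diagonal_mul_diagonal, ← Matrix.diagonal_zero]
    congr 1
    funext k
    split_ifs with h1 h2
    · exact absurd (h1.symm.trans h2) hij
    · simp
    · simp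
    · simp
  complete := by
    ext1 k l
    rw [Matrix.sum_apply]
    by_cases hkl : k = l
    · subst hkl
      simp [blockIdem]
    · simp [blockIdem, Matrix.diagonal_apply_ne _ hkl, Matrix.one_apply_ne hkl]

/-- The anchors in a block, and the factorization of a pair of blocks through them. -/
theorem exists_block_fac (H : IsCut n h L ℓ₁ ℓ₂ ℓ₃) (u : ℕ) {i j : Fin 5} (J : Finset (Fin 5))
    (hu : u + h ≤ n + 1) (hP : ∀ m, blk h ℓ₁ ℓ₂ ℓ₃ m = i → m < u)
    (hQ : ∀ m, blk h ℓ₁ ℓ₂ ℓ₃ m ∈ J → u + 2 * h ≤ m)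
    (hj : ∀ m, u ≤ m → m < u + h → blk h ℓ₁ ℓ₂ ℓ₃ m = j) :
    (∀ t : Fin L × Fin L,
      anchor F κ h u (fun k : Fin (n + 1) => blk h ℓ₁ ℓ₂ ℓ₃ k = i) (fun _ => 0) t ∈
        supp (gradedStrict F n κ) (blockIdem F n h ℓ₁ ℓ₂ ℓ₃) {(i, j)}) ∧
    ∀ x ∈ supp (gradedStrict F n κ) (blockIdem F n h ℓ₁ ℓ₂ ℓ₃) ({i} ×ˢ J),
      ∃ r : Fin L × Fin L → Matrix (Fin (n + 1)) (Fin (n + 1)) F[X],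
        (∀ t, r t ∈ supp (gradedStrict F n κ) (blockIdem F n h ℓ₁ ℓ₂ ℓ₃) ({j} ×ˢ J)) ∧
        x = ∑ t, anchor F κ h u (fun k : Fin (n + 1) => blk h ℓ₁ ℓ₂ ℓ₃ k = i) (fun _ => 0) t *
          r t := by
  refine ⟨fun t => ?_, fun x hx => ?_⟩
  · rw [mem_supp_iff]
    refine ⟨anchor_mem_gradedStrict (fun k hk => hP k hk) t, fun k l hne => ?_⟩
    obtain ⟨h1, -, h3⟩ := anchor_apply_ne_zero hne
    have h4 := Nat.mod_lt k.1 H.pos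
    rw [h1, hj l (by omega) (by omega)]
    exact Finset.mem_singleton_self _
  · rw [mem_supp_iff] at hx
    obtain ⟨r, h1, h2, h3⟩ := exists_eq_sum_anchor_mul (κ := κ) (L := L)
      (P := fun k : Fin (n + 1) => blk h ℓ₁ ℓ₂ ℓ₃ k = i)
      (Q := fun k : Fin (n + 1) => blk h ℓ₁ ℓ₂ ℓ₃ k ∈ J) (δ := fun _ => 0) H.pos hu H.le_mul
      (fun k hk => hP k hk) (fun k hk => hQ k hk)
      (fun k l hne => by
        have h4 := Finset.mem_product.1 (hx.2 k l hne)
        exact ⟨Finset.mem_singleton.1 h4.1, h4.2⟩) (fun k l _ _ => (hx.1 k l).1)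
    refine ⟨r, fun t => mem_supp_iff.2 ⟨h1 t, fun k l hne => ?_⟩, h3⟩
    obtain ⟨h4, h5⟩ := h2 t k l hne
    rw [hj k h4.1 h4.2]
    simpa using h5

open Classical in
/-- The syzygies of the anchors between `A` and `B₁` in the columns of `D` come from syzygies in
the columns of `C`. In each row of `B₁` the anchors are powers of `X`, so a syzygy is a combination
of the syzygies between consecutive powers. The matrix of its coefficients lies in `B₁ D` and
satisfies a degree bound lowered by `δ`, the gap between the two powers; it factors through anchors
between `B₁` and `C` with the same slack `δ`, which leaves room for the powers of `X` in the
consecutive syzygies. -/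
theorem exists_block_syz (H : IsCut n h L ℓ₁ ℓ₂ ℓ₃)
    (k : Fin L × Fin L → Matrix (Fin (n + 1)) (Fin (n + 1)) F[X])
    (hk : ∀ t, k t ∈ supp (gradedStrict F n κ) (blockIdem F n h ℓ₁ ℓ₂ ℓ₃) {(1, 4)})
    (hsum : ∑ t, anchor F κ h ℓ₁ (fun k : Fin (n + 1) => blk h ℓ₁ ℓ₂ ℓ₃ k = 0) (fun _ => 0) t *
      k t = 0) :
    ∃ (r : (Fin L × Fin L) × (Fin L × Fin L) → Fin L × Fin L →
        Matrix (Fin (n + 1)) (Fin (n + 1)) F[X])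
      (q : (Fin L × Fin L) × (Fin L × Fin L) → Matrix (Fin (n + 1)) (Fin (n + 1)) F[X]),
      (∀ u t, r u t ∈ supp (gradedStrict F n κ) (blockIdem F n h ℓ₁ ℓ₂ ℓ₃) {(1, 3)}) ∧
      (∀ u, q u ∈ supp (gradedStrict F n κ) (blockIdem F n h ℓ₁ ℓ₂ ℓ₃) {(3, 4)}) ∧
      (∀ t, k t = ∑ u, r u t * q u) ∧
      ∀ u, ∑ t, anchor F κ h ℓ₁ (fun k : Fin (n + 1) => blk h ℓ₁ ℓ₂ ℓ₃ k = 0) (fun _ => 0) t *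
        r u t = 0 := by
  have hpos := H.pos
  have hg₁ := H.gap₁
  have hg₂ := H.gap₂
  have hn := H.le_n
  have hu : ℓ₁ + h ≤ n + 1 := by omega
  have hu' : ℓ₂ + h ≤ n + 1 := by omega
  have hk' := fun t => mem_supp_iff.1 (hk t)
  -- `A σ b` says that the row `b` of `B₁` is met by the anchors in the piece `σ` of `A`
  let A : ℕ → Fin (n + 1) → Prop := fun σ b =>
    (ℓ₁ ≤ (b : ℕ) ∧ (b : ℕ) < ℓ₁ + h) ∧ σ * h + (b - ℓ₁) < ℓ₁
  let d : ℕ → Fin (n + 1) → ℕ → ℕ := fun σ b τ =>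
    if A σ b then min (τ * (κ * h)) (κ * (b - (σ * h + (b - ℓ₁)))) else 0
  have hd0 : ∀ σ b, d σ b 0 = 0 := fun σ b => by simp [d]
  have hdmono : ∀ σ b, Monotone (d σ b) := by
    intro σ b τ τ' hτ
    by_cases hA : A σ b
    · simp only [d, if_pos hA]
      exact min_le_min_right _ (Nat.mul_le_mul_right _ hτ)
    · simp only [d, if_neg hA, le_refl]
  have hdstep : ∀ σ b τ, d σ b (τ + 1) - d σ b τ ≤ κ * h := by
    intro σ b τ
    by_cases hA : A σ b
    · simp only [d, if_pos hA]
      have : (τ + 1) * (κ * h) = τ * (κ * h) + κ * h := by ring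
      omega
    · simp [d, if_neg hA]
  -- the entries of the tuple `k`, numbered by natural numbers
  let f : Fin L → Fin (n + 1) → Fin (n + 1) → ℕ → F[X] := fun σ b j τ =>
    if hτ : τ < L then k (σ, ⟨τ, hτ⟩) b j else 0
  have hfdeg : ∀ σ b j τ, (f σ b j τ).natDegree ≤ κ * ((j : ℕ) - b) := by
    intro σ b j τ
    simp only [f]
    split_ifs with hτ
    · exact ((hk' _).1 b j).1
    · simp
  have hfsum : ∀ σ : Fin L, ∀ b j : Fin (n + 1), A σ b →
      ∑ τ ∈ Finset.range L, Polynomial.X ^ d σ b τ * f σ b j τ = 0 := by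
    intro σ b j hA
    have hi : σ * h + ((b : ℕ) - ℓ₁) < n + 1 := by
      have := hA.2
      omega
    have hmod : (σ * h + ((b : ℕ) - ℓ₁)) % h = b - ℓ₁ := by
      rw [Nat.add_comm, Nat.add_mul_mod_self_right]
      exact Nat.mod_eq_of_lt (by have := hA.1; omega)
    have hdiv : (σ * h + ((b : ℕ) - ℓ₁)) / h = σ := by
      rw [Nat.add_comm, Nat.add_mul_div_right _ _ hpos, Nat.div_eq_of_lt (by have := hA.1; omega),
        Nat.zero_add]
    have hcol : anchorCol h ℓ₁ hpos hu ⟨_, hi⟩ = b := by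
      refine Fin.ext ?_
      simp only [anchorCol, hmod]
      exact Nat.add_sub_cancel' hA.1.1
    have h1 := congrFun (congrFun hsum ⟨_, hi⟩) j
    rw [Matrix.sum_apply] at h1
    simp only [anchor_mul_apply hpos hu, hcol, hdiv, hmod, blk_eq_zero_iff, Nat.sub_zero] at h1
    rw [Fintype.sum_prod_type, Finset.sum_eq_single σ] at h1
    · rw [← Fin.sum_univ_eq_sum_range (fun τ => Polynomial.X ^ d σ b τ * f σ b j τ) L]
      refine Eq.trans (Finset.sum_congr rfl fun τ _ => ?_) h1
      rw [if_pos ⟨hA.2, rfl⟩]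
      simp only [d, f, if_pos hA, Fin.is_lt, dite_true]
      rw [Nat.add_sub_cancel' hA.1.1]
    · intro σ' _ hσ'
      exact Finset.sum_eq_zero fun τ _ => if_neg fun h' => hσ' (Fin.ext h'.2.symm)
    · exact fun h' => absurd (Finset.mem_univ _) h'
  -- the coefficients of the consecutive syzygies, row by row
  have hS : ∀ (σ : Fin L) (b j : Fin (n + 1)), blk h ℓ₁ ℓ₂ ℓ₃ b = 1 → blk h ℓ₁ ℓ₂ ℓ₃ j = 4 →
      ∃ S : ℕ → F[X], S 0 = 0 ∧ (A σ b → S L = 0) ∧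
        (∀ τ < L, Polynomial.X ^ (d σ b (τ + 1) - d σ b τ) * S (τ + 1) = f σ b j τ + S τ) ∧
        ∀ τ < L, (S (τ + 1)).natDegree + (d σ b (τ + 1) - d σ b τ) ≤ κ * ((j : ℕ) - b) := by
    intro σ b j hb hj
    rw [blk_eq_one_iff] at hb
    rw [blk_eq_four_iff H] at hj
    by_cases hA : A σ b
    · obtain ⟨S, h1, h2, h3, h4⟩ := exists_syzygy_coeffs (d σ b) (κ * ((j : ℕ) - b)) (hd0 σ b)
        (hdmono σ b) (fun τ => (hdstep σ b τ).trans (Nat.mul_le_mul_left _ (by omega))) L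
        (f σ b j) (hfdeg σ b j) (hfsum σ b j hA)
      exact ⟨S, h1, fun _ => h2, h3, h4⟩
    · have hd : ∀ τ, d σ b τ = 0 := fun τ => if_neg hA
      refine ⟨fun τ => ∑ τ' ∈ Finset.range τ, f σ b j τ', Finset.sum_range_zero _,
        fun h' => absurd h' hA, fun τ _ => ?_, fun τ _ => ?_⟩
      · beta_reduce
        rw [hd, hd, Nat.sub_self, pow_zero, one_mul, Finset.sum_range_succ, add_comm]
      · rw [hd, hd, Nat.sub_self, Nat.add_zero]
        exact Polynomial.natDegree_sum_le_of_forall_le _ _ fun τ' _ => hfdeg σ b j τ'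
  choose! S hS0 hSL hSrel hSdeg using hS
  -- factor the matrix of coefficients of each consecutive syzygy through `C`
  let P : Fin L × Fin L → Fin (n + 1) → Prop := fun t b =>
    blk h ℓ₁ ℓ₂ ℓ₃ b = 1 ∧ ¬ ((t.2 : ℕ) + 1 = L ∧ A t.1 b)
  let δ : Fin L × Fin L → Fin (n + 1) → ℕ := fun t b => d t.1 b (t.2 + 1) - d t.1 b t.2
  let M : Fin L × Fin L → Matrix (Fin (n + 1)) (Fin (n + 1)) F[X] := fun t =>
    Matrix.of fun b j => if blk h ℓ₁ ℓ₂ ℓ₃ b = 1 ∧ blk h ℓ₁ ℓ₂ ℓ₃ j = 4 then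
      S t.1 b j (t.2 + 1) else 0
  have hM : ∀ t (b j : Fin (n + 1)), M t b j = if blk h ℓ₁ ℓ₂ ℓ₃ b = 1 ∧ blk h ℓ₁ ℓ₂ ℓ₃ j = 4 then
      S t.1 b j (t.2 + 1) else 0 := fun t b j => rfl
  have hMfac : ∀ t, ∃ q : Fin L × Fin L → Matrix (Fin (n + 1)) (Fin (n + 1)) F[X],
      (∀ t', q t' ∈ gradedStrict F n κ) ∧
      (∀ t' b j, q t' b j ≠ 0 →
        (ℓ₂ ≤ (b : ℕ) ∧ (b : ℕ) < ℓ₂ + h) ∧ blk h ℓ₁ ℓ₂ ℓ₃ j = 4) ∧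
      M t = ∑ t', anchor F κ h ℓ₂ (P t) (δ t) t' * q t' := by
    intro t
    refine exists_eq_sum_anchor_mul (Q := fun j : Fin (n + 1) => blk h ℓ₁ ℓ₂ ℓ₃ j = 4) hpos hu'
      H.le_mul (fun b hb => ?_) (fun j hj => ?_) (fun b j hne => ?_) (fun b j hb hj => ?_)
    · have := blk_eq_one_iff.1 hb.1
      omega
    · have := (blk_eq_four_iff H).1 hj
      omega
    · rw [hM] at hne
      by_cases hbj : blk h ℓ₁ ℓ₂ ℓ₃ b = 1 ∧ blk h ℓ₁ ℓ₂ ℓ₃ j = 4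
      · rw [if_pos hbj] at hne
        refine ⟨⟨hbj.1, fun hc => hne ?_⟩, hbj.2⟩
        rw [hc.1]
        exact hSL _ _ _ hbj.1 hbj.2 hc.2
      · rw [if_neg hbj] at hne
        exact absurd rfl hne
    · rw [hM, if_pos ⟨hb.1, hj⟩]
      exact hSdeg _ _ _ hb.1 hj _ t.2.2
  choose q hq hqsupp hMq using hMfac
  -- the syzygy between the powers numbered `t₀` and its successor, evaluated at `t`
  let c : Fin L × Fin L → Fin L × Fin L → Fin (n + 1) → F[X] := fun t₀ t b =>
    (if t = t₀ then Polynomial.X ^ δ t₀ b else 0) -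
      if t.1 = t₀.1 ∧ (t.2 : ℕ) = t₀.2 + 1 then 1 else 0
  have hcdeg : ∀ t₀ t b, (c t₀ t b).natDegree ≤ δ t₀ b := by
    intro t₀ t b
    refine (Polynomial.natDegree_sub_le _ _).trans (max_le ?_ ?_)
    · split_ifs
      · exact Polynomial.natDegree_X_pow_le _
      · simp
    · split_ifs <;> simp
  refine ⟨fun u t => Matrix.diagonal (c u.1 t) * anchor F κ h ℓ₂ (P u.1) (δ u.1) u.2,
    fun u => q u.1 u.2, fun u t => ?_, fun u => ?_, fun t => ?_, fun u => ?_⟩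
  · beta_reduce
    rw [mem_supp_iff]
    have hne' : ∀ b l : Fin (n + 1), anchor F κ h ℓ₂ (P u.1) (δ u.1) u.2 b l ≠ 0 →
        (ℓ₁ ≤ (b : ℕ) ∧ (b : ℕ) < ℓ₁ + 2 * h) ∧ ℓ₂ ≤ (l : ℕ) ∧ (l : ℕ) < ℓ₂ + h := by
      intro b l hne
      obtain ⟨h1, -, h3⟩ := anchor_apply_ne_zero hne
      have h4 := Nat.mod_lt b.1 hpos
      exact ⟨blk_eq_one_iff.1 h1.1, by omega⟩
    refine ⟨fun b l => ?_, fun b l hne => ?_⟩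
    · rw [Matrix.diagonal_mul]
      by_cases hz : anchor F κ h ℓ₂ (P u.1) (δ u.1) u.2 b l = 0
      · rw [hz, mul_zero]
        simp
      obtain ⟨h1, h2⟩ := hne' b l hz
      refine ⟨?_, fun hlb => ?_⟩
      · refine Polynomial.natDegree_mul_le.trans ?_
        have h3 := hcdeg u.1 t b
        have h4 := natDegree_anchor_le (F := F) (κ := κ) (h := h) (u := ℓ₂) (P := P u.1)
          (δ := δ u.1) u.2 b l
        have h5 : δ u.1 b ≤ κ * h := hdstep _ _ _
        have h6 : κ * h ≤ κ * ((l : ℕ) - b) := Nat.mul_le_mul_left _ (by omega)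
        omega
      · have h3 : (l : ℕ) ≤ b := hlb
        omega
    · rw [Matrix.diagonal_mul] at hne
      obtain ⟨h1, h2⟩ := hne' b l (right_ne_zero_of_mul hne)
      rw [blk_eq_one_iff.2 h1, (blk_eq_three_iff H).2 (by omega)]
      decide
  · rw [mem_supp_iff]
    refine ⟨hq _ _, fun b j hne => ?_⟩
    obtain ⟨h1, h2⟩ := hqsupp _ _ b j hne
    rw [h2, (blk_eq_three_iff H).2 (by omega)]
    decide
  · have h1 : ∑ u : (Fin L × Fin L) × (Fin L × Fin L), Matrix.diagonal (c u.1 t) *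
        anchor F κ h ℓ₂ (P u.1) (δ u.1) u.2 * q u.1 u.2 =
        ∑ t₀, Matrix.diagonal (c t₀ t) * M t₀ := by
      rw [Fintype.sum_prod_type]
      refine Finset.sum_congr rfl fun t₀ _ => ?_
      rw [hMq t₀, Finset.mul_sum]
      exact Finset.sum_congr rfl fun t' _ => Matrix.mul_assoc _ _ _
    rw [h1]
    ext1 b j
    rw [Matrix.sum_apply]
    simp only [Matrix.diagonal_mul, hM]
    by_cases hbj : blk h ℓ₁ ℓ₂ ℓ₃ b = 1 ∧ blk h ℓ₁ ℓ₂ ℓ₃ j = 4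
    swap
    · simp only [if_neg hbj, mul_zero, Finset.sum_const_zero]
      by_contra hne
      have h2 := (hk' t).2 b j hne
      rw [Finset.mem_singleton, Prod.mk.injEq] at h2
      exact hbj h2
    simp only [if_pos hbj, c, sub_mul, ite_mul, one_mul, zero_mul, Finset.sum_sub_distrib]
    rw [Finset.sum_ite_eq, if_pos (Finset.mem_univ _)]
    have h2 : ∑ t₀ : Fin L × Fin L, (if t.1 = t₀.1 ∧ (t.2 : ℕ) = t₀.2 + 1 then
        S t₀.1 b j (t₀.2 + 1) else 0) = S t.1 b j t.2 := by
      obtain ⟨σ, ⟨τ, hτ⟩⟩ := t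
      cases τ with
      | zero =>
        rw [hS0 σ b j hbj.1 hbj.2]
        exact Finset.sum_eq_zero fun t₀ _ => if_neg fun h' => by simp at h'
      | succ τ =>
        rw [Finset.sum_eq_single (σ, ⟨τ, Nat.lt_of_succ_lt hτ⟩)]
        · exact if_pos ⟨rfl, rfl⟩
        · rintro ⟨σ', τ'⟩ - hne
          refine if_neg fun h' => hne ?_
          have h3 : τ + 1 = (τ' : ℕ) + 1 := h'.2
          exact Prod.ext h'.1.symm (Fin.ext (by simp only; omega))
        · exact fun h' => absurd (Finset.mem_univ _) h'
    rw [h2, hSrel _ _ _ hbj.1 hbj.2 _ t.2.2, add_sub_cancel_right]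
    simp only [f, Fin.is_lt, dite_true]
  · ext1 i j
    rw [Matrix.sum_apply]
    simp only [anchor_mul_apply hpos hu, Matrix.diagonal_mul, Nat.sub_zero]
    set b := anchorCol h ℓ₁ hpos hu i with hb
    set z := anchor F κ h ℓ₂ (P u.1) (δ u.1) u.2 b j with hz
    by_cases hi : blk h ℓ₁ ℓ₂ ℓ₃ i = 0 ∧ (i : ℕ) / h = u.1.1
    swap
    · refine Finset.sum_eq_zero fun t _ => ?_
      by_cases ht : blk h ℓ₁ ℓ₂ ℓ₃ i = 0 ∧ (i : ℕ) / h = t.1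
      · have h1 : t.1 ≠ u.1.1 := fun h' => hi (h' ▸ ht)
        have h2 : c u.1 t b = 0 := by
          simp only [c]
          rw [if_neg fun h' => h1 (by rw [h']), if_neg fun h' => h1 h'.1, sub_zero]
        rw [h2, zero_mul, mul_zero, ite_self]
      · exact if_neg ht
    -- the row `b` is met by the anchors, and its exponents are those of the row `i` of the anchors
    have hmod := Nat.mod_lt i.1 hpos
    have hbval : (b : ℕ) = ℓ₁ + i % h := rfl
    have hidx : (u.1.1 : ℕ) * h + ((b : ℕ) - ℓ₁) = i := by
      rw [hbval, Nat.add_sub_cancel_left, ← hi.2]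
      exact Nat.div_add_mod' _ _
    have hA : A u.1.1 b := by
      refine ⟨by omega, ?_⟩
      rw [hidx]
      exact blk_eq_zero_iff.1 hi.1
    have hdval : ∀ τ, d u.1.1 b τ = min (τ * (κ * h)) (κ * ((ℓ₁ + i % h) - i)) := by
      intro τ
      simp only [d]
      rw [if_pos hA, hidx, hbval]
    have hterm : ∀ t : Fin L × Fin L, (if blk h ℓ₁ ℓ₂ ℓ₃ i = 0 ∧ (i : ℕ) / h = t.1 then
        Polynomial.X ^ min (t.2 * (κ * h)) (κ * ((ℓ₁ + i % h) - i)) * (c u.1 t b * z) else 0) =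
        (if t = u.1 then Polynomial.X ^ d u.1.1 b (u.1.2 + 1) * z else 0) -
        if t.1 = u.1.1 ∧ (t.2 : ℕ) = u.1.2 + 1 then
          Polynomial.X ^ d u.1.1 b (u.1.2 + 1) * z else 0 := by
      intro t
      have hδ : d u.1.1 b u.1.2 + δ u.1 b = d u.1.1 b (u.1.2 + 1) :=
        Nat.add_sub_cancel' (hdmono _ _ (Nat.le_succ _))
      by_cases ht : t.1 = u.1.1
      swap
      · rw [if_neg fun h' => ht (Fin.ext (h'.2.symm.trans hi.2)),
          if_neg fun h' => ht (by rw [h']), if_neg fun h' => ht h'.1, sub_zero]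
      rw [if_pos ⟨hi.1, ht ▸ hi.2⟩, ← hdval]
      simp only [c]
      by_cases h1 : t = u.1
      · rw [if_pos h1, if_pos h1, if_neg, if_neg, sub_zero, sub_zero, h1, ← mul_assoc, ← pow_add,
          hδ]
        · rw [h1]
          exact fun h' => absurd h'.2 (by omega)
        · rw [h1]
          exact fun h' => absurd h'.2 (by omega)
      · rw [if_neg h1, if_neg h1]
        by_cases h2 : (t.2 : ℕ) = u.1.2 + 1
        · rw [if_pos ⟨ht, h2⟩, if_pos ⟨ht, h2⟩, h2]
          ring
        · rw [if_neg fun h' => h2 h'.2, if_neg fun h' => h2 h'.2]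
          ring
    rw [Finset.sum_congr rfl fun t _ => hterm t, Finset.sum_sub_distrib, Finset.sum_ite_eq',
      if_pos (Finset.mem_univ _)]
    change _ = (0 : F[X])
    by_cases hlast : (u.1.2 : ℕ) + 1 = L
    · have hz0 : z = 0 := by
        by_contra hne
        exact (anchor_apply_ne_zero hne).1.2 ⟨hlast, hA⟩
      rw [hz0]
      simp
    · have hlt : (u.1.2 : ℕ) + 1 < L := by
        have := u.1.2.2
        omega
      rw [Finset.sum_eq_single (u.1.1, ⟨u.1.2 + 1, hlt⟩), if_pos ⟨rfl, rfl⟩, sub_self]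
      · rintro ⟨σ', τ'⟩ - hne
        refine if_neg fun h' => hne (Prod.ext h'.1 (Fin.ext h'.2))
      · exact fun h' => absurd (Finset.mem_univ _) h'

end MatrixBlocks

end UnipPres

namespace UnipPres

open scoped Polynomial

/-! ### The block systems of a group and of a product of groups -/

section GroupBlocks

variable {n h L ℓ₁ ℓ₂ ℓ₃ : ℕ} {F : Type*} [Field F] {κ : ℕ}

theorem toMat_sub_one_mem (g : GrUnip F n κ) : toMat g - 1 ∈ gradedStrict F n κ :=
  (toMat_spec g).1

theorem toMat_sub_one_mem_supp_iff (H : IsCut n h L ℓ₁ ℓ₂ ℓ₃) {c : Fin 5} (hc : c ∈ cuts)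
    (g : GrUnip F n κ) :
    toMat g - 1 ∈ supp (gradedStrict F n κ) (blockIdem F n h ℓ₁ ℓ₂ ℓ₃) (cutSet c) ↔
      g ∈ stair F n κ (cutPos ℓ₁ ℓ₂ ℓ₃ c) := by
  rw [mem_supp_cutSet_iff H hc (toMat_sub_one_mem g), mem_stair_iff]
  refine forall₂_congr fun k l => forall₂_congr fun hk hl => ?_
  rw [Matrix.sub_apply, Matrix.one_apply_ne (by rintro rfl; omega), sub_zero]

/-- The graded matrices form a block system whose index types depend on `L` only. -/
theorem blockSystem_gradedStrict (H : IsCut n h L ℓ₁ ℓ₂ ℓ₃) :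
    BlockSystem ((Fin L × Fin L) × (Fin L × Fin L)) (gradedStrict F n κ)
      (blockIdem F n h ℓ₁ ℓ₂ ℓ₃)
      (fun t : Fin L × Fin L =>
        anchor F κ h ℓ₁ (fun k : Fin (n + 1) => blk h ℓ₁ ℓ₂ ℓ₃ k = 0) (fun _ => 0) t) where
  mul_mem _ hx _ hy := mul_mem_gradedStrict hx hy
  left_mem x hx i k l := by
    rw [blockIdem_mul_apply]
    split_ifs
    · exact hx k l
    · simp
  right_mem x hx i k l := by
    rw [mul_blockIdem_apply]
    split_ifs
    · exact hx k l
    · simp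
  idem := completeOrthogonalIdempotents_blockIdem
  upper x hx i j hji := by
    ext1 k l
    rw [mul_blockIdem_apply, blockIdem_mul_apply]
    split_ifs with h1 h2
    · refine (hx k l).2 (not_lt.1 fun hkl => ?_)
      have := blk_mono H (show (k : ℕ) ≤ l from hkl.le)
      omega
    · rfl
    · rfl
  inv y hy := by
    obtain ⟨g, hg⟩ := exists_toMat_eq hy
    have hy' : y = toMat g - 1 := by rw [hg, add_sub_cancel_left]
    have h1 : toMat g * toMat g⁻¹ = 1 := by rw [← map_mul, mul_inv_cancel, map_one]
    have h2 : toMat g⁻¹ * toMat g = 1 := by rw [← map_mul, inv_mul_cancel, map_one]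
    have h3 : ∀ a b : Matrix (Fin (n + 1)) (Fin (n + 1)) F[X], a * b = 1 →
        a - 1 + (b - 1) + (a - 1) * (b - 1) = 0 := by
      intro a b hab
      rw [sub_mul, mul_sub, hab]
      noncomm_ring
    refine ⟨toMat g⁻¹ - 1, toMat_sub_one_mem _, ?_, ?_, fun k hk => ?_⟩
    · rw [hy']
      exact h3 _ _ h1
    · rw [hy']
      exact h3 _ _ h2
    · rw [hy', toMat_sub_one_mem_supp_iff H hk, toMat_sub_one_mem_supp_iff H hk]
      exact inv_mem
  anchor_mem := (exists_block_fac H ℓ₁ ∅ (by have := H.gap₁; have := H.gap₂; have := H.le_n; omega)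
    (fun m => blk_eq_zero_iff.1) (by simp)
    (fun m h1 h2 => blk_eq_one_iff.2 (by omega))).1
  gen := (exists_block_fac H ℓ₁ {3, 4}
    (by have := H.gap₁; have := H.gap₂; have := H.le_n; omega)
    (fun m => blk_eq_zero_iff.1) (fun m hm => by
      have := H.gap₁
      have := H.gap₂
      rw [Finset.mem_insert, Finset.mem_singleton, blk_eq_three_iff H, blk_eq_four_iff H] at hm
      omega)
    (fun m h1 h2 => blk_eq_one_iff.2 (by omega))).2
  fac i j k hijk x hx := by
    have := H.gap₁
    have := H.gap₂
    have := H.le_n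
    simp only [Finset.mem_insert, Finset.mem_singleton, Prod.mk.injEq] at hijk
    obtain ⟨rfl, rfl, rfl⟩ | ⟨rfl, rfl, rfl⟩ | ⟨rfl, rfl, rfl⟩ := hijk
    · obtain ⟨h1, h2⟩ := exists_block_fac (F := F) (κ := κ) H (ℓ₁ + 2 * h) (i := 0) (j := 2) {3}
        (by omega) (fun m hm => by rw [blk_eq_zero_iff] at hm; omega)
        (fun m hm => by rw [Finset.mem_singleton, blk_eq_three_iff H] at hm; omega)
        (fun m h1 h2 => blk_eq_two_iff.2 (by omega))
      obtain ⟨r, h3, h4⟩ := h2 x hx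
      exact ⟨_, r, h1, h3, h4⟩
    · obtain ⟨h1, h2⟩ := exists_block_fac (F := F) (κ := κ) H ℓ₂ (i := 1) (j := 3) {4}
        (by omega) (fun m hm => by rw [blk_eq_one_iff] at hm; omega)
        (fun m hm => by rw [Finset.mem_singleton, blk_eq_four_iff H] at hm; omega)
        (fun m h1 h2 => (blk_eq_three_iff H).2 (by omega))
      obtain ⟨r, h3, h4⟩ := h2 x hx
      exact ⟨_, r, h1, h3, h4⟩
    · obtain ⟨h1, h2⟩ := exists_block_fac (F := F) (κ := κ) H ℓ₂ (i := 2) (j := 3) {4}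
        (by omega) (fun m hm => by rw [blk_eq_two_iff] at hm; omega)
        (fun m hm => by rw [Finset.mem_singleton, blk_eq_four_iff H] at hm; omega)
        (fun m h1 h2 => (blk_eq_three_iff H).2 (by omega))
      obtain ⟨r, h3, h4⟩ := h2 x hx
      exact ⟨_, r, h1, h3, h4⟩
  syz := exists_block_syz H

end GroupBlocks

section Pi

variable {K : Type*} {R : K → Type*} [∀ s, Ring (R s)] {T : Type} [Fintype T] {U : Type}
  [Fintype U] {N : ∀ s, AddSubgroup (R s)} {e : ∀ s, Fin 5 → R s} {E : ∀ s, T → R s}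

theorem mem_supp_pi_iff {Z : Finset (Fin 5 × Fin 5)} {x : ∀ s, R s} :
    x ∈ supp (AddSubgroup.pi Set.univ N) (fun i s => e s i) Z ↔
      ∀ s, x s ∈ supp (N s) (e s) Z := by
  constructor
  · exact fun hx s => ⟨hx.1 s trivial, fun i j hij => congrFun (hx.2 i j hij) s⟩
  · exact fun hx => ⟨fun s _ => (hx s).1, fun i j hij => funext fun s => (hx s).2 i j hij⟩

/-- Products of block systems with the same index types are block systems; this is where the uniform
number of terms in the factorizations is used. -/
theorem BlockSystem.pi (hB : ∀ s, BlockSystem U (N s) (e s) (E s)) :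
    BlockSystem U (AddSubgroup.pi Set.univ N) (fun i s => e s i) (fun t s => E s t) where
  mul_mem x hx y hy s _ := (hB s).mul_mem _ (hx s trivial) _ (hy s trivial)
  left_mem x hx i s _ := (hB s).left_mem _ (hx s trivial) i
  right_mem x hx i s _ := (hB s).right_mem _ (hx s trivial) i
  idem :=
    { idem := fun i => funext fun s => (hB s).idem.idem i
      ortho := fun i j hij => funext fun s => (hB s).idem.ortho hij
      complete := by
        funext s
        rw [Finset.sum_apply]
        exact (hB s).idem.complete }
  upper x hx i j hij := funext fun s => (hB s).upper _ (hx s trivial) i j hij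
  inv y hy := by
    choose y' h1 h2 h3 h4 using fun s => (hB s).inv (y s) (hy s trivial)
    refine ⟨y', fun s _ => h1 s, funext h2, funext h3, fun k hk hyk => ?_⟩
    rw [mem_supp_pi_iff] at hyk ⊢
    exact fun s => h4 s k hk (hyk s)
  anchor_mem t := mem_supp_pi_iff.2 fun s => (hB s).anchor_mem t
  gen x hx := by
    choose r h1 h2 using fun s => (hB s).gen (x s) (mem_supp_pi_iff.1 hx s)
    refine ⟨fun t s => r s t, fun t => mem_supp_pi_iff.2 fun s => h1 s t, funext fun s => ?_⟩
    rw [Finset.sum_apply]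
    exact h2 s
  fac i j k hijk x hx := by
    choose p r h1 h2 h3 using fun s => (hB s).fac i j k hijk (x s) (mem_supp_pi_iff.1 hx s)
    refine ⟨fun t s => p s t, fun t s => r s t, fun t => mem_supp_pi_iff.2 fun s => h1 s t,
      fun t => mem_supp_pi_iff.2 fun s => h2 s t, funext fun s => ?_⟩
    rw [Finset.sum_apply]
    exact h3 s
  syz k hk hsum := by
    choose r q h1 h2 h3 h4 using fun s => (hB s).syz (fun t => k t s)
      (fun t => mem_supp_pi_iff.1 (hk t) s) (by simpa using congrFun hsum s)
    refine ⟨fun u t s => r s u t, fun u s => q s u, fun u t => mem_supp_pi_iff.2 fun s => h1 s u t,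
      fun u => mem_supp_pi_iff.2 fun s => h2 s u, fun t => funext fun s => ?_,
      fun u => funext fun s => ?_⟩
    · rw [Finset.sum_apply]
      exact h3 s t
    · rw [Finset.sum_apply]
      exact h4 s u

end Pi

end UnipPres

namespace UnipPres

open scoped Polynomial commutatorElement

/-! ### The area bound -/

section Area

universe u

/-- The groups of the theorem together with three cuts, for a fixed bound `L` on the quotient of
the size `n` by the step `h`. -/
structure CutGroup (L : ℕ) : Type (u + 1) where
  F : Type u
  [field : Field F]
  n : ℕ
  κ : ℕ
  h : ℕ
  ℓ₁ : ℕ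
  ℓ₂ : ℕ
  ℓ₃ : ℕ
  isCut : IsCut n h L ℓ₁ ℓ₂ ℓ₃

attribute [instance] CutGroup.field

/-- The three staircase subgroups. -/
def CutGroup.stairs {L : ℕ} (p : CutGroup.{u} L) : Fin 3 → Subgroup (GrUnip p.F p.n p.κ) :=
  ![stair p.F p.n p.κ p.ℓ₁, stair p.F p.n p.κ p.ℓ₂, stair p.F p.n p.κ p.ℓ₃]

/-- The cut before a block that gives the `i`-th staircase subgroup. -/
def cutOf : Fin 3 → Fin 5 := ![1, 3, 4]

theorem cutOf_mem (i : Fin 3) : cutOf i ∈ cuts := by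
  revert i
  decide

theorem exists_cutOf_eq {k : Fin 5} (hk : k ∈ cuts) : ∃ i, cutOf i = k := by
  revert k
  decide

theorem CutGroup.toMat_sub_one_mem_supp_iff {L : ℕ} (p : CutGroup.{u} L) (i : Fin 3)
    (g : GrUnip p.F p.n p.κ) :
    toMat g - 1 ∈ supp (gradedStrict p.F p.n p.κ) (blockIdem p.F p.n p.h p.ℓ₁ p.ℓ₂ p.ℓ₃)
      (cutSet (cutOf i)) ↔ g ∈ p.stairs i := by
  rw [UnipPres.toMat_sub_one_mem_supp_iff p.isCut (cutOf_mem i)]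
  fin_cases i <;> rfl

/-- The colimit of the three staircase subgroups embeds, also for a product of a sequence of
groups. -/
theorem CutGroup.colimitInjective {L : ℕ} (s : ℕ → CutGroup.{u} L) :
    ColimitInjective fun i => Subgroup.pi Set.univ fun k => (s k).stairs i := by
  intro Γ _ θ hθ W hW hprod
  have hB := BlockSystem.pi fun k =>
    blockSystem_gradedStrict (F := (s k).F) (κ := (s k).κ) (s k).isCut
  -- the tuple of nilpotent matrices of an element of the product
  let Y : (∀ k, GrUnip (s k).F (s k).n (s k).κ) →
      ∀ k, Matrix (Fin ((s k).n + 1)) (Fin ((s k).n + 1)) (s k).F[X] := fun g k => toMat (g k) - 1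
  have hYinj : Function.Injective Y := fun g g' hgg => funext fun k =>
    toMat_injective (sub_left_injective (congrFun hgg k))
  have hYmul : ∀ g g', Y (g * g') = Y g + Y g' + Y g * Y g' := by
    intro g g'
    funext k
    change toMat (g k * g' k) - 1 =
      (toMat (g k) - 1) + (toMat (g' k) - 1) + (toMat (g k) - 1) * (toMat (g' k) - 1)
    rw [map_mul]
    noncomm_ring
  have hYmem : ∀ i g, Y g ∈ supp (AddSubgroup.pi Set.univ fun k =>
      gradedStrict (s k).F (s k).n (s k).κ) (fun j k =>
        blockIdem (s k).F (s k).n (s k).h (s k).ℓ₁ (s k).ℓ₂ (s k).ℓ₃ j) (cutSet (cutOf i)) ↔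
      g ∈ Subgroup.pi Set.univ fun k => (s k).stairs i := by
    intro i g
    rw [mem_supp_pi_iff, Subgroup.mem_pi]
    exact forall_congr' fun k => ((s k).toMat_sub_one_mem_supp_iff i (g k)).trans (by simp)
  have hYsurj : ∀ y ∈ AddSubgroup.pi Set.univ fun k =>
      gradedStrict (s k).F (s k).n (s k).κ, ∃ g, Y g = y := by
    intro y hy
    choose g hg using fun k => exists_toMat_eq (hy k trivial)
    exact ⟨g, funext fun k => by simp only [Y, hg, add_sub_cancel_left]⟩
  have hX : IsLocalHom (AddSubgroup.pi Set.univ fun k => gradedStrict (s k).F (s k).n (s k).κ)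
      (fun j k => blockIdem (s k).F (s k).n (s k).h (s k).ℓ₁ (s k).ℓ₂ (s k).ℓ₃ j)
      (fun y => θ (Function.invFun Y y)) := by
    refine ⟨fun c hc y hy z hz => ?_⟩
    obtain ⟨i, rfl⟩ := exists_cutOf_eq hc
    obtain ⟨g, rfl⟩ := hYsurj y hy.1
    obtain ⟨g', rfl⟩ := hYsurj z hz.1
    rw [← hYmul, Function.leftInverse_invFun hYinj, Function.leftInverse_invFun hYinj,
      Function.leftInverse_invFun hYinj]
    exact hθ i _ ((hYmem i g).1 hy) _ ((hYmem i g').1 hz)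
  have key := prod_map_eq_one hB hX (W.map Y) ?_ ?_
  · rw [List.map_map] at key
    rw [← key]
    congr 1
    exact List.map_congr_left fun g _ => by
      rw [Function.comp_apply, Function.leftInverse_invFun hYinj]
  · intro y hy
    obtain ⟨g, hg, rfl⟩ := List.mem_map.1 hy
    obtain ⟨i, hi⟩ := hW g hg
    exact ⟨cutOf i, cutOf_mem i, (hYmem i g).2 hi⟩
  · have h1 : ∀ g, 1 + Y g = MonoidHom.pi (fun k => toMat.comp (Pi.evalMonoidHom
        (fun k => GrUnip (s k).F (s k).n (s k).κ) k)) g := fun g => funext fun k =>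
      add_sub_cancel 1 (toMat (g k))
    rw [List.map_map, show ((fun y => 1 + y) ∘ Y) = _ from funext h1, ← map_list_prod, hprod,
      map_one]

theorem exists_garea_stairs_le (L T : ℕ) : ∃ C : ℕ, ∀ p : CutGroup.{u} L,
    garea p.stairs T ≤ C :=
  exists_garea_le (fun p : CutGroup.{u} L => GrUnip p.F p.n p.κ) (fun p => p.stairs)
    CutGroup.colimitInjective T

end Area

end UnipPres

namespace UnipPres

open scoped Polynomial commutatorElement

/-! ### The diameter bound -/

section Diameter

variable {n h L ℓ₁ ℓ₂ ℓ₃ : ℕ} {F : Type*} [Field F] {κ : ℕ}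

/-- A matrix is the sum of its part at the block positions in `W` and of the rest. -/
theorem exists_split {Z : Finset (Fin 5 × Fin 5)} (W : Finset (Fin 5 × Fin 5))
    {y : Matrix (Fin (n + 1)) (Fin (n + 1)) F[X]}
    (hy : y ∈ supp (gradedStrict F n κ) (blockIdem F n h ℓ₁ ℓ₂ ℓ₃) Z) :
    ∃ x ∈ supp (gradedStrict F n κ) (blockIdem F n h ℓ₁ ℓ₂ ℓ₃) (Z ∩ W),
      ∃ z ∈ supp (gradedStrict F n κ) (blockIdem F n h ℓ₁ ℓ₂ ℓ₃) (Z \ W), y = x + z := by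
  rw [mem_supp_iff] at hy
  refine ⟨Matrix.of fun k l => if (blk h ℓ₁ ℓ₂ ℓ₃ k, blk h ℓ₁ ℓ₂ ℓ₃ l) ∈ W then y k l else 0,
    mem_supp_iff.2 ⟨fun k l => ?_, fun k l hne => ?_⟩,
    Matrix.of fun k l => if (blk h ℓ₁ ℓ₂ ℓ₃ k, blk h ℓ₁ ℓ₂ ℓ₃ l) ∈ W then 0 else y k l,
    mem_supp_iff.2 ⟨fun k l => ?_, fun k l hne => ?_⟩, ?_⟩
  · rw [Matrix.of_apply]
    split_ifs
    · exact hy.1 k l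
    · simp
  · rw [Matrix.of_apply] at hne
    split_ifs at hne with hW
    · exact Finset.mem_inter.2 ⟨hy.2 k l hne, hW⟩
    · exact absurd rfl hne
  · rw [Matrix.of_apply]
    split_ifs
    · simp
    · exact hy.1 k l
  · rw [Matrix.of_apply] at hne
    split_ifs at hne with hW
    · exact absurd rfl hne
    · exact Finset.mem_sdiff.2 ⟨hy.2 k l hne, hW⟩
  · ext1 k l
    rw [Matrix.add_apply, Matrix.of_apply, Matrix.of_apply]
    split_ifs <;> simp

theorem mem_stair_of_mem_supp (H : IsCut n h L ℓ₁ ℓ₂ ℓ₃) {c : Fin 5} (hc : c ∈ cuts)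
    {g : GrUnip F n κ} {y : Matrix (Fin (n + 1)) (Fin (n + 1)) F[X]} (hg : toMat g = 1 + y)
    (hy : y ∈ supp (gradedStrict F n κ) (blockIdem F n h ℓ₁ ℓ₂ ℓ₃) (cutSet c)) :
    g ∈ stair F n κ (cutPos ℓ₁ ℓ₂ ℓ₃ c) := by
  rw [← toMat_sub_one_mem_supp_iff H hc, hg, add_sub_cancel_left]
  exact hy

/-- Every element is a bounded product of elements of the first two staircase subgroups: after
splitting off the block diagonal part for the second cut and the rows outside `A`, what remains
is a product of the commutators of the anchors with elements of the first staircase subgroup. -/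
theorem exists_word_prod_eq (H : IsCut n h L ℓ₁ ℓ₂ ℓ₃) (g : GrUnip F n κ) :
    ∃ W : List (GrUnip F n κ), W.length ≤ 4 * (L * L) + 2 ∧
      (∀ x ∈ W, x ∈ stair F n κ ℓ₁ ∨ x ∈ stair F n κ ℓ₂) ∧ W.prod = g := by
  have hB := blockSystem_gradedStrict (F := F) (κ := κ) H
  set E := fun t : Fin L × Fin L =>
    anchor F κ h ℓ₁ (fun k : Fin (n + 1) => blk h ℓ₁ ℓ₂ ℓ₃ k = 0) (fun _ => 0) t with hE
  obtain ⟨y, hy⟩ : ∃ y, toMat g = 1 + y := ⟨toMat g - 1, (add_sub_cancel _ _).symm⟩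
  have hyN : y ∈ gradedStrict F n κ := by
    have := toMat_sub_one_mem g
    rwa [hy, add_sub_cancel_left] at this
  -- split off the block diagonal part for the second cut
  obtain ⟨d, hd, x, hx, hdx⟩ := exists_split (cutSet 3) (hB.mem_supp_upper hyN)
  have hd : d ∈ supp (gradedStrict F n κ) (blockIdem F n h ℓ₁ ℓ₂ ℓ₃) (cutSet 3) := supp_mono hd
  have hx : x ∈ supp (gradedStrict F n κ) (blockIdem F n h ℓ₁ ℓ₂ ℓ₃)
      (({0, 1, 2} : Finset (Fin 5)) ×ˢ {3, 4}) := supp_mono hx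
  obtain ⟨d', -, -, hd2, hd3⟩ := hB.inv d hd.1
  have hd' := hd3 3 (by decide) hd
  have hv : x + x * d' ∈ supp (gradedStrict F n κ) (blockIdem F n h ℓ₁ ℓ₂ ℓ₃)
      (({0, 1, 2} : Finset (Fin 5)) ×ˢ {3, 4}) := add_mem hx (hB.mul_mem_supp hx hd')
  have hyv : 1 + y = (1 + (x + x * d')) * (1 + d) := by
    have h1 : (1 + (x + x * d')) * (1 + d) = 1 + d + x + x * (d' + d + d' * d) := by noncomm_ring
    rw [h1, hd2, hdx, mul_zero, add_zero, add_assoc]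
  obtain ⟨v, hvA, w, hwB, hvw⟩ := exists_split {(0, 3), (0, 4)} hv
  have hvA : v ∈ supp (gradedStrict F n κ) (blockIdem F n h ℓ₁ ℓ₂ ℓ₃) {(0, 3), (0, 4)} :=
    supp_mono hvA
  have hwB : w ∈ supp (gradedStrict F n κ) (blockIdem F n h ℓ₁ ℓ₂ ℓ₃)
    (({1, 2} : Finset (Fin 5)) ×ˢ {3, 4}) := supp_mono hwB
  obtain ⟨r, hr, hvr⟩ := hB.gen v hvA
  obtain ⟨gd, hgd⟩ := exists_toMat_eq hd.1
  obtain ⟨gw, hgw⟩ := exists_toMat_eq hwB.1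
  choose a ha using fun t => exists_toMat_eq (hB.anchor_mem t).1
  choose b hb using fun t => exists_toMat_eq (hr t).1
  have hEr : ∀ t, E t * r t ∈
      supp (gradedStrict F n κ) (blockIdem F n h ℓ₁ ℓ₂ ℓ₃) {(0, 3), (0, 4)} := fun t =>
    hB.mul_mem_supp (hB.anchor_mem t) (hr t)
  have hcomm : ∀ t, toMat ⁅a t, b t⁆ = 1 + E t * r t := by
    intro t
    obtain ⟨c, hc⟩ := exists_toMat_eq (hEr t).1
    rw [← hc]
    congr 1
    rw [commutatorElement_def, mul_assoc, ← mul_inv_rev, mul_inv_eq_iff_eq_mul]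
    apply toMat_injective
    rw [map_mul, map_mul, map_mul, ha, hb, hc]
    have h1 : r t * E t = 0 := hB.mul_eq_zero_of_supp (hr t) (hB.anchor_mem t)
    have h2 : E t * r t * E t = 0 := by rw [mul_assoc, h1, mul_zero]
    have h3 : E t * r t * r t = 0 := hB.mul_eq_zero_of_supp (hEr t) (hr t)
    have h4 : (1 + E t * r t) * ((1 + r t) * (1 + E t)) = 1 + r t + E t + E t * r t + r t * E t +
        E t * r t * r t + E t * r t * E t + E t * (r t * (r t * E t)) := by noncomm_ring
    change (1 + E t) * (1 + r t) = (1 + E t * r t) * ((1 + r t) * (1 + E t))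
    rw [h4, h1, h2, h3]
    noncomm_ring
  have hprod : ∀ l : List (Fin L × Fin L),
      toMat (l.map fun t => ⁅a t, b t⁆).prod = 1 + (l.map fun t => E t * r t).sum := by
    intro l
    induction l with
    | nil => simp
    | cons t l ih =>
      have h1 : (l.map fun t => E t * r t).sum ∈
          supp (gradedStrict F n κ) (blockIdem F n h ℓ₁ ℓ₂ ℓ₃) {(0, 3), (0, 4)} :=
        list_sum_mem fun z hz => by
          obtain ⟨t', -, rfl⟩ := List.mem_map.1 hz
          exact hEr t'
      rw [List.map_cons, List.prod_cons, map_mul, ih, hcomm, one_add_mul_one_add,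
        hB.mul_eq_zero_of_supp (hEr t) h1, add_zero, List.map_cons, List.sum_cons]
  have h1 : ∀ {c : GrUnip F n κ} {z}, toMat c = 1 + z →
      z ∈ supp (gradedStrict F n κ) (blockIdem F n h ℓ₁ ℓ₂ ℓ₃) (cutSet 1) →
      c ∈ stair F n κ ℓ₁ := fun hc hz => mem_stair_of_mem_supp H (c := 1) (by decide) hc hz
  have h2 : ∀ {c : GrUnip F n κ} {z}, toMat c = 1 + z →
      z ∈ supp (gradedStrict F n κ) (blockIdem F n h ℓ₁ ℓ₂ ℓ₃) (cutSet 3) →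
      c ∈ stair F n κ ℓ₂ := fun hc hz => mem_stair_of_mem_supp H (c := 3) (by decide) hc hz
  have ha' : ∀ t, a t ∈ stair F n κ ℓ₂ := fun t => h2 (ha t) (supp_mono (hB.anchor_mem t))
  have hb' : ∀ t, b t ∈ stair F n κ ℓ₁ := fun t => h1 (hb t) (supp_mono (hr t))
  refine ⟨((Finset.univ : Finset (Fin L × Fin L)).toList.map fun t =>
    [a t, b t, (a t)⁻¹, (b t)⁻¹]).flatten ++ [gw, gd], ?_, ?_, ?_⟩
  · simp [List.length_flatten, Function.comp_def, mul_comm]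
  · intro z hz
    simp only [List.mem_append, List.mem_flatten, List.mem_map, List.mem_cons, List.not_mem_nil,
      or_false] at hz
    obtain ⟨_, ⟨t, -, rfl⟩, hz⟩ | rfl | rfl := hz
    · simp only [List.mem_cons, List.not_mem_nil, or_false] at hz
      obtain rfl | rfl | rfl | rfl := hz
      · exact Or.inr (ha' t)
      · exact Or.inl (hb' t)
      · exact Or.inr (inv_mem (ha' t))
      · exact Or.inl (inv_mem (hb' t))
    · exact Or.inl (h1 hgw (supp_mono hwB))
    · exact Or.inr (h2 hgd hd)
  · apply toMat_injective
    have h3 : (((Finset.univ : Finset (Fin L × Fin L)).toList.map fun t =>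
        [a t, b t, (a t)⁻¹, (b t)⁻¹]).flatten).prod =
        ((Finset.univ : Finset (Fin L × Fin L)).toList.map fun t => ⁅a t, b t⁆).prod := by
      rw [List.prod_flatten, List.map_map]
      congr 1
      refine List.map_congr_left fun t _ => ?_
      simp [commutatorElement_def, mul_assoc]
    rw [List.prod_append, h3, map_mul, hprod, Finset.sum_map_toList, ← hvr, List.prod_cons,
      List.prod_singleton, map_mul, hgw, hgd, ← mul_assoc, one_add_mul_one_add,
      hB.mul_eq_zero_of_supp hvA hwB, add_zero, ← hvw, hy, hyv]

theorem gdiam_stair_le (H : IsCut n h L ℓ₁ ℓ₂ ℓ₃) :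
    gdiam ![stair F n κ ℓ₁, stair F n κ ℓ₂] ≤ (4 * (L * L) + 2 : ℕ) := by
  refine iSup_le fun g => ?_
  obtain ⟨W, hlen, hW, hprod⟩ := exists_word_prod_eq H g
  have hmem : ∀ x ∈ W, ∃ i, x ∈ (![stair F n κ ℓ₁, stair F n κ ℓ₂] : Fin 2 → _) i := fun x hx =>
    (hW x hx).elim (fun h' => ⟨0, h'⟩) (fun h' => ⟨1, h'⟩)
  refine (iInf₂_le (W.attach.map fun x => ⟨x.1, hmem x.1 x.2⟩) ?_).trans ?_
  · rw [SubWord.eval, List.map_map, ← hprod]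
    congr 1
    exact List.attach_map_subtype_val W
  · rw [List.length_map, List.length_attach]
    exact_mod_cast hlen

end Diameter

/-! ### The choice of the step -/

/-- For large `n`, long gaps leave room for the step `h = ⌊ξ n / 4⌋`, and the number of steps
needed to cover `n` stays bounded. -/
theorem exists_isCut {ξ : ℝ} (hξ : 0 < ξ) : ∃ L : ℕ, ∀ᶠ n : ℕ in Filter.atTop,
    ∀ ℓ₁ ℓ₂ ℓ₃ : ℕ, ℓ₃ ≤ n → ξ * n ≤ (ℓ₂ : ℝ) - ℓ₁ → ξ * n ≤ (ℓ₃ : ℝ) - ℓ₂ →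
      ∃ h, IsCut n h L ℓ₁ ℓ₂ ℓ₃ := by
  -- for `8 ≤ ξ n` the step `⌊ξ n / 4⌋` is at least `ξ n / 8`, and `16 / ξ` of these exceed `n`
  refine ⟨⌈16 / ξ⌉₊ + 1, ?_⟩
  filter_upwards [Filter.eventually_ge_atTop ⌈8 / ξ⌉₊, Filter.eventually_ge_atTop 1]
    with n hn hn1 ℓ₁ ℓ₂ ℓ₃ h3 h12 h23
  have hn' : 8 ≤ ξ * n := by
    have := (div_le_iff₀ hξ).1 (Nat.ceil_le.1 hn)
    linarith
  have hn1' : (1 : ℝ) ≤ n := by exact_mod_cast hn1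
  have hfl : (⌊ξ * n / 4⌋₊ : ℝ) ≤ ξ * n / 4 := Nat.floor_le (by positivity)
  have hfl' : ξ * n / 4 - 1 < (⌊ξ * n / 4⌋₊ : ℝ) := Nat.sub_one_lt_floor _
  have hceil : 16 / ξ ≤ (⌈16 / ξ⌉₊ : ℝ) := Nat.le_ceil _
  refine ⟨⌊ξ * n / 4⌋₊, ?_, ?_, ?_, h3, ?_⟩
  · rw [Nat.floor_pos]
    linarith
  · have : (ℓ₁ : ℝ) + 4 * (⌊ξ * n / 4⌋₊ : ℝ) ≤ ℓ₂ := by linarith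
    exact_mod_cast this
  · have : (ℓ₂ : ℝ) + 2 * (⌊ξ * n / 4⌋₊ : ℝ) ≤ ℓ₃ := by linarith
    exact_mod_cast this
  · rw [Nat.add_sub_cancel]
    have h4 : 16 / ξ * (ξ * n / 8) = 2 * n := by
      field_simp
      norm_num
    have h5 : 16 / ξ * (ξ * n / 8) ≤ (⌈16 / ξ⌉₊ : ℝ) * (⌊ξ * n / 4⌋₊ : ℝ) :=
      mul_le_mul hceil (by linarith) (by positivity) (Nat.cast_nonneg _)
    have : (n : ℝ) + 1 ≤ (⌈16 / ξ⌉₊ : ℝ) * (⌊ξ * n / 4⌋₊ : ℝ) := by linarith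
    exact_mod_cast this

end UnipPres

theorem theorem1p4 (ξ : ℝ) (hξ : 0 < ξ) :
    ∃ C₀ C : ℕ, ∀ᶠ n : ℕ in Filter.atTop,
      ∀ (F : Type*) [Field F] (κ : ℕ), 1 ≤ κ →
        ∀ ℓ₁ ℓ₂ ℓ₃ : ℕ, 1 ≤ ℓ₁ → ℓ₁ < ℓ₂ → ℓ₂ < ℓ₃ → ℓ₃ ≤ n →
          ξ * n ≤ (ℓ₂ : ℝ) - ℓ₁ → ξ * n ≤ (ℓ₃ : ℝ) - ℓ₂ →
            UnipPres.gdiam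
                ![UnipPres.stair F n κ ℓ₁, UnipPres.stair F n κ ℓ₂] ≤ C₀ ∧
            UnipPres.garea
                ![UnipPres.stair F n κ ℓ₁, UnipPres.stair F n κ ℓ₂, UnipPres.stair F n κ ℓ₃]
                (2 * C₀ + 1) ≤ C := by
  obtain ⟨L, hL⟩ := UnipPres.exists_isCut hξ
  obtain ⟨C, hC⟩ := UnipPres.exists_garea_stairs_le L (2 * (4 * (L * L) + 2) + 1)
  refine ⟨4 * (L * L) + 2, C, ?_⟩
  filter_upwards [hL] with n hn F _ κ _ ℓ₁ ℓ₂ ℓ₃ _ _ _ h3 h12 h23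
  obtain ⟨h, H⟩ := hn ℓ₁ ℓ₂ ℓ₃ h3 h12 h23
  exact ⟨UnipPres.gdiam_stair_le H, hC ⟨F, n, κ, h, ℓ₁, ℓ₂, ℓ₃, H⟩⟩
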